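/- Let $\mathbb B_n$ be the open unit ball of $\mathbb C^n$, $v$ Lebesgue measure normalized by $v(\mathbb B_n)=1$, and $\langle z,w\rangle=\sum_k z_k\overline{w_k}$. Let $L^2_a(\mathbb B_n)$ be the Bergman space of holomorphic functions $f$ on $\mathbb B_n$ with $\|f\|^2=\int_{\mathbb B_n}|f|^2\,dv<\infty$. For an ideal $I\subset\mathbb C[z_1,\dots,z_n]$ let $\mathcal P_I$ be the closure of $I$ in $L^2_a(\mathbb B_n)$. Let $\beta(z,w)=\frac12\log\frac{1+\rho(z,w)}{1-\rho(z,w)}$, $\rho(z,w)=|\varphi_z(w)|$, be the Bergman metric of $\mathbb B_n$, where $\varphi_z(w)=\frac{z-P_zw-(1-|z|^2)^{1/2}Q_zw}{1-\langle w,z\rangle}$, $P_z$ and $Q_z$ being the orthogonal projections of $\mathbb C^n$ onto $\mathbb Cz$ and $z^\perp$. For $E\subset\mathbb B_n$ and $r>0$ put $E^{(r)}=\{w\in\mathbb B_n:\inf_{z\in E}\beta(w,z)<r\}$ (empty if $E=\emptyset$). **Hypothesis 1** on $I$: there are positive integers $N,M$ and $C>0$ such that for every sufficiently small $\epsilon>0$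 there is $R_0>0$ such that for every $R>R_0$ there are $0<\delta<1$, $C'>0$, finite or countably infinite families $\{E_i\}_{i\in\Lambda}$, $\{F_i\}_{i\in\Lambda}$ of open sets, each family covering $\{z\in\mathbb B_n:|z|>\delta\}$, and for each $i$ a finite or countably infinite family $\{p_{ij}\}_{j\in\Gamma_i}\subset I$, with the following properties. 1. $E_i\subset F_i\subset\mathbb B_n$ and $E_i^{(3R)}\subset F_i$ for all $i$, and every $z\in\mathbb B_n$ belongs to $F_i$ for at most $M$ indices $i$. 2. $\deg p_{ij}<N$ for all $i,j$. 3. For each $i$ there are linear maps $f\mapsto f_{ij}$, $j\in\Gamma_i$, from $\mathcal P_I$ to the holomorphic functions on $E_i^{(3R)}$, such that for all $f\in\mathcal P_I$ $$\int_{E_i^{(3R)}}\Big|\sum_{j}p_{ij}f_{ij}-f\Big|^2dv\le\epsilon\int_{F_i}|f|^2dv,\qquad \int_{E_i^{(3R)}}\Big(\sum_{j}|p_{ij}f_{ij}|\Big)^2dv\le C\int_{F_i}|f|^2dv,$$ $$\int_{E_i^{(3R)}}\Big(\sum_{j}|p_{ij}(\lambda)f_{ij}(\lambda)|\Big)^2(1-|\lambda|^2)\,dv(\lambda)\le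 C'\int_{F_i}|f(\lambda)|^2(1-|\lambda|^2)\,dv(\lambda).$$ **Theorem.** Let $I\subset\mathbb C[z_1,\dots,z_n]$ be an ideal that satisfies Hypothesis 1. Then $\mathcal P_I$, a closed subspace of $L^2_a(\mathbb B_n)$ invariant under multiplication by $z_1,\dots,z_n$, has the asymptotic stable division property with generating functions that are polynomials of bounded degree. That is, there are a finite or countably infinite family $\{h_i\}_{i\in\Lambda}\subset\mathcal P_I$ of polynomials whose degrees are bounded by one constant, a bounded linear operator $T$ on $\mathcal P_I$ with bounded inverse, and constants $C_1,C_2$, such that for every $f\in\mathcal P_I$ there are holomorphic functions $\{g_i\}_{i\in\Lambda}$ on $\mathbb B_n$ with 1. $Tf=\sum_{i\in\Lambda}h_ig_i$ pointwise on $\mathbb B_n$; 2. $\displaystyle\int_{\mathbb B_n}\Big(\sum_{i\in\Lambda}|h_ig_i|\Big)^2dv\le C_1\int_{\mathbb B_n}|f|^2dv$; 3. $\displaystyle\int_{\mathbb B_n}\Big(\sum_{i\in\Lambda}|h_i(z)g_i(z)|\Big)^2(1-|z|^2)\,dv(z)\le C_2\int_{\mathbb B_n}|f(z)|^2(1-|z|^2)\,dv(z)$.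 -/

import Mathlib

open MeasureTheory
open scoped ENNReal

namespace BergmanASD

/-- The Hermitian space `ℂⁿ`. Mathlib's `inner ℂ x y` is linear in the second variable, so the
product `⟨z, w⟩ = ∑ zᵢ conj wᵢ` of several complex variables is `inner ℂ w z`. -/
abbrev Cn (n : ℕ) : Type := EuclideanSpace ℂ (Fin n)

/-- The open unit ball of `ℂⁿ`. -/
def ball (n : ℕ) : Set (Cn n) := Metric.ball 0 1

/-- Lebesgue measure on the unit ball, normalized to total mass one (regarded as a measure on `ℂⁿ`
that is carried by the ball). -/
noncomputable def ballMeasure (n : ℕ) : Measure (Cn n) :=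
  (volume (ball n))⁻¹ • volume.restrict (ball n)

lemma ballMeasure_eq_cond (n : ℕ) :
    ballMeasure n = ProbabilityTheory.cond volume (ball n) := rfl

instance isProbabilityMeasure_ballMeasure (n : ℕ) : IsProbabilityMeasure (ballMeasure n) := by
  rw [ballMeasure_eq_cond]
  exact ProbabilityTheory.cond_isProbabilityMeasure_of_finite
    (Metric.measure_ball_pos volume (0 : Cn n) one_pos).ne' measure_ball_lt_top.ne

lemma ae_mem_ball (n : ℕ) : ∀ᵐ z ∂(ballMeasure n), z ∈ ball n :=
  Measure.ae_smul_measure (ae_restrict_mem Metric.isOpen_ball.measurableSet) _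

/-! ### The Bergman space -/

/-- The Bergman space: the square integrable functions (as classes in `L²` of the ball) that have
a holomorphic representative. It carries the norm and inner product of `L²`. -/
noncomputable def bergmanSpace (n : ℕ) : Submodule ℂ (Lp ℂ 2 (ballMeasure n)) where
  carrier := {F | ∃ f : Cn n → ℂ, DifferentiableOn ℂ f (ball n) ∧ F =ᵐ[ballMeasure n] f}
  add_mem' := by
    rintro F G ⟨f, hf, hFf⟩ ⟨g, hg, hGg⟩
    exact ⟨f + g, hf.add hg, (Lp.coeFn_add F G).trans (hFf.add hGg)⟩
  zero_mem' := ⟨0, differentiableOn_const 0, Lp.coeFn_zero ℂ 2 _⟩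
  smul_mem' := by
    rintro c F ⟨f, hf, hFf⟩
    exact ⟨c • f, hf.const_smul c, (Lp.coeFn_smul c F).trans (hFf.const_smul c)⟩

/-- The holomorphic function on the ball given by an element of the Bergman space. Only its values
on the ball matter, and there it is uniquely determined, by continuity. -/
noncomputable def fn {n : ℕ} (f : bergmanSpace n) : Cn n → ℂ := Classical.choose f.2

lemma differentiableOn_fn {n : ℕ} (f : bergmanSpace n) : DifferentiableOn ℂ (fn f) (ball n) :=
  (Classical.choose_spec f.2).1

lemma coe_ae_eq_fn {n : ℕ} (f : bergmanSpace n) :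
    (f : Lp ℂ 2 (ballMeasure n)) =ᵐ[ballMeasure n] fn f :=
  (Classical.choose_spec f.2).2

/-- The value of a polynomial at a point of `ℂⁿ`. -/
noncomputable def polyEval {n : ℕ} (p : MvPolynomial (Fin n) ℂ) (z : Cn n) : ℂ :=
  MvPolynomial.eval (fun k => z k) p

lemma differentiable_polyEval {n : ℕ} (p : MvPolynomial (Fin n) ℂ) :
    Differentiable ℂ (polyEval p) := by
  unfold polyEval
  induction p using MvPolynomial.induction_on with
  | C a => simp
  | add p q hp hq =>
    simp only [map_add]
    exact hp.fun_add hq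
  | mul_X p i hp =>
    simp only [map_mul, MvPolynomial.eval_X]
    exact hp.fun_mul (EuclideanSpace.proj (𝕜 := ℂ) i).differentiable

lemma memLp_polyEval {n : ℕ} (p : MvPolynomial (Fin n) ℂ) :
    MemLp (polyEval p) 2 (ballMeasure n) := by
  have hc : Continuous (polyEval p) := (differentiable_polyEval p).continuous
  obtain ⟨C, hC⟩ := (isCompact_closedBall (0 : Cn n) 1).exists_bound_of_continuousOn hc.continuousOn
  refine MemLp.of_bound hc.aestronglyMeasurable C ?_
  filter_upwards [ae_mem_ball n] with z hz
  exact hC z (Metric.ball_subset_closedBall hz)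

/-- A polynomial, as an element of the Bergman space. -/
noncomputable def polyToBergman (n : ℕ) : MvPolynomial (Fin n) ℂ →ₗ[ℂ] bergmanSpace n where
  toFun p := ⟨(memLp_polyEval p).toLp (polyEval p), polyEval p,
    (differentiable_polyEval p).differentiableOn, MemLp.coeFn_toLp _⟩
  map_add' p q := by
    refine Subtype.ext ?_
    exact (MemLp.toLp_congr (memLp_polyEval (p + q)) ((memLp_polyEval p).add (memLp_polyEval q)) (Filter.Eventually.of_forall fun z => by simp [polyEval])).trans
      (MemLp.toLp_add (memLp_polyEval p) (memLp_polyEval q))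
  map_smul' c p := by
    refine Subtype.ext ?_
    exact (MemLp.toLp_congr (memLp_polyEval (c • p)) ((memLp_polyEval p).const_smul c) (Filter.Eventually.of_forall fun z => by
      simp [polyEval, MvPolynomial.smul_eval])).trans
      (MemLp.toLp_const_smul c (memLp_polyEval p))

/-- The closure in the Bergman space of an ideal of polynomials. -/
noncomputable def idealClosure {n : ℕ} (I : Ideal (MvPolynomial (Fin n) ℂ)) :
    Submodule ℂ (bergmanSpace n) :=
  ((I.restrictScalars ℂ).map (polyToBergman n)).topologicalClosure

/-- A (Hilbert) submodule of the Bergman space: a closed linear subspace that is invariant under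
multiplication by each coordinate function. -/
def IsHilbertSubmodule {n : ℕ} (P : Submodule ℂ (bergmanSpace n)) : Prop :=
  IsClosed (P : Set (bergmanSpace n)) ∧
    ∀ f ∈ P, ∀ (k : Fin n) (g : bergmanSpace n), (∀ z ∈ ball n, fn g z = z k * fn f z) → g ∈ P

/-! ### The Bergman metric -/

/-- The Möbius transform
`φ_z(w) = (z - P_z w - (1 - |z|²)^{1/2} Q_z w) / (1 - ⟨w, z⟩)`, where `P_z` and `Q_z` are the
orthogonal projections onto `ℂ z` and its orthogonal complement. (For `z = 0` one has `P_z = 0` and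
`φ_z(w) = -w`.) -/
noncomputable def mobius {n : ℕ} (z w : Cn n) : Cn n :=
  (1 - inner ℂ z w)⁻¹ •
    (z - (ℂ ∙ z).starProjection w
      - (Real.sqrt (1 - ‖z‖ ^ 2) : ℂ) • ((ℂ ∙ z)ᗮ).starProjection w)

/-- The pseudo-hyperbolic metric of the ball. -/
noncomputable def pseudoHyp {n : ℕ} (z w : Cn n) : ℝ := ‖mobius z w‖

/-- The hyperbolic (Bergman) metric of the ball. -/
noncomputable def bergmanDist {n : ℕ} (z w : Cn n) : ℝ :=
  1 / 2 * Real.log ((1 + pseudoHyp z w) / (1 - pseudoHyp z w))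

/-- The set of the points `w` of the ball whose Bergman distance to `E`, that is, the infimum of
`β(w, z)` over `z ∈ E`, is less than `r`. It is empty if `E` is empty. -/
def bergmanNhd {n : ℕ} (E : Set (Cn n)) (r : ℝ) : Set (Cn n) :=
  {w | w ∈ ball n ∧ ∃ z ∈ E, bergmanDist w z < r}

/-! ### The asymptotic stable division property -/

/-- The weight `1 - |z|²`, which is nonnegative on the ball. -/
noncomputable def weight {n : ℕ} (z : Cn n) : ℝ≥0∞ := ENNReal.ofReal (1 - ‖z‖ ^ 2)

/-- The submodule `P` of the Bergman space has the asymptotic stable division property with the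
generating functions `h i`, `i ∈ Λ`. The operator `T` is a bounded linear bijection of `P` with
bounded inverse, and sums and integrals of nonnegative functions take values in `[0, ∞]`. -/
def HasASDWith {n : ℕ} (P : Submodule ℂ (bergmanSpace n)) {Λ : Type} (h : Λ → bergmanSpace n) :
    Prop :=
  IsHilbertSubmodule P ∧ (∀ i, h i ∈ P) ∧
  ∃ (T : P ≃L[ℂ] P) (C₁ C₂ : ℝ), ∀ f : P, ∃ g : Λ → Cn n → ℂ,
    (∀ i, DifferentiableOn ℂ (g i) (ball n)) ∧
    (∀ z ∈ ball n, HasSum (fun i => fn (h i) z * g i z) (fn (T f : bergmanSpace n) z)) ∧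
    ∫⁻ z, (∑' i, ‖fn (h i) z * g i z‖ₑ) ^ 2 ∂(ballMeasure n) ≤
      ENNReal.ofReal C₁ * ∫⁻ z, ‖fn (f : bergmanSpace n) z‖ₑ ^ 2 ∂(ballMeasure n) ∧
    ∫⁻ z, (∑' i, ‖fn (h i) z * g i z‖ₑ) ^ 2 * weight z ∂(ballMeasure n) ≤
      ENNReal.ofReal C₂ *
        ∫⁻ z, ‖fn (f : bergmanSpace n) z‖ₑ ^ 2 * weight z ∂(ballMeasure n)

/-! ### Local decompositions -/

/-- The conditions on one family of local decompositions, for given constants: open covers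
`E i ⊆ F i` of the shell `δ < |z| < 1` and polynomials `p i j` in the ideal `I`. The linear map
`L i j` sends `f` to the coefficient `f_{ij}`, a holomorphic function on the `3R`-neighbourhood of
`E i` (its values elsewhere are irrelevant). The series `∑ j, p i j * f_{ij}` converges absolutely
almost everywhere on that neighbourhood, by the bound that follows it. -/
structure IsLocalDecomposition {n : ℕ} (I : Ideal (MvPolynomial (Fin n) ℂ)) (N M : ℕ)
    (C ε R δ C' : ℝ) {Λ : Type} {Γ : Λ → Type} (E F : Λ → Set (Cn n))
    (p : (i : Λ) → Γ i → MvPolynomial (Fin n) ℂ) : Prop where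
  isOpen_E : ∀ i, IsOpen (E i)
  isOpen_F : ∀ i, IsOpen (F i)
  cover_E : {z ∈ ball n | δ < ‖z‖} ⊆ ⋃ i, E i
  cover_F : {z ∈ ball n | δ < ‖z‖} ⊆ ⋃ i, F i
  E_subset : ∀ i, E i ⊆ F i
  F_subset : ∀ i, F i ⊆ ball n
  nhd_subset : ∀ i, bergmanNhd (E i) (3 * R) ⊆ F i
  overlap : ∀ z ∈ ball n, {i | z ∈ F i}.encard ≤ M
  mem_ideal : ∀ i j, p i j ∈ I
  degree_lt : ∀ i j, (p i j).totalDegree < N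
  decomposition : ∀ i, ∃ L : Γ i → (idealClosure I →ₗ[ℂ] (Cn n → ℂ)),
    ∀ f : idealClosure I,
      (∀ j, DifferentiableOn ℂ (L j f) (bergmanNhd (E i) (3 * R))) ∧
      ∫⁻ z in bergmanNhd (E i) (3 * R),
          ‖(∑' j, polyEval (p i j) z * L j f z) - fn (f : bergmanSpace n) z‖ₑ ^ 2
            ∂(ballMeasure n) ≤
        ENNReal.ofReal ε * ∫⁻ z in F i, ‖fn (f : bergmanSpace n) z‖ₑ ^ 2 ∂(ballMeasure n) ∧
      ∫⁻ z in bergmanNhd (E i) (3 * R),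
          (∑' j, ‖polyEval (p i j) z * L j f z‖ₑ) ^ 2 ∂(ballMeasure n) ≤
        ENNReal.ofReal C * ∫⁻ z in F i, ‖fn (f : bergmanSpace n) z‖ₑ ^ 2 ∂(ballMeasure n) ∧
      ∫⁻ z in bergmanNhd (E i) (3 * R),
          (∑' j, ‖polyEval (p i j) z * L j f z‖ₑ) ^ 2 * weight z ∂(ballMeasure n) ≤
        ENNReal.ofReal C' *
          ∫⁻ z in F i, ‖fn (f : bergmanSpace n) z‖ₑ ^ 2 * weight z ∂(ballMeasure n)

/-- The ideal `I` admits local decompositions with bounded overlap: the constants `N`, `M`, `C` are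
fixed first and serve all small `ε` and all large `R`; the radius `δ`, the constant `C'`, the covers
and the polynomials may depend on `ε` and `R`. -/
def HasLocalDecompositions {n : ℕ} (I : Ideal (MvPolynomial (Fin n) ℂ)) : Prop :=
  ∃ (N M : ℕ) (C : ℝ), 0 < N ∧ 0 < M ∧ 0 < C ∧
    ∃ ε₀ : ℝ, 0 < ε₀ ∧ ∀ ε : ℝ, 0 < ε → ε < ε₀ →
      ∃ R₀ : ℝ, 0 < R₀ ∧ ∀ R : ℝ, R₀ < R →
        ∃ δ C' : ℝ, 0 < δ ∧ δ < 1 ∧ 0 < C' ∧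
          ∃ (Λ : Type) (Γ : Λ → Type), Countable Λ ∧ (∀ i, Countable (Γ i)) ∧
            ∃ (E F : Λ → Set (Cn n)) (p : (i : Λ) → Γ i → MvPolynomial (Fin n) ℂ),
              IsLocalDecomposition I N M C ε R δ C' E F p

end BergmanASD

/-! Let `f_{ij}` be the local coefficients, and let `χ_i` be functions supported in the
`R`-neighbourhood of `E_i` that add up to one on the shell and are Lipschitz for the Bergman metric
with constant `(2M + 1) / R`. The sum of the `χ_i p_{ij} f_{ij}` is close to `f` on the shell, but
its coefficients `χ_i f_{ij}` are not holomorphic. They are therefore smoothed by a weighted Bergman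
kernel: the operator `S` has as coefficient of `p_{ij}` the function `z ↦ γ ∫ χ_i(w) f_{ij}(w) (1 -
|w|²)^l / (1 - ⟨z, w⟩)^(n + 1 + l) dv(w)` with `l = N + n + 2`, which is holomorphic.

Only the products `p_{ij} f_{ij}` are controlled, whereas in `S f` the polynomial is evaluated at
`z` and the coefficient at `w`. The bound on degrees bridges this: by `enorm_polyEval_mul_le`,
`|p(z)| |f(w)|` is at most a constant times `(|1 - ⟨z, w⟩| / (1 - |w|²))^N` times the average of `|p
f|` over a disc about `w`. On a complex line this is proved by moving the zeros of `p` out of the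
unit disc. The exponent `l` absorbs the growth and leaves the kernel `hker`, which Schur's test
bounds on `L²` with and without the weight `1 - |z|²`, and whose part at large hyperbolic distance
has small norm (`exists_farKer_bound`). At bounded distance `χ_i` is almost constant when `R` is
large, and for constant `χ_i` the truncated kernel reproduces `p_{ij} f_{ij}` exactly
(`setIntegral_near_eq`). With `m = 1 - ∑ χ_i`, it follows that `f - S f - m f` is small in `L²`
(`lintegral_err_sq_le`).

That `S f` lies in the closure of the ideal is shown by duality: the kernel is a convergent power
series in `⟨z, w⟩`, so each `p_{ij}` times the kernel is orthogonal to whatever is orthogonal to `I`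
(`exists_fn_eq_glue`).

The remainder `m f` lives on the compact ball `|z| ≤ δ`. There evaluations are uniformly
approximated by pairings with finitely many polynomials `q_k` of the ideal, so `m f` may be replaced
by a finite rank operator `V f = ∑ ℓ_k(f) q_k` when paired with elements of the closure. Altogether
`‖f - S f - V f‖ ≤ ‖f‖ / 2`, so `T = S + V` is invertible by the Neumann series, and `T f` is a
combination of the `p_{ij}` and the `q_k`. The two norm estimates come from the Schur bounds for
`hker` and from the boundedness of the `ℓ_k`. -/

namespace BergmanASD

/-! ### Algebra of the Möbius transforms -/

section Mobius

variable {n : ℕ}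

/-- The defect `1 - |z|²`. -/
noncomputable def om (z : Cn n) : ℝ := 1 - ‖z‖ ^ 2

lemma mem_ball_iff {z : Cn n} : z ∈ ball n ↔ ‖z‖ < 1 := by simp [ball]

lemma isOpen_ball (n : ℕ) : IsOpen (ball n) := Metric.isOpen_ball

lemma zero_mem_ball (n : ℕ) : (0 : Cn n) ∈ ball n := by simp [ball]

lemma om_pos {z : Cn n} (hz : z ∈ ball n) : 0 < om z := by
  rw [mem_ball_iff] at hz
  unfold om
  nlinarith [norm_nonneg z]

lemma mem_ball_of_om_pos {z : Cn n} (hz : 0 < om z) : z ∈ ball n := by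
  rw [mem_ball_iff]
  unfold om at hz
  nlinarith [norm_nonneg z]

lemma om_le_one (z : Cn n) : om z ≤ 1 := by
  unfold om
  nlinarith [sq_nonneg ‖z‖]

lemma continuous_om : Continuous (om (n := n)) := by
  unfold om
  fun_prop

/-- The linear part `P_a + (1 - |a|²)^{1/2} Q_a` of the Möbius transform. -/
noncomputable def mobLin (a : Cn n) : Cn n →L[ℂ] Cn n :=
  (ℂ ∙ a).starProjection + (Real.sqrt (om a) : ℂ) • ((ℂ ∙ a)ᗮ).starProjection

lemma mobius_eq (a u : Cn n) : mobius a u = (1 - inner ℂ a u)⁻¹ • (a - mobLin a u) := by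
  simp [mobius, mobLin, om, sub_sub]

lemma mobLin_self (a : Cn n) : mobLin a a = a := by
  have h1 : (ℂ ∙ a).starProjection a = a :=
    Submodule.starProjection_eq_self_iff.2 (Submodule.mem_span_singleton_self a)
  simp [mobLin, h1, Submodule.starProjection_orthogonal_val]

lemma inner_mobLin_left (a u v : Cn n) :
    inner ℂ (mobLin a u) v = inner ℂ u (mobLin a v) := by
  simp only [mobLin, add_apply, smul_apply, inner_add_left,
    inner_add_right, inner_smul_left, inner_smul_right, Complex.conj_ofReal,
    Submodule.inner_starProjection_left_eq_right]

lemma norm_sq_smul_starProjection (a u : Cn n) :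
    ((‖a‖ : ℂ) ^ 2) • (ℂ ∙ a).starProjection u = inner ℂ a u • a := by
  rw [Submodule.starProjection_singleton]
  by_cases ha : a = 0
  · simp [ha]
  · have : (‖a‖ : ℂ) ≠ 0 := by simpa using ha
    rw [smul_smul]
    congr 1
    push_cast
    exact mul_div_cancel₀ _ (pow_ne_zero 2 this)

/-- The square is `P + (1 - |a|²) Q`, and `|a|² P u = ⟨u, a⟩ a`. The projections disappear from the
result, and `a = 0` is no exception. -/
lemma mobLin_mobLin {a : Cn n} (ha : a ∈ ball n) (u : Cn n) :
    mobLin a (mobLin a u) = (om a : ℂ) • u + inner ℂ a u • a := by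
  have hs : ((Real.sqrt (om a) : ℝ) : ℂ) * (Real.sqrt (om a) : ℝ) = (om a : ℂ) := by
    rw [← Complex.ofReal_mul, Real.mul_self_sqrt (om_pos ha).le]
  have h1 : ∀ v, (ℂ ∙ a).starProjection ((ℂ ∙ a).starProjection v) = (ℂ ∙ a).starProjection v :=
    fun v => Submodule.starProjection_eq_self_iff.2 (Submodule.starProjection_apply_mem _ _)
  rw [← norm_sq_smul_starProjection]
  simp only [mobLin, add_apply, smul_apply,
    Submodule.starProjection_orthogonal_val, map_add, map_sub, map_smul, h1, sub_self, smul_zero,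
    add_zero, smul_add, smul_sub, smul_smul, hs]
  have : (om a : ℂ) = 1 - (‖a‖ : ℂ) ^ 2 := by simp [om]
  rw [this]
  module

lemma norm_inner_lt_one {a u : Cn n} (ha : a ∈ ball n) (hu : ‖u‖ ≤ 1) : ‖inner ℂ a u‖ < 1 := by
  rw [mem_ball_iff] at ha
  calc ‖inner ℂ a u‖ ≤ ‖a‖ * ‖u‖ := norm_inner_le_norm a u
    _ ≤ ‖a‖ * 1 := by gcongr
    _ < 1 := by simpa using ha

lemma norm_one_sub_inner_pos {a u : Cn n} (ha : a ∈ ball n) (hu : ‖u‖ ≤ 1) :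
    0 < ‖1 - inner ℂ a u‖ := by
  have h := norm_inner_lt_one ha hu
  have := norm_sub_norm_le (1 : ℂ) (inner ℂ a u)
  rw [norm_one] at this
  linarith

lemma one_sub_inner_ne_zero {a u : Cn n} (ha : a ∈ ball n) (hu : u ∈ ball n) :
    (1 : ℂ) - inner ℂ a u ≠ 0 :=
  norm_pos_iff.1 (norm_one_sub_inner_pos ha (mem_ball_iff.1 hu).le)

lemma norm_one_sub_inner_comm (a u : Cn n) : ‖1 - inner ℂ a u‖ = ‖1 - inner ℂ u a‖ := by
  rw [← inner_conj_symm u a, ← norm_star (1 - inner ℂ a u)]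
  simp

lemma inner_sub_mobLin_self (a u : Cn n) :
    inner ℂ a (a - mobLin a u) = (‖a‖ : ℂ) ^ 2 - inner ℂ a u := by
  rw [inner_sub_right, ← inner_mobLin_left, mobLin_self, inner_self_eq_norm_sq_to_K]
  rfl

lemma one_sub_inner_mobius_left {a u : Cn n} (ha : a ∈ ball n) (hu : u ∈ ball n) :
    1 - inner ℂ a (mobius a u) = (om a : ℂ) / (1 - inner ℂ a u) := by
  have h := one_sub_inner_ne_zero ha hu
  rw [mobius_eq, inner_smul_right, inner_sub_mobLin_self]
  field_simp
  simp only [om]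
  push_cast
  ring

/-- Since `mobLin a` is self-adjoint, both copies can be moved to one side, where `mobLin_mobLin`
evaluates them. The diagonal case gives `om_mobius`, and the moduli give the invariance of the
pseudo-hyperbolic metric. -/
lemma one_sub_inner_mobius {a u v : Cn n} (ha : a ∈ ball n) (hu : u ∈ ball n) (hv : v ∈ ball n) :
    1 - inner ℂ (mobius a u) (mobius a v) =
      (om a : ℂ) * (1 - inner ℂ u v) / ((1 - inner ℂ u a) * (1 - inner ℂ a v)) := by
  have h1 := one_sub_inner_ne_zero hu ha
  have h2 := one_sub_inner_ne_zero ha hv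
  have h3 : inner ℂ (a - mobLin a u) (a - mobLin a v) =
      (‖a‖ : ℂ) ^ 2 - inner ℂ a v - inner ℂ u a + (om a : ℂ) * inner ℂ u v
        + inner ℂ a v * inner ℂ u a := by
    rw [inner_sub_left, inner_sub_mobLin_self, inner_sub_right, inner_mobLin_left, mobLin_self,
      inner_mobLin_left, mobLin_mobLin ha, inner_add_right, inner_smul_right, inner_smul_right]
    ring
  rw [mobius_eq, mobius_eq, inner_smul_left, inner_smul_right, h3]
  have h4 : (starRingEnd ℂ) (1 - inner ℂ a u)⁻¹ = (1 - inner ℂ u a)⁻¹ := by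
    rw [map_inv₀, map_sub, map_one, inner_conj_symm]
  rw [h4]
  field_simp
  simp only [om]
  push_cast
  ring

lemma om_mobius {a u : Cn n} (ha : a ∈ ball n) (hu : u ∈ ball n) :
    om (mobius a u) = om a * om u / ‖1 - inner ℂ a u‖ ^ 2 := by
  have h := one_sub_inner_mobius ha hu hu
  have h2 : (1 - inner ℂ u a) * (1 - inner ℂ a u) = ((‖1 - inner ℂ a u‖ ^ 2 : ℝ) : ℂ) := by
    have : (1 - inner ℂ u a) = (starRingEnd ℂ) (1 - inner ℂ a u) := by
      rw [map_sub, map_one, inner_conj_symm]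
    rw [this, mul_comm, Complex.mul_conj, Complex.normSq_eq_norm_sq]
  rw [h2, inner_self_eq_norm_sq_to_K, inner_self_eq_norm_sq_to_K] at h
  have h3 : ((om (mobius a u) : ℝ) : ℂ) =
      ((om a * om u / ‖1 - inner ℂ a u‖ ^ 2 : ℝ) : ℂ) := by
    simp only [om] at h ⊢
    push_cast at h ⊢
    exact h
  exact_mod_cast h3

lemma mobius_mem_ball {a u : Cn n} (ha : a ∈ ball n) (hu : u ∈ ball n) : mobius a u ∈ ball n := by
  apply mem_ball_of_om_pos
  rw [om_mobius ha hu]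
  have := norm_one_sub_inner_pos ha (mem_ball_iff.1 hu).le
  have := om_pos ha
  have := om_pos hu
  positivity

lemma mobius_mobius {a u : Cn n} (ha : a ∈ ball n) (hu : u ∈ ball n) :
    mobius a (mobius a u) = u := by
  have h := one_sub_inner_ne_zero ha hu
  have ho : (om a : ℂ) ≠ 0 := by exact_mod_cast (om_pos ha).ne'
  rw [mobius_eq a (mobius a u), one_sub_inner_mobius_left ha hu, mobius_eq, map_smul, map_sub,
    mobLin_self, mobLin_mobLin ha]
  have : a - (1 - inner ℂ a u)⁻¹ • (a - ((om a : ℂ) • u + inner ℂ a u • a)) =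
      ((1 - inner ℂ a u)⁻¹ * (om a : ℂ)) • u := by
    have h5 : a = ((1 - inner ℂ a u)⁻¹ * (1 - inner ℂ a u)) • a := by
      rw [inv_mul_cancel₀ h, one_smul]
    nth_rewrite 1 [h5]
    module
  rw [this, smul_smul]
  have h6 : ((om a : ℂ) / (1 - inner ℂ a u))⁻¹ * ((1 - inner ℂ a u)⁻¹ * (om a : ℂ)) = 1 := by
    field_simp
  rw [h6, one_smul]

lemma mobius_zero_right (a : Cn n) : mobius a 0 = a := by
  simp [mobius_eq]

lemma mobius_self (a : Cn n) : mobius a a = 0 := by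
  simp [mobius_eq, mobLin_self]

/-! ### The pseudo-hyperbolic and hyperbolic metrics -/

lemma pseudoHyp_nonneg (z w : Cn n) : 0 ≤ pseudoHyp z w := norm_nonneg _

lemma one_sub_pseudoHyp_sq {z w : Cn n} (hz : z ∈ ball n) (hw : w ∈ ball n) :
    1 - pseudoHyp z w ^ 2 = om z * om w / ‖1 - inner ℂ z w‖ ^ 2 := om_mobius hz hw

lemma pseudoHyp_lt_one {z w : Cn n} (hz : z ∈ ball n) (hw : w ∈ ball n) : pseudoHyp z w < 1 :=
  mem_ball_iff.1 (mobius_mem_ball hz hw)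

lemma pseudoHyp_comm {z w : Cn n} (hz : z ∈ ball n) (hw : w ∈ ball n) :
    pseudoHyp z w = pseudoHyp w z := by
  have h1 := one_sub_pseudoHyp_sq hz hw
  have h2 := one_sub_pseudoHyp_sq hw hz
  rw [norm_one_sub_inner_comm, mul_comm, ← h2] at h1
  exact (sq_eq_sq₀ (pseudoHyp_nonneg _ _) (pseudoHyp_nonneg _ _)).1 (by linarith)

lemma pseudoHyp_mobius {a u v : Cn n} (ha : a ∈ ball n) (hu : u ∈ ball n) (hv : v ∈ ball n) :
    pseudoHyp (mobius a u) (mobius a v) = pseudoHyp u v := by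
  have h1 := one_sub_pseudoHyp_sq (mobius_mem_ball ha hu) (mobius_mem_ball ha hv)
  have h2 := one_sub_pseudoHyp_sq hu hv
  rw [om_mobius ha hu, om_mobius ha hv, one_sub_inner_mobius ha hu hv] at h1
  have h3 : 1 - pseudoHyp (mobius a u) (mobius a v) ^ 2 = 1 - pseudoHyp u v ^ 2 := by
    rw [h1, h2]
    have i1 := norm_one_sub_inner_pos ha (mem_ball_iff.1 hu).le
    have i2 := norm_one_sub_inner_pos ha (mem_ball_iff.1 hv).le
    have i3 := norm_one_sub_inner_pos hu (mem_ball_iff.1 hv).le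
    have := om_pos ha
    rw [norm_div, norm_mul, norm_mul, Complex.norm_real, Real.norm_of_nonneg this.le,
      norm_one_sub_inner_comm u a]
    field_simp
  exact (sq_eq_sq₀ (pseudoHyp_nonneg _ _) (pseudoHyp_nonneg _ _)).1 (by linarith)

lemma pseudoHyp_mobius_right {a u : Cn n} (ha : a ∈ ball n) (hu : u ∈ ball n) :
    pseudoHyp a (mobius a u) = ‖u‖ := by
  unfold pseudoHyp
  rw [mobius_mobius ha hu]

/-- In the formula for `1 - ρ²` only `|1 - ⟨v, u⟩|` depends on the directions, and it is at most `1
+ |u| |v|`. -/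
lemma pseudoHyp_le_of_norm {u v : Cn n} (hu : u ∈ ball n) (hv : v ∈ ball n) :
    pseudoHyp u v ≤ (‖u‖ + ‖v‖) / (1 + ‖u‖ * ‖v‖) := by
  have h := one_sub_pseudoHyp_sq hu hv
  have hu' := om_pos hu
  have hv' := om_pos hv
  have i3 := norm_one_sub_inner_pos hu (mem_ball_iff.1 hv).le
  have hle : ‖1 - inner ℂ u v‖ ≤ 1 + ‖u‖ * ‖v‖ := by
    calc ‖1 - inner ℂ u v‖ ≤ ‖(1 : ℂ)‖ + ‖inner ℂ u v‖ := norm_sub_le _ _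
      _ ≤ 1 + ‖u‖ * ‖v‖ := by rw [norm_one]; gcongr; exact norm_inner_le_norm u v
  have hp : 0 < 1 + ‖u‖ * ‖v‖ := by positivity
  have h2 : om u * om v / (1 + ‖u‖ * ‖v‖) ^ 2 ≤ 1 - pseudoHyp u v ^ 2 := by
    rw [h]
    gcongr
  have h3 : om u * om v / (1 + ‖u‖ * ‖v‖) ^ 2 = 1 - ((‖u‖ + ‖v‖) / (1 + ‖u‖ * ‖v‖)) ^ 2 := by
    unfold om
    field_simp
    ring
  rw [h3] at h2
  exact (sq_le_sq₀ (pseudoHyp_nonneg _ _) (by positivity)).1 (by linarith)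

/-- The isometry `φ_y` moves the middle point to the origin, where distances are norms. -/
lemma pseudoHyp_triangle {x y z : Cn n} (hx : x ∈ ball n) (hy : y ∈ ball n) (hz : z ∈ ball n) :
    pseudoHyp x z ≤ (pseudoHyp x y + pseudoHyp y z) / (1 + pseudoHyp x y * pseudoHyp y z) := by
  have h := pseudoHyp_le_of_norm (mobius_mem_ball hy hx) (mobius_mem_ball hy hz)
  rw [pseudoHyp_mobius hy hx hz] at h
  rw [pseudoHyp_comm hx hy]
  exact h

lemma bergmanDist_comm {z w : Cn n} (hz : z ∈ ball n) (hw : w ∈ ball n) :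
    bergmanDist z w = bergmanDist w z := by
  unfold bergmanDist
  rw [pseudoHyp_comm hz hw]

lemma log_ratio_mono {s t : ℝ} (hs : 0 ≤ s) (hst : s ≤ t) (ht : t < 1) :
    1 / 2 * Real.log ((1 + s) / (1 - s)) ≤ 1 / 2 * Real.log ((1 + t) / (1 - t)) := by
  have h1 : 0 < 1 - t := by linarith
  have h2 : 0 < 1 - s := by linarith
  have h3 : 0 ≤ 1 + t := by linarith
  gcongr

lemma bergmanDist_nonneg {z w : Cn n} (hz : z ∈ ball n) (hw : w ∈ ball n) :
    0 ≤ bergmanDist z w := by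
  have := log_ratio_mono le_rfl (pseudoHyp_nonneg z w) (pseudoHyp_lt_one hz hw)
  simpa [bergmanDist] using this

lemma bergmanDist_self {z : Cn n} : bergmanDist z z = 0 := by
  simp [bergmanDist, pseudoHyp, mobius_self]

/-- The Bergman distance is the inverse hyperbolic tangent of `ρ`, and `(s + t) / (1 + s t)` is the
addition law of the hyperbolic tangent. -/
lemma bergmanDist_triangle {x y z : Cn n} (hx : x ∈ ball n) (hy : y ∈ ball n) (hz : z ∈ ball n) :
    bergmanDist x z ≤ bergmanDist x y + bergmanDist y z := by
  have h := pseudoHyp_triangle hx hy hz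
  have hs0 := pseudoHyp_nonneg x y
  have ht0 := pseudoHyp_nonneg y z
  have hs1 := pseudoHyp_lt_one hx hy
  have ht1 := pseudoHyp_lt_one hy hz
  have hu0 := pseudoHyp_nonneg x z
  unfold bergmanDist
  set s := pseudoHyp x y
  set t := pseudoHyp y z
  have hp : 0 < 1 + s * t := by positivity
  have h1 : (s + t) / (1 + s * t) < 1 := by
    rw [div_lt_one hp]
    nlinarith [mul_pos (sub_pos.2 hs1) (sub_pos.2 ht1)]
  refine (log_ratio_mono hu0 h h1).trans_eq ?_
  have hs2 : 0 < 1 - s := by linarith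
  have ht2 : 0 < 1 - t := by linarith
  rw [← mul_add, ← Real.log_mul (by positivity) (by positivity)]
  congr 2
  have h2 : 1 - (s + t) / (1 + s * t) = (1 - s) * (1 - t) / (1 + s * t) := by
    field_simp; ring
  have h3 : 1 + (s + t) / (1 + s * t) = (1 + s) * (1 + t) / (1 + s * t) := by
    field_simp; ring
  rw [h2, h3]
  field_simp

lemma continuousOn_pseudoHyp {z : Cn n} (hz : z ∈ ball n) :
    ContinuousOn (fun w => pseudoHyp w z) (ball n) := by
  -- As a function of its first variable, `mobius w z` contains the projection onto `ℂ w`, which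
  -- jumps at `w = 0`. The formula for `1 - ρ²` avoids it.
  have h : ContinuousOn
      (fun w => Real.sqrt (1 - om z * om w / ‖1 - inner ℂ z w‖ ^ 2)) (ball n) := by
    refine Real.continuous_sqrt.comp_continuousOn (continuousOn_const.sub (ContinuousOn.div ?_ ?_ ?_))
    · exact (continuous_const.mul continuous_om).continuousOn
    · exact Continuous.continuousOn (by fun_prop)
    · intro w hw
      exact pow_ne_zero _ (norm_one_sub_inner_pos hz (mem_ball_iff.1 hw).le).ne'
  refine h.congr fun w hw => ?_
  beta_reduce
  rw [← one_sub_pseudoHyp_sq hz hw, pseudoHyp_comm hw hz, sub_sub_cancel,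
    Real.sqrt_sq (pseudoHyp_nonneg _ _)]

lemma continuousOn_bergmanDist {z : Cn n} (hz : z ∈ ball n) :
    ContinuousOn (fun w => bergmanDist w z) (ball n) := by
  have h := continuousOn_pseudoHyp hz
  have h1 : ∀ w ∈ ball n, 0 < 1 - pseudoHyp w z := fun w hw => by
    have := pseudoHyp_lt_one hw hz
    linarith
  unfold bergmanDist
  refine continuousOn_const.mul (ContinuousOn.log ((continuousOn_const.add h).div
    (continuousOn_const.sub h) fun w hw => (h1 w hw).ne') fun w hw => ?_)
  have := h1 w hw
  have := pseudoHyp_nonneg w z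
  positivity

lemma isOpen_bergmanNhd {E : Set (Cn n)} (hE : E ⊆ ball n) (r : ℝ) : IsOpen (bergmanNhd E r) := by
  have : bergmanNhd E r = ⋃ z ∈ E, (ball n ∩ (fun w => bergmanDist w z) ⁻¹' Set.Iio r) := by
    ext w
    simp only [bergmanNhd, Set.mem_ofPred_eq, Set.mem_iUnion, Set.mem_inter_iff, Set.mem_preimage,
      Set.mem_Iio, exists_prop]
    tauto
  rw [this]
  refine isOpen_biUnion fun z hz => ?_
  exact (continuousOn_bergmanDist (hE hz)).isOpen_inter_preimage (isOpen_ball n) isOpen_Iio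

lemma bergmanNhd_bergmanNhd {E : Set (Cn n)} (hE : E ⊆ ball n) {r s : ℝ} {w x : Cn n}
    (hx : x ∈ bergmanNhd E r) (hw : w ∈ ball n) (h : bergmanDist w x ≤ s) :
    w ∈ bergmanNhd E (r + s) := by
  obtain ⟨hxb, z, hz, hxz⟩ := hx
  exact ⟨hw, z, hz, by linarith [bergmanDist_triangle hw hxb (hE hz)]⟩

lemma bergmanNhd_mono {E : Set (Cn n)} {r s : ℝ} (h : r ≤ s) : bergmanNhd E r ⊆ bergmanNhd E s :=
  fun _ hw => ⟨hw.1, hw.2.imp fun _ hz => ⟨hz.1, hz.2.trans_le h⟩⟩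

end Mobius


/-! ### Change of variables -/

section Jacobian

variable {n : ℕ}

/-- The real Jacobian of the Möbius transform `φ_a` at `u`. -/
noncomputable def jac (a u : Cn n) : ℝ := (om a / ‖1 - inner ℂ a u‖ ^ 2) ^ (n + 1)

lemma jac_nonneg {a : Cn n} (ha : a ∈ ball n) (u : Cn n) : 0 ≤ jac a u := by
  have := om_pos ha
  unfold jac
  positivity

/-- The complex derivative of `φ_a` at `u`. -/
noncomputable def mobiusDeriv (a u : Cn n) : Cn n →L[ℂ] Cn n :=
  (1 - inner ℂ a u)⁻¹ • (-(mobLin a) + (innerSL ℂ a).smulRight (mobius a u))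

lemma hasFDerivAt_mobius {a u : Cn n} (ha : a ∈ ball n) (hu : u ∈ ball n) :
    HasFDerivAt (mobius a) (mobiusDeriv a u) u := by
  have h0 := one_sub_inner_ne_zero ha hu
  have h1 : HasFDerivAt (fun v => 1 - inner ℂ a v) (-(innerSL ℂ a)) u := by
    have := (innerSL ℂ a).hasFDerivAt (x := u)
    simpa using this.const_sub 1
  have h2 : HasFDerivAt (fun v => (1 - inner ℂ a v)⁻¹)
      ((-((1 - inner ℂ a u) ^ 2)⁻¹) • (-(innerSL ℂ a))) u :=
    (hasDerivAt_inv h0).comp_hasFDerivAt u h1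
  have h3 : HasFDerivAt (fun v => a - mobLin a v) (-(mobLin a)) u :=
    ((mobLin a).hasFDerivAt (x := u)).const_sub a
  have h4 := h2.fun_smul h3
  have h5 : mobius a = fun v => (1 - inner ℂ a v)⁻¹ • (a - mobLin a v) := by
    funext v
    exact mobius_eq a v
  rw [h5]
  refine h4.congr_fderiv ?_
  ext1 v
  simp only [mobiusDeriv, mobius_eq, add_apply, smul_apply, neg_apply,
    ContinuousLinearMap.smulRight_apply, innerSL_apply_apply, smul_eq_mul]
  rw [smul_add, smul_smul, smul_smul]
  congr 2
  field_simp

/-- The matrix determinant lemma: up to the scalar `c` the map is a transvection. -/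
lemma det_smul_one_add_smulRight (c : ℂ) (hc : c ≠ 0) (f : Module.Dual ℂ (Cn n)) (v : Cn n) :
    LinearMap.det (c • (LinearMap.id : Cn n →ₗ[ℂ] Cn n) + f.smulRight v) = c ^ n * (1 + f v / c) := by
  have : c • (LinearMap.id : Cn n →ₗ[ℂ] Cn n) + f.smulRight v
      = c • LinearMap.transvection f (c⁻¹ • v) := by
    ext1 x
    simp [LinearMap.transvection.apply, smul_smul, mul_comm, hc]
  rw [this, LinearMap.det_smul, LinearMap.transvection.det]
  simp [div_eq_inv_mul]

/-- The square is a multiple of the identity plus a rank one map, so no basis adapted to `a` is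
needed. The quotient stands for the power `n - 1`; it is also right for `n = 0`, where `om a = 1`.
-/
lemma det_mobLin_sq {a : Cn n} (ha : a ∈ ball n) :
    LinearMap.det (mobLin a : Cn n →ₗ[ℂ] Cn n) ^ 2 = (om a : ℂ) ^ n / om a := by
  have ho : (om a : ℂ) ≠ 0 := by exact_mod_cast (om_pos ha).ne'
  have h : (mobLin a : Cn n →ₗ[ℂ] Cn n) ∘ₗ (mobLin a : Cn n →ₗ[ℂ] Cn n)
      = (om a : ℂ) • (LinearMap.id : Cn n →ₗ[ℂ] Cn n) +
        (innerSL ℂ a : Cn n →ₗ[ℂ] ℂ).smulRight a := by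
    ext1 u
    simp [mobLin_mobLin ha u]
  rw [sq, ← LinearMap.det_comp, h, det_smul_one_add_smulRight _ ho]
  have : (1 : ℂ) + ((innerSL ℂ a : Cn n →ₗ[ℂ] ℂ) a) / (om a : ℂ) = 1 / om a := by
    have : ((innerSL ℂ a : Cn n →ₗ[ℂ] ℂ) a) = (‖a‖ : ℂ) ^ 2 := by
      exact inner_self_eq_norm_sq_to_K (𝕜 := ℂ) a
    rw [this]
    field_simp
    simp [om]
  rw [this]
  ring

/-- Composition with `mobLin a` turns the derivative into a multiple of the identity plus a rank one
map. Only the modulus of the determinant matters for the Jacobian, so the extra factor can be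
removed by `det_mobLin_sq`. -/
lemma det_mobLin_mul {a u : Cn n} (ha : a ∈ ball n) (hu : u ∈ ball n) :
    LinearMap.det (mobLin a : Cn n →ₗ[ℂ] Cn n) *
      LinearMap.det (mobiusDeriv a u : Cn n →ₗ[ℂ] Cn n) =
      (-(om a : ℂ)) ^ n / (1 - inner ℂ a u) ^ (n + 1) := by
  have h0 := one_sub_inner_ne_zero ha hu
  have ho : (om a : ℂ) ≠ 0 := by exact_mod_cast (om_pos ha).ne'
  have h : (mobLin a : Cn n →ₗ[ℂ] Cn n) ∘ₗ (mobiusDeriv a u : Cn n →ₗ[ℂ] Cn n)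
      = (-(om a : ℂ) / (1 - inner ℂ a u)) • (LinearMap.id : Cn n →ₗ[ℂ] Cn n) +
        (innerSL ℂ a : Cn n →ₗ[ℂ] ℂ).smulRight (((-(om a : ℂ)) / (1 - inner ℂ a u) ^ 2) • u) := by
    ext1 v
    have h1 : mobLin a (mobius a u) = a - ((om a : ℂ) / (1 - inner ℂ a u)) • u := by
      rw [mobius_eq, map_smul, map_sub, mobLin_self, mobLin_mobLin ha]
      have h5 : (1 - inner ℂ a u)⁻¹ - (1 - inner ℂ a u)⁻¹ * inner ℂ a u = 1 := by
        field_simp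
      linear_combination (norm := module) h5 • a
    simp only [mobiusDeriv, LinearMap.comp_apply, ContinuousLinearMap.coe_coe, add_apply,
      smul_apply, neg_apply, ContinuousLinearMap.smulRight_apply, innerSL_apply_apply, map_smul,
      map_add, map_neg, mobLin_mobLin ha, h1, LinearMap.add_apply, LinearMap.smul_apply,
      LinearMap.id_apply, LinearMap.smulRight_apply]
    generalize (1 - inner ℂ a u) = d at *
    module
  rw [← LinearMap.det_comp, h, det_smul_one_add_smulRight _ (div_ne_zero (neg_ne_zero.2 ho) h0)]
  simp only [map_smul, ContinuousLinearMap.coe_coe, innerSL_apply_apply, smul_eq_mul]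
  have h6 : (1 : ℂ) + -(om a : ℂ) / (1 - inner ℂ a u) ^ 2 * inner ℂ a u /
      (-(om a : ℂ) / (1 - inner ℂ a u)) = 1 / (1 - inner ℂ a u) := by
    field_simp
    ring
  rw [h6, div_pow, pow_succ]
  field_simp

lemma norm_det_mobiusDeriv_sq {a u : Cn n} (ha : a ∈ ball n) (hu : u ∈ ball n) :
    ‖LinearMap.det (mobiusDeriv a u : Cn n →ₗ[ℂ] Cn n)‖ ^ 2 = jac a u := by
  have h1 := congrArg norm (det_mobLin_sq ha)
  have h2 := congrArg (fun x => ‖x‖ ^ 2) (det_mobLin_mul ha hu)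
  have ho := om_pos ha
  have hd := norm_one_sub_inner_pos ha (mem_ball_iff.1 hu).le
  simp only [norm_mul, norm_div, norm_pow, norm_neg, Complex.norm_real,
    Real.norm_of_nonneg ho.le] at h1 h2
  rw [mul_pow, h1] at h2
  have h3 : (om a ^ n / om a) ≠ 0 := by positivity
  rw [← mul_right_inj' h3, h2, jac, div_pow, div_pow, ← pow_mul, ← pow_mul, pow_succ (om a)]
  field_simp
  ring

lemma abs_det_restrictScalars (f : Cn n →L[ℂ] Cn n) :
    |(f.restrictScalars ℝ).det| = ‖LinearMap.det (f : Cn n →ₗ[ℂ] Cn n)‖ ^ 2 := by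
  have : (f.restrictScalars ℝ).det = Algebra.norm ℝ (LinearMap.det (f : Cn n →ₗ[ℂ] Cn n)) :=
    LinearMap.det_restrictScalars (R := ℝ) (f := (f : Cn n →ₗ[ℂ] Cn n))
  rw [this, Algebra.norm_complex_apply, Complex.normSq_eq_norm_sq, abs_of_nonneg (by positivity)]

lemma image_mobius_ball {a : Cn n} (ha : a ∈ ball n) : mobius a '' ball n = ball n := by
  ext x
  constructor
  · rintro ⟨u, hu, rfl⟩
    exact mobius_mem_ball ha hu
  · intro hx
    exact ⟨mobius a x, mobius_mem_ball ha hx, mobius_mobius ha hx⟩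

lemma injOn_mobius {a : Cn n} (ha : a ∈ ball n) : Set.InjOn (mobius a) (ball n) := by
  intro x hx y hy h
  rw [← mobius_mobius ha hx, h, mobius_mobius ha hy]

lemma measurableSet_ball (n : ℕ) : MeasurableSet (ball n) := (isOpen_ball n).measurableSet

lemma lintegral_mobius {a : Cn n} (ha : a ∈ ball n) (g : Cn n → ℝ≥0∞) :
    ∫⁻ x, g x ∂(ballMeasure n) =
      ∫⁻ u, ENNReal.ofReal (jac a u) * g (mobius a u) ∂(ballMeasure n) := by
  have h := lintegral_image_eq_lintegral_abs_det_fderiv_mul (volume : Measure (Cn n))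
    (measurableSet_ball n) (f' := fun u => (mobiusDeriv a u).restrictScalars ℝ)
    (fun u hu => ((hasFDerivAt_mobius ha hu).restrictScalars ℝ).hasFDerivWithinAt)
    (injOn_mobius ha) g
  rw [image_mobius_ball ha] at h
  simp only [ballMeasure, lintegral_smul_measure]
  rw [h]
  congr 1
  refine setLIntegral_congr_fun (measurableSet_ball n) fun u hu => ?_
  simp only [abs_det_restrictScalars, norm_det_mobiusDeriv_sq ha hu]

lemma integral_mobius {a : Cn n} (ha : a ∈ ball n) (g : Cn n → ℂ) :
    ∫ x, g x ∂(ballMeasure n) = ∫ u, (jac a u : ℂ) * g (mobius a u) ∂(ballMeasure n) := by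
  have h := integral_image_eq_integral_abs_det_fderiv_smul (volume : Measure (Cn n))
    (measurableSet_ball n) (f' := fun u => (mobiusDeriv a u).restrictScalars ℝ)
    (fun u hu => ((hasFDerivAt_mobius ha hu).restrictScalars ℝ).hasFDerivWithinAt)
    (injOn_mobius ha) g
  rw [image_mobius_ball ha] at h
  simp only [ballMeasure, integral_smul_measure]
  rw [h]
  congr 1
  refine setIntegral_congr_fun (measurableSet_ball n) fun u hu => ?_
  simp only [abs_det_restrictScalars, norm_det_mobiusDeriv_sq ha hu, Complex.real_smul]

/-- Affine complex change of variables. -/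
lemma lintegral_comp_const_smul_add (c : ℂ) (hc : c ≠ 0) (b : Cn n) (s : Set (Cn n))
    (hs : MeasurableSet s) (g : Cn n → ℝ≥0∞) :
    ENNReal.ofReal (‖c‖ ^ (2 * n)) * ∫⁻ x in s, g (c • x + b) =
      ∫⁻ x in (fun x => c • x + b) '' s, g x := by
  have hd : ∀ x ∈ s, HasFDerivWithinAt (fun x : Cn n => c • x + b)
      ((c • ContinuousLinearMap.id ℂ (Cn n)).restrictScalars ℝ) s x := fun x _ => by
    have : HasFDerivAt (fun x : Cn n => c • x + b) (c • ContinuousLinearMap.id ℂ (Cn n)) x :=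
      ((hasFDerivAt_id x).const_smul c).add_const b
    exact (this.restrictScalars ℝ).hasFDerivWithinAt
  have hi : Set.InjOn (fun x : Cn n => c • x + b) s := by
    intro x _ y _ h
    simpa [hc] using h
  rw [lintegral_image_eq_lintegral_abs_det_fderiv_mul volume hs hd hi,
    ← lintegral_const_mul' _ _ ENNReal.ofReal_ne_top]
  have : ‖LinearMap.det ((c • ContinuousLinearMap.id ℂ (Cn n) : Cn n →L[ℂ] Cn n) :
      Cn n →ₗ[ℂ] Cn n)‖ ^ 2 = ‖c‖ ^ (2 * n) := by
    have : ((c • ContinuousLinearMap.id ℂ (Cn n) : Cn n →L[ℂ] Cn n) : Cn n →ₗ[ℂ] Cn n)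
        = c • LinearMap.id := rfl
    rw [this, LinearMap.det_smul]
    simp [← pow_mul, mul_comm]
  simp only [abs_det_restrictScalars, this]

lemma jac_mobius {a u : Cn n} (ha : a ∈ ball n) (hu : u ∈ ball n) :
    jac a (mobius a u) * jac a u = 1 := by
  have ho := om_pos ha
  have hd := norm_one_sub_inner_pos ha (mem_ball_iff.1 hu).le
  rw [jac, jac, one_sub_inner_mobius_left ha hu, norm_div, Complex.norm_real,
    Real.norm_of_nonneg ho.le, ← mul_pow]
  field_simp
  simp

lemma lintegral_jac {a : Cn n} (ha : a ∈ ball n) :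
    ∫⁻ u, ENNReal.ofReal (jac a u) ∂(ballMeasure n) = 1 := by
  have := lintegral_mobius ha (fun _ => 1)
  simpa using this.symm

end Jacobian


/-! ### A polynomial times a holomorphic function -/

section Growth

open Polynomial in
/-- Moving the zeros of a polynomial out of the unit disc compares its value at a distant point with
the mean of its product with a holomorphic function over the unit circle. -/
lemma norm_eval_mul_le_circleAverage {N : ℕ} (P : ℂ[X]) (hP : P.natDegree ≤ N) {F : ℂ → ℂ}
    (hF : DiffContOnCl ℂ F (Metric.ball 0 1)) {T : ℝ} (hT : 0 ≤ T) {s : ℂ} (hs : ‖s‖ ≤ T) :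
    ‖P.eval s‖ * ‖F 0‖ ≤ (1 + T) ^ N * Real.circleAverage (fun t => ‖P.eval t * F t‖) 0 1 := by
  have hcont : ∀ (Q : ℂ[X]) {F : ℂ → ℂ}, DiffContOnCl ℂ F (Metric.ball 0 1) →
      CircleIntegrable (fun t => ‖Q.eval t * F t‖) 0 1 := fun Q F hF => by
    refine ContinuousOn.circleIntegrable zero_le_one (ContinuousOn.norm ?_)
    refine Q.continuous.continuousOn.mul (hF.continuousOn.mono ?_)
    rw [closure_ball _ one_ne_zero]
    exact Metric.sphere_subset_closedBall
  have hnn : ∀ g : ℂ → ℂ, 0 ≤ Real.circleAverage (fun t => ‖g t‖) 0 1 := fun g =>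
    Real.circleAverage_nonneg_of_nonneg fun t _ => norm_nonneg _
  induction N generalizing P F with
  | zero =>
    obtain ⟨c, rfl⟩ := Polynomial.natDegree_eq_zero.1 (Nat.le_zero.1 hP)
    simp only [eval_C, pow_zero, one_mul, ← norm_mul]
    have hG : DiffContOnCl ℂ (fun t => c * F t) (Metric.ball 0 1) := hF.const_smul c
    have h1 := DiffContOnCl.circleAverage (R := 1) (c := 0) (by simpa using hG)
    rw [← h1]
    rw [Real.circleAverage_def, Real.circleAverage_def, norm_smul, smul_eq_mul,
      Real.norm_of_nonneg (by positivity)]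
    gcongr
    exact intervalIntegral.norm_integral_le_integral_norm Real.two_pi_pos.le
  | succ N ih =>
    by_cases hd : P.natDegree ≤ N
    · refine (ih P hd hF).trans ?_
      gcongr
      · exact hnn _
      · linarith
      · exact Nat.le_succ N
    obtain ⟨a, ha⟩ := Complex.exists_root (f := P) (Polynomial.natDegree_pos_iff_degree_pos.1 (by omega))
    obtain ⟨Q, rfl⟩ := Polynomial.dvd_iff_isRoot.2 ha
    have hQ0 : Q ≠ 0 := by
      rintro rfl
      simp at hd
    have hQ : Q.natDegree ≤ N := by
      rw [natDegree_mul (X_sub_C_ne_zero a) hQ0, natDegree_X_sub_C] at hP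
      omega
    have hlin : ∀ b d : ℂ, DiffContOnCl ℂ (fun t => (b * t + d) * F t) (Metric.ball 0 1) :=
      fun b d => by
        have h : Differentiable ℂ (fun t : ℂ => b * t + d) := by fun_prop
        exact h.diffContOnCl.smul hF
    simp only [eval_mul, eval_sub, eval_X, eval_C]
    -- A zero outside the open disc is absorbed into `F` unchanged, at the cost `|s - a| ≤ (1 + T)
    -- |a|`. A zero inside is first reflected: `1 - conj a * t` has the same modulus as `t - a` on
    -- the circle and the value `1` at `0`.
    by_cases ha1 : 1 ≤ ‖a‖
    · have h := ih Q hQ (hlin 1 (-a))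
      simp only [mul_zero, zero_add, norm_mul, norm_neg, one_mul] at h
      have hsa : ‖s - a‖ ≤ (1 + T) * ‖a‖ := by
        calc ‖s - a‖ ≤ ‖s‖ + ‖a‖ := norm_sub_le _ _
          _ ≤ T * ‖a‖ + ‖a‖ := by nlinarith
          _ = (1 + T) * ‖a‖ := by ring
      have h2 : (fun t => ‖(t - a) * eval t Q * F t‖) =
          fun t => ‖eval t Q‖ * (‖t + -a‖ * ‖F t‖) := by
        funext t
        rw [norm_mul, norm_mul, ← sub_eq_add_neg]
        ring
      rw [h2, norm_mul]
      calc ‖s - a‖ * ‖eval s Q‖ * ‖F 0‖ ≤ (1 + T) * ‖a‖ * ‖eval s Q‖ * ‖F 0‖ := by gcongr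
        _ = (1 + T) * (‖eval s Q‖ * (‖a‖ * ‖F 0‖)) := by ring
        _ ≤ (1 + T) * ((1 + T) ^ N *
              Real.circleAverage (fun t => ‖eval t Q‖ * (‖t + -a‖ * ‖F t‖)) 0 1) := by
            gcongr
        _ = _ := by ring
    · push Not at ha1
      have h := ih Q hQ (hlin (-(starRingEnd ℂ a)) 1)
      simp only [mul_zero, zero_add, one_mul] at h
      have hsa : ‖s - a‖ ≤ 1 + T := by
        calc ‖s - a‖ ≤ ‖s‖ + ‖a‖ := norm_sub_le _ _
          _ ≤ 1 + T := by linarith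
      have h2 : Real.circleAverage (fun t => ‖eval t Q * ((-(starRingEnd ℂ a) * t + 1) * F t)‖) 0 1 =
          Real.circleAverage (fun t => ‖(t - a) * eval t Q * F t‖) 0 1 := by
        refine Real.circleAverage_congr_sphere fun t ht => ?_
        have ht1 : ‖t‖ = 1 := by simpa using ht
        have h3 : -(starRingEnd ℂ a) * t + 1 = t * (starRingEnd ℂ) (t - a) := by
          have := Complex.mul_conj' t
          rw [ht1] at this
          rw [map_sub, mul_sub, this]
          push_cast
          ring
        simp only [h3, norm_mul, ht1, RCLike.norm_conj]
        ring
      rw [h2] at h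
      rw [norm_mul]
      calc ‖s - a‖ * ‖eval s Q‖ * ‖F 0‖ ≤ (1 + T) * ‖eval s Q‖ * ‖F 0‖ := by gcongr
        _ = (1 + T) * (‖eval s Q‖ * ‖F 0‖) := by ring
        _ ≤ (1 + T) * ((1 + T) ^ N * _) := by gcongr
        _ = _ := by ring

variable {n : ℕ}

/-- The functions that restrict to polynomials of degree at most `N` on each complex line. -/
def IsLinePoly (N : ℕ) (q : Cn n → ℂ) : Prop :=
  ∀ x y : Cn n, ∃ P : Polynomial ℂ, P.natDegree ≤ N ∧ ∀ t : ℂ, q (x + t • y) = P.eval t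

lemma IsLinePoly.mul {N M : ℕ} {p q : Cn n → ℂ} (hp : IsLinePoly N p) (hq : IsLinePoly M q) :
    IsLinePoly (N + M) (fun u => p u * q u) := fun x y => by
  obtain ⟨P, hP, hP'⟩ := hp x y
  obtain ⟨Q, hQ, hQ'⟩ := hq x y
  exact ⟨P * Q, Polynomial.natDegree_mul_le.trans (by omega), fun t => by simp [hP', hQ']⟩

lemma IsLinePoly.mono {N M : ℕ} {p : Cn n → ℂ} (hp : IsLinePoly N p) (h : N ≤ M) :
    IsLinePoly M p := fun x y => by
  obtain ⟨P, hP, hP'⟩ := hp x y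
  exact ⟨P, hP.trans h, hP'⟩

lemma isLinePoly_const (c : ℂ) : IsLinePoly 0 (fun _ : Cn n => c) := fun _ _ =>
  ⟨Polynomial.C c, by simp, by simp⟩

lemma isLinePoly_affine (c : ℂ) (L : Cn n →L[ℂ] ℂ) : IsLinePoly 1 (fun u => c - L u) := fun x y =>
  ⟨Polynomial.C (c - L x) - Polynomial.C (L y) * Polynomial.X, by compute_degree, fun t => by
    simp; ring⟩

lemma IsLinePoly.pow {N : ℕ} {p : Cn n → ℂ} (hp : IsLinePoly N p) (k : ℕ) :
    IsLinePoly (k * N) (fun u => p u ^ k) := by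
  induction k with
  | zero => simpa using isLinePoly_const (n := n) 1
  | succ k ih => simpa [pow_succ, add_mul] using ih.mul hp

lemma isLinePoly_sum {ι : Type*} {N : ℕ} (s : Finset ι) {p : ι → Cn n → ℂ}
    (hp : ∀ i ∈ s, IsLinePoly N (p i)) : IsLinePoly N (fun u => ∑ i ∈ s, p i u) := fun x y => by
  choose! P hP hP' using fun i hi => hp i hi x y
  refine ⟨∑ i ∈ s, P i, Polynomial.natDegree_sum_le_of_forall_le _ _ hP, fun t => ?_⟩
  rw [Polynomial.eval_finsetSum]
  exact Finset.sum_congr rfl fun i hi => hP' i hi t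

lemma isLinePoly_prod {ι : Type*} (s : Finset ι) {d : ι → ℕ} {p : ι → Cn n → ℂ}
    (hp : ∀ i ∈ s, IsLinePoly (d i) (p i)) :
    IsLinePoly (∑ i ∈ s, d i) (fun u => ∏ i ∈ s, p i u) := fun x y => by
  choose! P hP hP' using fun i hi => hp i hi x y
  refine ⟨∏ i ∈ s, P i, (Polynomial.natDegree_prod_le _ _).trans (Finset.sum_le_sum hP), fun t => ?_⟩
  rw [Polynomial.eval_prod]
  exact Finset.prod_congr rfl fun i hi => hP' i hi t

lemma setIntegral_ball_rotate {c : ℂ} (hc : ‖c‖ = 1) (τ : ℝ) (g : Cn n → ℂ) :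
    ∫ u in Metric.ball 0 τ, g (c • u) = ∫ u in Metric.ball 0 τ, g u := by
  have hc0 : c ≠ 0 := by
    rintro rfl
    simp at hc
  have hd : ∀ x ∈ Metric.ball (0 : Cn n) τ, HasFDerivWithinAt (fun x : Cn n => c • x)
      ((c • ContinuousLinearMap.id ℂ (Cn n)).restrictScalars ℝ) (Metric.ball 0 τ) x := fun x _ => by
    have : HasFDerivAt (fun x : Cn n => c • x) (c • ContinuousLinearMap.id ℂ (Cn n)) x :=
      (hasFDerivAt_id x).const_smul c
    exact (this.restrictScalars ℝ).hasFDerivWithinAt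
  have hi : Set.InjOn (fun x : Cn n => c • x) (Metric.ball 0 τ) := by
    intro x _ y _ h
    simpa [hc0] using h
  have h := integral_image_eq_integral_abs_det_fderiv_smul (volume : Measure (Cn n))
    Metric.isOpen_ball.measurableSet hd hi g
  have him : (fun x : Cn n => c • x) '' Metric.ball 0 τ = Metric.ball 0 τ := by
    ext x
    constructor
    · rintro ⟨y, hy, rfl⟩
      simpa [norm_smul, hc] using hy
    · intro hx
      exact ⟨c⁻¹ • x, by simpa [norm_smul, hc] using hx, by simp [smul_smul, hc0]⟩
  rw [him] at h
  rw [h]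
  refine integral_congr_ae (Filter.Eventually.of_forall fun u => ?_)
  have : ‖LinearMap.det ((c • ContinuousLinearMap.id ℂ (Cn n) : Cn n →L[ℂ] Cn n) :
      Cn n →ₗ[ℂ] Cn n)‖ ^ 2 = 1 := by
    have : ((c • ContinuousLinearMap.id ℂ (Cn n) : Cn n →L[ℂ] Cn n) : Cn n →ₗ[ℂ] Cn n)
        = c • LinearMap.id := rfl
    rw [this, LinearMap.det_smul]
    simp [hc]
  simp only [abs_det_restrictScalars, this, one_smul]

/-- The mean value property over a ball with a circular weight. -/
lemma setIntegral_ball_eq {τ : ℝ} {g ψ : Cn n → ℂ}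
    (hg : ContinuousOn g (Metric.closedBall 0 τ)) (hg' : DifferentiableOn ℂ g (Metric.ball 0 τ))
    (hψ : Continuous ψ) (hψ' : ∀ c : ℂ, ‖c‖ = 1 → ∀ u, ψ (c • u) = ψ u) :
    ∫ u in Metric.ball 0 τ, g u * ψ u = g 0 * ∫ u in Metric.ball 0 τ, ψ u := by
  obtain ⟨B, hB⟩ := (isCompact_closedBall (0 : Cn n) τ).exists_bound_of_continuousOn
    (hg.mul hψ.continuousOn)
  have hexp : ∀ θ : ℝ, ‖circleMap 0 1 θ‖ = 1 := fun θ => by simp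
  have hmem : ∀ (θ : ℝ) {u : Cn n}, u ∈ Metric.ball 0 τ → circleMap 0 1 θ • u ∈ Metric.ball 0 τ := by
    intro θ u hu
    simpa [norm_smul] using hu
  set ν : Measure ℝ := volume.restrict (Set.Ioc 0 (2 * Real.pi))
  -- The double integral over `θ` and `u` is computed in both orders. The integral over `u` does not
  -- depend on `θ`, by rotation invariance; the integral over `θ` is given by the mean value
  -- property on the disc `t ↦ t • u`.
  have hswap : ∫ θ, (∫ u in Metric.ball (0 : Cn n) τ, g (circleMap 0 1 θ • u) * ψ u) ∂ν =
      ∫ u in Metric.ball (0 : Cn n) τ, (∫ θ, g (circleMap 0 1 θ • u) * ψ u ∂ν) := by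
    refine integral_integral_swap ?_
    rw [Measure.prod_restrict]
    have hfin : (volume.prod (volume : Measure (Cn n)))
        (Set.Ioc 0 (2 * Real.pi) ×ˢ Metric.ball 0 τ) < ∞ := by
      rw [Measure.prod_prod]
      exact ENNReal.mul_lt_top (by simp [ENNReal.mul_lt_top]) measure_ball_lt_top
    have : IsFiniteMeasure ((volume.prod (volume : Measure (Cn n))).restrict
        (Set.Ioc 0 (2 * Real.pi) ×ˢ Metric.ball 0 τ)) := ⟨by simpa using hfin⟩
    refine Integrable.of_bound ?_ B ?_
    · refine ContinuousOn.aestronglyMeasurable ?_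
        (measurableSet_Ioc.prod Metric.isOpen_ball.measurableSet)
      refine ContinuousOn.mul ?_ (hψ.comp continuous_snd).continuousOn
      refine hg.comp (Continuous.continuousOn ?_) ?_
      · exact ((continuous_circleMap 0 1).comp continuous_fst).smul continuous_snd
      · intro x hx
        exact Metric.ball_subset_closedBall (hmem x.1 hx.2)
    · refine ae_restrict_of_forall_mem
        (measurableSet_Ioc.prod Metric.isOpen_ball.measurableSet) fun x hx => ?_
      have := hB _ (Metric.ball_subset_closedBall (hmem x.1 hx.2))
      simpa only [Function.uncurry, hψ' _ (hexp x.1), Pi.mul_apply] using this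
  have h1 : ∀ θ : ℝ, ∫ u in Metric.ball 0 τ, g (circleMap 0 1 θ • u) * ψ u =
      ∫ u in Metric.ball 0 τ, g u * ψ u := fun θ => by
    rw [← setIntegral_ball_rotate (hexp θ) τ (fun u => g u * ψ u)]
    simp only [hψ' _ (hexp θ)]
  have h2 : ∀ u ∈ Metric.ball (0 : Cn n) τ, ∫ θ, g (circleMap 0 1 θ • u) * ψ u ∂ν =
      (2 * Real.pi : ℂ) * (g 0 * ψ u) := fun u hu => by
    have hd : DiffContOnCl ℂ (fun t : ℂ => g (t • u)) (Metric.ball 0 |1|) := by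
      rw [abs_one]
      have hm : Set.MapsTo (fun t : ℂ => t • u) (Metric.closedBall 0 1) (Metric.ball 0 τ) := by
        intro t ht
        have ht' : ‖t‖ ≤ 1 := by simpa using ht
        have hu' : ‖u‖ < τ := by simpa using hu
        simp only [Metric.mem_ball, dist_zero_right, norm_smul]
        nlinarith [norm_nonneg u, norm_nonneg t]
      have hdiff : DifferentiableOn ℂ (fun t : ℂ => g (t • u)) (Metric.closedBall 0 1) :=
        hg'.comp (Differentiable.differentiableOn (by fun_prop)) hm
      refine DifferentiableOn.diffContOnCl ?_
      rwa [closure_ball _ one_ne_zero]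
    have h := DiffContOnCl.circleAverage hd
    rw [Real.circleAverage_def, intervalIntegral.integral_of_le Real.two_pi_pos.le] at h
    rw [integral_mul_const]
    have h3 : ∫ θ, g (circleMap 0 1 θ • u) ∂ν = (2 * Real.pi : ℂ) * g 0 := by
      rw [zero_smul] at h
      rw [← h, Complex.real_smul, ← mul_assoc]
      push_cast
      rw [mul_inv_cancel₀ (by simp [Real.pi_ne_zero]), one_mul]
    rw [h3]
    ring
  rw [setIntegral_congr_fun Metric.isOpen_ball.measurableSet h2] at hswap
  simp only [h1, integral_const, integral_const_mul] at hswap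
  have h4 : (ν.real Set.univ) = 2 * Real.pi := by
    simp [ν, Real.pi_pos.le]
  rw [h4, Complex.real_smul] at hswap
  push_cast at hswap
  exact mul_left_cancel₀ (by simp [Real.pi_ne_zero]) hswap

lemma enorm_mul_volume_le {τ σ : ℝ} (hτσ : τ < σ) {F : Cn n → ℂ}
    (hF : DifferentiableOn ℂ F (Metric.ball 0 σ)) :
    ‖F 0‖ₑ * volume (Metric.ball (0 : Cn n) τ) ≤ ∫⁻ ζ in Metric.ball 0 τ, ‖F ζ‖ₑ := by
  have h := setIntegral_ball_eq (τ := τ) (ψ := fun _ => 1)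
    (hF.continuousOn.mono (Metric.closedBall_subset_ball hτσ))
    (hF.mono (Metric.ball_subset_ball hτσ.le)) continuous_const (fun _ _ _ => rfl)
  simp only [mul_one, integral_const] at h
  have h2 := enorm_integral_le_lintegral_enorm (μ := volume.restrict (Metric.ball (0 : Cn n) τ)) F
  rw [h, enorm_mul] at h2
  refine le_trans (le_of_eq ?_) h2
  congr 1
  have : (volume (Metric.ball (0 : Cn n) τ)) ≠ ∞ := measure_ball_lt_top.ne
  rw [Complex.real_smul, mul_one]
  rw [← ofReal_norm, Complex.norm_real, Real.norm_of_nonneg measureReal_nonneg]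
  simp [measureReal_def, this]

end Growth


/-! ### Growth of a polynomial against a local integral of its product with a holomorphic function
-/

section Growth

variable {n : ℕ}

lemma measurable_indicator_of_continuousOn {X Y : Type*} [TopologicalSpace X] [MeasurableSpace X]
    [OpensMeasurableSpace X] [TopologicalSpace Y] [MeasurableSpace Y] [BorelSpace Y] [Zero Y]
    {s : Set X} (hs : MeasurableSet s) {f : X → Y} (hf : ContinuousOn f s) :
    Measurable (s.indicator f) := by
  classical
  rw [← Set.piecewise_eq_indicator]
  exact hf.measurable_piecewise continuousOn_const hs

lemma ofReal_circleAverage_le {h : ℂ → ℝ} (h0 : ∀ t, 0 ≤ h t) :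
    ENNReal.ofReal (Real.circleAverage h 0 1) ≤ ENNReal.ofReal (2 * Real.pi)⁻¹ *
      ∫⁻ θ in Set.Ioc 0 (2 * Real.pi), ENNReal.ofReal (h (circleMap 0 1 θ)) := by
  rw [Real.circleAverage_def, intervalIntegral.integral_of_le Real.two_pi_pos.le, smul_eq_mul,
    ENNReal.ofReal_mul (by positivity)]
  gcongr
  by_cases hi : Integrable (fun θ => h (circleMap 0 1 θ))
      (volume.restrict (Set.Ioc 0 (2 * Real.pi)))
  · rw [ofReal_integral_eq_lintegral_ofReal hi (Filter.Eventually.of_forall fun _ => h0 _)]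
  -- Without integrability the circle average is `0` by convention.
  · simp [integral_undef hi]

/-- On the complex line through a centre `ζ` near `0` and the point `u`, scaled so that `u` has
parameter `8`, the unit circle stays inside the ball of radius `1 / 2`, and
`norm_eval_mul_le_circleAverage` bounds `|q(u)| |F(ζ)|`. Averaging over `ζ` turns the circle means
into a volume integral, and the mean value property of `F` replaces `F(ζ)` by `F(0)`. -/
lemma enorm_mul_enorm_zero_le (n N : ℕ) :
    ∃ C : ℝ, 0 ≤ C ∧ ∀ q F : Cn n → ℂ, IsLinePoly N q → Continuous q →
      DifferentiableOn ℂ F (Metric.ball 0 (1 / 2)) → ∀ u ∈ ball n,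
      ‖q u‖ₑ * ‖F 0‖ₑ ≤
        ENNReal.ofReal C * ∫⁻ ζ in Metric.ball 0 (1 / 2), ‖q ζ * F ζ‖ₑ ∂(ballMeasure n) := by
  have hvol8 : volume (Metric.ball (0 : Cn n) (1 / 8)) ≠ 0 :=
    (Metric.measure_ball_pos volume _ (by norm_num)).ne'
  have hvol8' : volume (Metric.ball (0 : Cn n) (1 / 8)) ≠ ∞ := measure_ball_lt_top.ne
  have hvol1 : volume (ball n) ≠ 0 := (Metric.measure_ball_pos volume _ (by norm_num)).ne'
  have hvol1' : volume (ball n) ≠ ∞ := measure_ball_lt_top.ne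
  -- The factor `9 ^ N` is `(1 + T) ^ N` for `T = 8`. The map `ζ ↦ ζ + t (u - ζ) / 8` with `|t| = 1`
  -- has the linear factor `1 - t / 8` of modulus at least `7 / 8`, so `(8 / 7) ^ (2 n)` bounds its
  -- inverse Jacobian.
  set D : ℝ≥0∞ := ENNReal.ofReal (9 ^ N) * ENNReal.ofReal ((8 / 7) ^ (2 * n)) with hD
  have hDtop : D ≠ ∞ := ENNReal.mul_ne_top ENNReal.ofReal_ne_top ENNReal.ofReal_ne_top
  set K : ℝ≥0∞ := D * volume (ball n) / volume (Metric.ball (0 : Cn n) (1 / 8)) with hK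
  have hKtop : K ≠ ∞ := ENNReal.div_ne_top (ENNReal.mul_ne_top hDtop hvol1') hvol8
  refine ⟨K.toReal, ENNReal.toReal_nonneg, fun q F hq hqc hF u hu => ?_⟩
  rw [ENNReal.ofReal_toReal hKtop]
  set B2 : Set (Cn n) := Metric.ball 0 (1 / 2) with hB2
  set G : Cn n → ℝ≥0∞ := B2.indicator (fun ζ => ‖q ζ * F ζ‖ₑ) with hG
  have hB2m : MeasurableSet B2 := Metric.isOpen_ball.measurableSet
  have hGm : Measurable G := by
    have : ContinuousOn (fun ζ => ‖q ζ * F ζ‖ₑ) B2 :=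
      (continuous_enorm.comp_continuousOn (hqc.continuousOn.mul hF.continuousOn))
    exact measurable_indicator_of_continuousOn hB2m this
  have hpt : ∀ ζ ∈ Metric.ball (0 : Cn n) (1 / 8), ∀ t : ℂ, ‖t‖ ≤ 1 →
      ζ + t • ((1 / 8 : ℂ) • (u - ζ)) ∈ B2 := by
    intro ζ hζ t ht
    have h1 : ‖ζ‖ < 1 / 8 := by simpa using hζ
    have h2 := mem_ball_iff.1 hu
    have h3 : ‖t • ((1 / 8 : ℂ) • (u - ζ))‖ ≤ 1 * (1 / 8 * (‖u‖ + ‖ζ‖)) := by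
      rw [norm_smul, norm_smul]
      gcongr
      · simp
      · exact norm_sub_le _ _
    have h4 := norm_add_le ζ (t • ((1 / 8 : ℂ) • (u - ζ)))
    rw [hB2, mem_ball_zero_iff]
    linarith
  -- the zeros of `q` on the complex line through `ζ` and `u`
  have hline : ∀ ζ ∈ Metric.ball (0 : Cn n) (1 / 8), ‖q u‖ₑ * ‖F ζ‖ₑ ≤
      ENNReal.ofReal (9 ^ N) * (ENNReal.ofReal (2 * Real.pi)⁻¹ *
        ∫⁻ θ in Set.Ioc 0 (2 * Real.pi),
          G (ζ + circleMap 0 1 θ • ((1 / 8 : ℂ) • (u - ζ)))) := by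
    intro ζ hζ
    obtain ⟨P, hP, hP'⟩ := hq ζ ((1 / 8 : ℂ) • (u - ζ))
    have hdiff : DiffContOnCl ℂ (fun t : ℂ => F (ζ + t • ((1 / 8 : ℂ) • (u - ζ))))
        (Metric.ball 0 1) := by
      refine DifferentiableOn.diffContOnCl ?_
      rw [closure_ball _ one_ne_zero]
      refine hF.comp (Differentiable.differentiableOn (by fun_prop)) fun t ht => hpt ζ hζ t ?_
      simpa using ht
    have h := norm_eval_mul_le_circleAverage P hP hdiff (T := 8) (s := 8) (by norm_num) (by simp)
    have hu8 : P.eval 8 = q u := by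
      rw [← hP', smul_smul]
      norm_num
    rw [hu8, zero_smul, add_zero] at h
    have h' := ENNReal.ofReal_le_ofReal h
    rw [ENNReal.ofReal_mul (norm_nonneg _), ofReal_norm, ofReal_norm,
      ENNReal.ofReal_mul (by positivity)] at h'
    refine h'.trans ?_
    have h9 : (1 + 8 : ℝ) = 9 := by norm_num
    rw [h9]
    gcongr
    refine (ofReal_circleAverage_le fun t => norm_nonneg _).trans_eq ?_
    congr 1
    refine lintegral_congr fun θ => ?_
    rw [hG, Set.indicator_of_mem (hpt ζ hζ _ (by simp)), ofReal_norm, hP']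
  -- averaging over the centre `ζ`
  have haff : ∀ θ : ℝ, ∫⁻ ζ in Metric.ball (0 : Cn n) (1 / 8),
      G (ζ + circleMap 0 1 θ • ((1 / 8 : ℂ) • (u - ζ))) ≤
      ENNReal.ofReal ((8 / 7) ^ (2 * n)) * ∫⁻ ζ, G ζ := by
    intro θ
    set t := circleMap 0 1 θ with ht
    have ht1 : ‖t‖ = 1 := by simp [ht]
    have hc : 7 / 8 ≤ ‖1 - t * (1 / 8)‖ := by
      have := norm_sub_norm_le (1 : ℂ) (t * (1 / 8))
      rw [norm_mul, ht1] at this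
      norm_num at this ⊢
      linarith
    have hc0 : 1 - t * (1 / 8) ≠ 0 := norm_pos_iff.1 (by linarith)
    have h := lintegral_comp_const_smul_add (1 - t * (1 / 8)) hc0 ((t * (1 / 8)) • u)
      (Metric.ball (0 : Cn n) (1 / 8)) Metric.isOpen_ball.measurableSet G
    have h1 : ∀ ζ : Cn n, (1 - t * (1 / 8)) • ζ + (t * (1 / 8)) • u =
        ζ + t • ((1 / 8 : ℂ) • (u - ζ)) := fun ζ => by module
    simp only [h1] at h
    have h2 : ENNReal.ofReal ((8 / 7) ^ (2 * n)) *
        ENNReal.ofReal (‖1 - t * (1 / 8)‖ ^ (2 * n)) ≥ 1 := by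
      rw [← ENNReal.ofReal_mul (by positivity), ← mul_pow, ge_iff_le, ENNReal.one_le_ofReal]
      exact one_le_pow₀ (by linarith)
    calc ∫⁻ ζ in Metric.ball (0 : Cn n) (1 / 8), G (ζ + t • ((1 / 8 : ℂ) • (u - ζ)))
        ≤ (ENNReal.ofReal ((8 / 7) ^ (2 * n)) * ENNReal.ofReal (‖1 - t * (1 / 8)‖ ^ (2 * n))) *
          ∫⁻ ζ in Metric.ball (0 : Cn n) (1 / 8), G (ζ + t • ((1 / 8 : ℂ) • (u - ζ))) :=
          le_mul_of_one_le_left zero_le h2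
      _ ≤ _ := by
          rw [mul_assoc, h]
          gcongr
          exact Measure.restrict_le_self
  have hGint : ∫⁻ ζ, G ζ = volume (ball n) * ∫⁻ ζ in B2, ‖q ζ * F ζ‖ₑ ∂(ballMeasure n) := by
    rw [hG, lintegral_indicator hB2m]
    have : (ballMeasure n).restrict B2 = (volume (ball n))⁻¹ • volume.restrict B2 := by
      rw [ballMeasure, Measure.restrict_smul, Measure.restrict_restrict hB2m]
      congr 2
      exact Set.inter_eq_left.2 (Metric.ball_subset_ball (by norm_num))
    rw [this, lintegral_smul_measure, smul_eq_mul, ← mul_assoc, ENNReal.mul_inv_cancel hvol1 hvol1',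
      one_mul]
  have hmain : ‖q u‖ₑ * ‖F 0‖ₑ * volume (Metric.ball (0 : Cn n) (1 / 8)) ≤ D * ∫⁻ ζ, G ζ := by
    calc ‖q u‖ₑ * ‖F 0‖ₑ * volume (Metric.ball (0 : Cn n) (1 / 8))
        ≤ ‖q u‖ₑ * ∫⁻ ζ in Metric.ball 0 (1 / 8), ‖F ζ‖ₑ := by
          rw [mul_assoc]
          gcongr
          exact enorm_mul_volume_le (by norm_num) hF
      _ = ∫⁻ ζ in Metric.ball 0 (1 / 8), ‖q u‖ₑ * ‖F ζ‖ₑ :=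
          (lintegral_const_mul' _ _ enorm_ne_top).symm
      _ ≤ ∫⁻ ζ in Metric.ball 0 (1 / 8), ENNReal.ofReal (9 ^ N) *
          (ENNReal.ofReal (2 * Real.pi)⁻¹ * ∫⁻ θ in Set.Ioc 0 (2 * Real.pi),
          G (ζ + circleMap 0 1 θ • ((1 / 8 : ℂ) • (u - ζ)))) :=
          setLIntegral_mono' Metric.isOpen_ball.measurableSet hline
      _ = ENNReal.ofReal (9 ^ N) * (ENNReal.ofReal (2 * Real.pi)⁻¹ *
          ∫⁻ θ in Set.Ioc 0 (2 * Real.pi), ∫⁻ ζ in Metric.ball (0 : Cn n) (1 / 8),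
          G (ζ + circleMap 0 1 θ • ((1 / 8 : ℂ) • (u - ζ)))) := by
          rw [lintegral_const_mul' _ _ ENNReal.ofReal_ne_top,
            lintegral_const_mul' _ _ ENNReal.ofReal_ne_top, lintegral_lintegral_swap]
          refine (hGm.comp ?_).aemeasurable
          have : Continuous fun x : Cn n × ℝ =>
              x.1 + circleMap 0 1 x.2 • ((1 / 8 : ℂ) • (u - x.1)) := by
            have := (continuous_circleMap 0 1).comp (continuous_snd (X := Cn n) (Y := ℝ))
            exact continuous_fst.add (this.smul (by fun_prop))
          exact this.measurable
      _ ≤ ENNReal.ofReal (9 ^ N) * (ENNReal.ofReal (2 * Real.pi)⁻¹ *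
          ∫⁻ _θ in Set.Ioc 0 (2 * Real.pi),
            ENNReal.ofReal ((8 / 7) ^ (2 * n)) * ∫⁻ ζ, G ζ) := by
          gcongr with θ
          exact haff θ
      _ = D * ∫⁻ ζ, G ζ := by
          rw [lintegral_const, Measure.restrict_apply_univ, Real.volume_Ioc, sub_zero]
          have : ENNReal.ofReal (2 * Real.pi)⁻¹ * ENNReal.ofReal (2 * Real.pi) = 1 := by
            rw [← ENNReal.ofReal_mul (by positivity), inv_mul_cancel₀ (by positivity),
              ENNReal.ofReal_one]
          rw [mul_comm _ (ENNReal.ofReal (2 * Real.pi)), ← mul_assoc (ENNReal.ofReal (2 * Real.pi)⁻¹),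
            this, one_mul, ← mul_assoc]
  rw [hGint] at hmain
  rw [hK]
  have := ENNReal.le_div_iff_mul_le (Or.inl hvol8) (Or.inl hvol8') |>.2 hmain
  refine this.trans_eq ?_
  simp only [div_eq_mul_inv]
  ring

end Growth


/-! ### Möbius invariant averages, growth estimates and the mean value property of the kernel -/

section MobiusGrowth

variable {n : ℕ}

/-- The kernel of the average over the pseudo-hyperbolic disc of radius `1 / 2` about `w`. -/
noncomputable def avgKer (w x : Cn n) : ℝ≥0∞ :=
  {p : Cn n × Cn n | 3 / 4 < om p.1 * om p.2 / ‖1 - inner ℂ p.1 p.2‖ ^ 2}.indicator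
    (fun p => ENNReal.ofReal (jac p.1 p.2)) (w, x)

lemma measurable_jac : Measurable (fun p : Cn n × Cn n => jac p.1 p.2) := by
  unfold jac
  have h1 : Measurable (fun p : Cn n × Cn n => om p.1) := (continuous_om.comp continuous_fst).measurable
  have h2 : Measurable (fun p : Cn n × Cn n => ‖1 - inner ℂ p.1 p.2‖) :=
    (by fun_prop : Continuous fun p : Cn n × Cn n => ‖1 - inner ℂ p.1 p.2‖).measurable
  exact (h1.div (h2.pow_const 2)).pow_const _

lemma measurable_ratio :
    Measurable (fun p : Cn n × Cn n => om p.1 * om p.2 / ‖1 - inner ℂ p.1 p.2‖ ^ 2) := by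
  have h1 : Measurable (fun p : Cn n × Cn n => om p.1) := (continuous_om.comp continuous_fst).measurable
  have h3 : Measurable (fun p : Cn n × Cn n => om p.2) := (continuous_om.comp continuous_snd).measurable
  have h2 : Measurable (fun p : Cn n × Cn n => ‖1 - inner ℂ p.1 p.2‖) :=
    (by fun_prop : Continuous fun p : Cn n × Cn n => ‖1 - inner ℂ p.1 p.2‖).measurable
  exact (h1.mul h3).div (h2.pow_const 2)

lemma measurable_avgKer : Measurable (fun p : Cn n × Cn n => avgKer p.1 p.2) :=
  (measurable_jac.ennreal_ofReal).indicator (measurableSet_lt measurable_const measurable_ratio)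

/-- The condition `ρ < 1 / 2` is `1 - ρ² > 3 / 4`. The definition of `avgKer` uses the second form
because its formula is visibly measurable in both variables. -/
lemma avgKer_eq {w x : Cn n} (hw : w ∈ ball n) (hx : x ∈ ball n) :
    avgKer w x = if pseudoHyp w x < 1 / 2 then ENNReal.ofReal (jac w x) else 0 := by
  have h := one_sub_pseudoHyp_sq hw hx
  have h0 := pseudoHyp_nonneg w x
  have : (3 / 4 < om w * om x / ‖1 - inner ℂ w x‖ ^ 2) ↔ pseudoHyp w x < 1 / 2 := by
    rw [← h]
    constructor <;> intro h1 <;> nlinarith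
  simp only [avgKer, Set.indicator, Set.mem_ofPred_eq, this]

lemma ofReal_jac_mul_avgKer {w u : Cn n} (hw : w ∈ ball n) (hu : u ∈ ball n) :
    ENNReal.ofReal (jac w u) * avgKer w (mobius w u) =
      (Metric.ball (0 : Cn n) (1 / 2)).indicator 1 u := by
  rw [avgKer_eq hw (mobius_mem_ball hw hu), pseudoHyp_mobius_right hw hu]
  by_cases h : ‖u‖ < 1 / 2
  · rw [if_pos h, Set.indicator_of_mem (by simpa using h), ← ENNReal.ofReal_mul (jac_nonneg hw _),
      mul_comm, jac_mobius hw hu]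
    simp
  · rw [if_neg h, Set.indicator_of_notMem (by simpa using h), mul_zero]

/-- Under `x = φ_w(u)` the two Jacobians cancel, and the average runs over a ball that does not
depend on `w`. -/
lemma lintegral_avgKer_mul {w : Cn n} (hw : w ∈ ball n) (g : Cn n → ℝ≥0∞) :
    ∫⁻ x, avgKer w x * g x ∂(ballMeasure n) =
      ∫⁻ u in Metric.ball 0 (1 / 2), g (mobius w u) ∂(ballMeasure n) := by
  rw [lintegral_mobius hw, ← lintegral_indicator Metric.isOpen_ball.measurableSet]
  refine lintegral_congr_ae ?_
  filter_upwards [ae_mem_ball n] with u hu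
  rw [← mul_assoc, ofReal_jac_mul_avgKer hw hu]
  by_cases h : u ∈ Metric.ball (0 : Cn n) (1 / 2)
  · simp only [Set.indicator_of_mem h, Pi.one_apply, one_mul]
  · simp only [Set.indicator_of_notMem h, zero_mul]

/-- The homogenization of `p ∘ φ_w`, which restricts to polynomials on lines. -/
lemma exists_isLinePoly_mobius {N : ℕ} {p : MvPolynomial (Fin n) ℂ} (hp : p.totalDegree ≤ N)
    {w : Cn n} (hw : w ∈ ball n) :
    ∃ q : Cn n → ℂ, IsLinePoly N q ∧ Continuous q ∧
      ∀ u ∈ ball n, q u = (1 - inner ℂ w u) ^ N * polyEval p (mobius w u) := by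
  have hdeg : ∀ d ∈ p.support, ∑ k, d k ≤ N := fun d hd => by
    have := (MvPolynomial.le_totalDegree hd).trans hp
    rwa [Finsupp.sum_fintype _ _ (fun _ => rfl)] at this
  refine ⟨fun u => ∑ d ∈ p.support, p.coeff d *
    ((∏ k, (w k - mobLin w u k) ^ d k) * (1 - inner ℂ w u) ^ (N - ∑ k, d k)), ?_, ?_, ?_⟩
  · refine isLinePoly_sum _ fun d hd => ?_
    have h1 : ∀ k ∈ Finset.univ, IsLinePoly (d k * 1) (fun u => (w k - mobLin w u k) ^ d k) :=
      fun k _ => (isLinePoly_affine (w k) ((EuclideanSpace.proj k).comp (mobLin w))).pow (d k)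
    have h2 := (isLinePoly_affine 1 (innerSL ℂ w)).pow (N - ∑ k, d k)
    have h3 := (isLinePoly_const (p.coeff d)).mul ((isLinePoly_prod _ h1).mul h2)
    refine h3.mono ?_
    have := hdeg d hd
    simp only [mul_one]
    omega
  · fun_prop
  · intro u hu
    have h0 := one_sub_inner_ne_zero hw hu
    simp only [polyEval, MvPolynomial.eval_eq', Finset.mul_sum]
    refine Finset.sum_congr rfl fun d hd => ?_
    have h1 : ∀ k, mobius w u k = (1 - inner ℂ w u)⁻¹ * (w k - mobLin w u k) := fun k => by
      rw [mobius_eq]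
      simp
    simp only [h1, mul_pow, Finset.prod_mul_distrib, Finset.prod_pow_eq_pow_sum]
    have h2 : (1 - inner ℂ w u) ^ N =
        (1 - inner ℂ w u) ^ (N - ∑ k, d k) * (1 - inner ℂ w u) ^ (∑ k, d k) := by
      rw [← pow_add, Nat.sub_add_cancel (hdeg d hd)]
    rw [h2, inv_pow]
    field_simp

/-- The growth of a polynomial compared with the average of its product with a holomorphic
function. -/
lemma enorm_polyEval_mul_le (n N : ℕ) :
    ∃ C : ℝ, 0 ≤ C ∧ ∀ (p : MvPolynomial (Fin n) ℂ), p.totalDegree ≤ N → ∀ (f : Cn n → ℂ),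
      ∀ w ∈ ball n, DifferentiableOn ℂ f {x | x ∈ ball n ∧ pseudoHyp w x < 1 / 2} →
      ∀ z ∈ ball n, ‖polyEval p z‖ₑ * ‖f w‖ₑ ≤
        ENNReal.ofReal (C * (‖1 - inner ℂ w z‖ / om w) ^ N) *
          ∫⁻ x, avgKer w x * ‖polyEval p x * f x‖ₑ ∂(ballMeasure n) := by
  obtain ⟨C, hC, hmain⟩ := enorm_mul_enorm_zero_le n N
  refine ⟨C, hC, fun p hp f w hw hf z hz => ?_⟩
  obtain ⟨q, hq, hqc, hq'⟩ := exists_isLinePoly_mobius hp hw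
  -- The factor `(1 - ⟨u, w⟩) ^ N` that clears the denominators of `p ∘ φ_w` is divided out of the
  -- holomorphic function, so the product is that of `p` and `f` in Möbius coordinates.
  set F : Cn n → ℂ := fun u => f (mobius w u) * ((1 - inner ℂ w u) ^ N)⁻¹ with hF
  have hhalf : Metric.ball (0 : Cn n) (1 / 2) ⊆ ball n := Metric.ball_subset_ball (by norm_num)
  have hFd : DifferentiableOn ℂ F (Metric.ball 0 (1 / 2)) := by
    refine DifferentiableOn.mul ?_ (DifferentiableOn.inv ?_ ?_)
    · refine hf.comp (fun u hu => ((hasFDerivAt_mobius hw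
        (hhalf hu)).differentiableAt).differentiableWithinAt) fun u hu => ?_
      refine ⟨mobius_mem_ball hw (hhalf hu), ?_⟩
      rw [pseudoHyp_mobius_right hw (hhalf hu)]
      simpa using hu
    · have : Differentiable ℂ (fun u : Cn n => inner ℂ w u) := (innerSL ℂ w).differentiable
      exact (((differentiable_const 1).sub this).pow N).differentiableOn
    · exact fun u hu => pow_ne_zero _ (one_sub_inner_ne_zero hw (hhalf hu))
  have h := hmain q F hq hqc hFd (mobius w z) (mobius_mem_ball hw hz)
  have hF0 : F 0 = f w := by simp [hF, mobius_zero_right]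
  have hint : ∫⁻ ζ in Metric.ball 0 (1 / 2), ‖q ζ * F ζ‖ₑ ∂(ballMeasure n) =
      ∫⁻ x, avgKer w x * ‖polyEval p x * f x‖ₑ ∂(ballMeasure n) := by
    rw [lintegral_avgKer_mul hw]
    refine setLIntegral_congr_fun Metric.isOpen_ball.measurableSet fun u hu => ?_
    have h0 := one_sub_inner_ne_zero hw (hhalf hu)
    simp only [hF]
    rw [hq' u (hhalf hu)]
    congr 1
    field_simp
  have hdz := norm_one_sub_inner_pos hw (mem_ball_iff.1 hz).le
  have ho := om_pos hw
  rw [hF0, hint, hq' _ (mobius_mem_ball hw hz), mobius_mobius hw hz, one_sub_inner_mobius_left hw hz]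
    at h
  -- At `u = φ_w(z)` the clearing factor equals `(om w / (1 - ⟨z, w⟩)) ^ N`; its inverse is the
  -- growth factor of the estimate.
  have h3 : ‖polyEval p z‖ₑ = ENNReal.ofReal ((‖1 - inner ℂ w z‖ / om w) ^ N) *
      ‖((om w : ℂ) / (1 - inner ℂ w z)) ^ N * polyEval p z‖ₑ := by
    rw [enorm_mul, ← mul_assoc, ← ofReal_norm (((om w : ℂ) / (1 - inner ℂ w z)) ^ N),
      ← ENNReal.ofReal_mul (by positivity), norm_pow, norm_div, Complex.norm_real,
      Real.norm_of_nonneg ho.le, ← mul_pow]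
    have : ‖1 - inner ℂ w z‖ / om w * (om w / ‖1 - inner ℂ w z‖) = 1 := by field_simp
    simp [this]
  rw [h3, mul_comm C, ENNReal.ofReal_mul (by positivity), mul_assoc, mul_assoc]
  gcongr

/-- The open pseudo-hyperbolic disc. -/
def near (z : Cn n) (τ : ℝ) : Set (Cn n) := {x | x ∈ ball n ∧ pseudoHyp z x < τ}

lemma isOpen_near {z : Cn n} (hz : z ∈ ball n) (τ : ℝ) : IsOpen (near z τ) := by
  have := (continuousOn_pseudoHyp hz).isOpen_inter_preimage (isOpen_ball n) (isOpen_Iio (a := τ))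
  convert this using 1
  ext x
  simp only [near, Set.mem_ofPred_eq, Set.mem_inter_iff, Set.mem_preimage, Set.mem_Iio]
  exact and_congr_right fun hx => by rw [pseudoHyp_comm hz hx]

/-- The reproducing kernel of a weighted Bergman space, with its weight. -/
noncomputable def bker (l : ℕ) (z w : Cn n) : ℂ :=
  (om w : ℂ) ^ l / (1 - inner ℂ w z) ^ (n + 1 + l)

/-- In the coordinates `x = φ_z(u)` the disc becomes a centred ball, and Jacobian and kernel combine
to the radial weight `(1 - |u|²) ^ l` times a function holomorphic in `u` with value `1` at the
centre. The mean value property therefore holds on discs of every radius `τ < 1`, with a normalizing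
constant independent of `z`. -/
lemma setIntegral_near_eq (l : ℕ) {z : Cn n} (hz : z ∈ ball n) {τ : ℝ} (hτ : τ < 1) {g : Cn n → ℂ}
    (hg : ContinuousOn g {x | x ∈ ball n ∧ pseudoHyp z x ≤ τ})
    (hg' : DifferentiableOn ℂ g (near z τ)) :
    ∫ x in near z τ, g x * bker l z x ∂(ballMeasure n) =
      g z * ∫ u in Metric.ball 0 τ, (om u : ℂ) ^ l ∂(ballMeasure n) := by
  have hcb : Metric.closedBall (0 : Cn n) τ ⊆ ball n := Metric.closedBall_subset_ball hτ
  have hbb : Metric.ball (0 : Cn n) τ ⊆ ball n := Metric.ball_subset_ball hτ.le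
  rw [← integral_indicator (isOpen_near hz τ).measurableSet, integral_mobius hz]
  have h1 : ∫ u, (jac z u : ℂ) * (near z τ).indicator (fun x => g x * bker l z x) (mobius z u)
      ∂(ballMeasure n) = ∫ u in Metric.ball 0 τ,
        (g (mobius z u) * ((1 - inner ℂ z u) ^ (n + 1 + l))⁻¹) * (om u : ℂ) ^ l
          ∂(ballMeasure n) := by
    rw [← integral_indicator Metric.isOpen_ball.measurableSet]
    refine integral_congr_ae ?_
    filter_upwards [ae_mem_ball n] with u hu
    have hm := mobius_mem_ball hz hu
    by_cases h : ‖u‖ < τ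
    · have hn : mobius z u ∈ near z τ := ⟨hm, by rwa [pseudoHyp_mobius_right hz hu]⟩
      rw [Set.indicator_of_mem hn, Set.indicator_of_mem (by simpa using h)]
      have h0 := one_sub_inner_ne_zero hz hu
      have h0' := one_sub_inner_ne_zero hu hz
      have ho : (om z : ℂ) ≠ 0 := by exact_mod_cast (om_pos hz).ne'
      have e1 : 1 - inner ℂ (mobius z u) z = (om z : ℂ) / (1 - inner ℂ u z) := by
        have := congrArg (starRingEnd ℂ) (one_sub_inner_mobius_left hz hu)
        simpa [inner_conj_symm] using this
      have e2 : ((‖1 - inner ℂ z u‖ : ℝ) : ℂ) ^ 2 = (1 - inner ℂ z u) * (1 - inner ℂ u z) := by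
        rw [← Complex.mul_conj', map_sub, map_one, inner_conj_symm]
      rw [bker, e1, om_mobius hz hu, jac]
      push_cast
      rw [e2]
      generalize hA : (1 - inner ℂ z u) = A at *
      generalize hB : (1 - inner ℂ u z) = B at *
      generalize n + 1 = m
      simp only [pow_add, div_pow, mul_pow]
      field_simp
    · have hn : mobius z u ∉ near z τ := fun hn => h (by
        have := hn.2
        rwa [pseudoHyp_mobius_right hz hu] at this)
      rw [Set.indicator_of_notMem hn, Set.indicator_of_notMem (by simpa using h), mul_zero]
  rw [h1]
  have hr : ∀ φ : Cn n → ℂ, ∫ u in Metric.ball 0 τ, φ u ∂(ballMeasure n) =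
      ((volume (ball n))⁻¹).toReal • ∫ u in Metric.ball 0 τ, φ u := fun φ => by
    rw [ballMeasure, Measure.restrict_smul,
      Measure.restrict_restrict Metric.isOpen_ball.measurableSet, Set.inter_eq_left.2 hbb,
      integral_smul_measure]
  rw [hr, hr, setIntegral_ball_eq (ψ := fun u => (om u : ℂ) ^ l)]
  · simp [mobius_zero_right]
    ring
  · refine ContinuousOn.mul (hg.comp (fun u hu => ((hasFDerivAt_mobius hz
      (hcb hu)).continuousAt).continuousWithinAt) fun u hu => ?_) (ContinuousOn.inv₀ ?_ ?_)
    · refine ⟨mobius_mem_ball hz (hcb hu), ?_⟩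
      rw [pseudoHyp_mobius_right hz (hcb hu)]
      simpa using hu
    · exact Continuous.continuousOn (by fun_prop)
    · exact fun u hu => pow_ne_zero _ (one_sub_inner_ne_zero hz (hcb hu))
  · refine DifferentiableOn.mul ?_ (DifferentiableOn.inv ?_ ?_)
    · refine hg'.comp (fun u hu => ((hasFDerivAt_mobius hz
        (hbb hu)).differentiableAt).differentiableWithinAt) fun u hu => ?_
      refine ⟨mobius_mem_ball hz (hbb hu), ?_⟩
      rw [pseudoHyp_mobius_right hz (hbb hu)]
      simpa using hu
    · have : Differentiable ℂ (fun u : Cn n => inner ℂ z u) := (innerSL ℂ z).differentiable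
      exact (((differentiable_const 1).sub this).pow _).differentiableOn
    · exact fun u hu => pow_ne_zero _ (one_sub_inner_ne_zero hz (hbb hu))
  · have := continuous_om (n := n)
    fun_prop
  · intro c hc u
    simp [om, norm_smul, hc]

end MobiusGrowth


/-! ### Schur's test -/

section Schur

lemma sq_lintegral_mul_le {X : Type*} [MeasurableSpace X] {μ : Measure X} {f g : X → ℝ≥0∞}
    (hf : AEMeasurable f μ) (hg : AEMeasurable g μ) :
    (∫⁻ x, f x * g x ∂μ) ^ 2 ≤ (∫⁻ x, f x ^ 2 ∂μ) * ∫⁻ x, g x ^ 2 ∂μ := by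
  have h := ENNReal.lintegral_mul_le_Lp_mul_Lq μ Real.HolderConjugate.two_two hf hg
  have h2 := pow_le_pow_left' h 2
  refine h2.trans_eq ?_
  have h3 : ∀ a : ℝ≥0∞, (a ^ (1 / 2 : ℝ)) ^ 2 = a := fun a => by
    rw [← ENNReal.rpow_natCast, ← ENNReal.rpow_mul]
    norm_num
  rw [mul_pow, h3, h3]
  norm_num

/-- Schur's test with a weight. -/
lemma lintegral_sq_lintegral_le {X : Type*} [MeasurableSpace X] {μ : Measure X} [SFinite μ]
    {K : X → X → ℝ≥0∞} (hK : Measurable (Function.uncurry K)) {s b v g : X → ℝ≥0∞}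
    (hs : Measurable s) (hb : Measurable b) (hv : Measurable v) (hg : Measurable g)
    (hs0 : ∀ᵐ x ∂μ, s x ≠ 0) (hs1 : ∀ᵐ x ∂μ, s x ≠ ∞) {A B : ℝ≥0∞}
    (h1 : ∀ᵐ z ∂μ, ∫⁻ w, K z w * s w ^ 2 ∂μ ≤ A * b z)
    (h2 : ∀ᵐ w ∂μ, ∫⁻ z, K z w * (b z * v z) ∂μ ≤ B * (s w ^ 2 * v w)) :
    ∫⁻ z, (∫⁻ w, K z w * g w ∂μ) ^ 2 * v z ∂μ ≤ A * B * ∫⁻ w, g w ^ 2 * v w ∂μ := by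
  have hKz : ∀ z, Measurable (K z) := fun z => hK.comp measurable_prodMk_left
  have hsg : Measurable fun w => (s w)⁻¹ * g w := hs.inv.mul hg
  have hsg2 : Measurable fun w => ((s w)⁻¹ * g w) ^ 2 := hsg.pow_const 2
  have hs2 : Measurable fun w => s w ^ 2 := hs.pow_const 2
  have hssg : Measurable fun w => s w * ((s w)⁻¹ * g w) := hs.mul hsg
  have hcs : ∀ᵐ z ∂μ, (∫⁻ w, K z w * g w ∂μ) ^ 2 ≤
      A * b z * ∫⁻ w, K z w * ((s w)⁻¹ * g w) ^ 2 ∂μ := by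
    filter_upwards [h1] with z hz
    -- Cauchy–Schwarz for the measure with density `K z`, applied to the factorization `g = s * (s⁻¹
    -- * g)`.
    have h := sq_lintegral_mul_le (μ := μ.withDensity (K z)) hs.aemeasurable
      hsg.aemeasurable
    rw [lintegral_withDensity_eq_lintegral_mul _ (hKz z) hssg,
      lintegral_withDensity_eq_lintegral_mul _ (hKz z) hs2,
      lintegral_withDensity_eq_lintegral_mul _ (hKz z) hsg2] at h
    have he : ∫⁻ w, K z w * g w ∂μ =
        ∫⁻ w, (K z * fun w => s w * ((s w)⁻¹ * g w)) w ∂μ := by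
      refine lintegral_congr_ae ?_
      filter_upwards [hs0, hs1] with w hw0 hw1
      simp only [Pi.mul_apply]
      rw [← mul_assoc (s w), ENNReal.mul_inv_cancel hw0 hw1, one_mul]
    rw [he]
    refine h.trans ?_
    gcongr
    · exact hz
    · exact le_rfl
  calc ∫⁻ z, (∫⁻ w, K z w * g w ∂μ) ^ 2 * v z ∂μ
      ≤ ∫⁻ z, A * ∫⁻ w, K z w * (b z * v z) * ((s w)⁻¹ * g w) ^ 2 ∂μ ∂μ := by
        refine lintegral_mono_ae ?_
        filter_upwards [hcs] with z hz
        calc (∫⁻ w, K z w * g w ∂μ) ^ 2 * v z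
            ≤ A * b z * (∫⁻ w, K z w * ((s w)⁻¹ * g w) ^ 2 ∂μ) * v z := by gcongr
          _ = A * ((b z * v z) * ∫⁻ w, K z w * ((s w)⁻¹ * g w) ^ 2 ∂μ) := by ring
          _ = A * ∫⁻ w, K z w * (b z * v z) * ((s w)⁻¹ * g w) ^ 2 ∂μ := by
            have hm : Measurable fun w => K z w * ((s w)⁻¹ * g w) ^ 2 := (hKz z).mul hsg2
            rw [← lintegral_const_mul _ hm]
            congr 1
            refine lintegral_congr fun w => ?_
            ring
    _ = A * ∫⁻ w, (∫⁻ z, K z w * (b z * v z) ∂μ) * ((s w)⁻¹ * g w) ^ 2 ∂μ := by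
        have hm : Measurable (Function.uncurry fun z w =>
            K z w * (b z * v z) * ((s w)⁻¹ * g w) ^ 2) :=
          (hK.mul ((hb.mul hv).comp measurable_fst)).mul
            (hsg2.comp measurable_snd)
        have hm2 : Measurable fun z => ∫⁻ w, K z w * (b z * v z) * ((s w)⁻¹ * g w) ^ 2 ∂μ :=
          hm.lintegral_prod_right'
        rw [lintegral_const_mul _ hm2, lintegral_lintegral_swap hm.aemeasurable]
        congr 1
        refine lintegral_congr fun w => ?_
        have hm3 : Measurable fun z => K z w * (b z * v z) :=
          (hK.comp measurable_prodMk_right).mul (hb.mul hv)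
        rw [lintegral_mul_const _ hm3]
    _ ≤ A * ∫⁻ w, B * (g w ^ 2 * v w) ∂μ := by
        gcongr A * ?_
        refine lintegral_mono_ae ?_
        filter_upwards [h2, hs0, hs1] with w hw hw0 hw1
        calc (∫⁻ z, K z w * (b z * v z) ∂μ) * ((s w)⁻¹ * g w) ^ 2
            ≤ B * (s w ^ 2 * v w) * ((s w)⁻¹ * g w) ^ 2 := by gcongr
          _ = B * ((s w * (s w)⁻¹) ^ 2 * (g w ^ 2 * v w)) := by ring
          _ = B * (g w ^ 2 * v w) := by rw [ENNReal.mul_inv_cancel hw0 hw1]; ring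
    _ = A * B * ∫⁻ w, g w ^ 2 * v w ∂μ := by
        have hm4 : Measurable fun w => g w ^ 2 * v w := (hg.pow_const 2).mul hv
        rw [lintegral_const_mul _ hm4, mul_assoc]

end Schur

/-! ### Averaging operators and dyadic domination of kernels -/

section Estimates

variable {n : ℕ}

lemma weight_eq (z : Cn n) : weight z = ENNReal.ofReal (om z) := rfl

lemma measurable_weight : Measurable (weight (n := n)) :=
  (continuous_om.measurable).ennreal_ofReal

lemma om_le_two_mul_norm {z w : Cn n} (hz : z ∈ ball n) (hw : w ∈ ball n) :
    om w ≤ 2 * ‖1 - inner ℂ w z‖ := by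
  rw [mem_ball_iff] at hz hw
  have h1 := norm_inner_le_norm (𝕜 := ℂ) w z
  have h2 := norm_sub_norm_le (1 : ℂ) (inner ℂ w z)
  rw [norm_one] at h2
  unfold om
  nlinarith [norm_nonneg w, norm_nonneg z]

lemma norm_one_sub_inner_le_two {z w : Cn n} (hz : z ∈ ball n) (hw : w ∈ ball n) :
    ‖1 - inner ℂ w z‖ ≤ 2 := by
  have h := norm_inner_lt_one hw (mem_ball_iff.1 hz).le
  have := norm_sub_le (1 : ℂ) (inner ℂ w z)
  rw [norm_one] at this
  linarith

/-- The averaging operator over pseudo-hyperbolic discs. -/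
noncomputable def avg (G : Cn n → ℝ≥0∞) (w : Cn n) : ℝ≥0∞ :=
  ∫⁻ x, avgKer w x * G x ∂(ballMeasure n)

lemma measurable_avg {G : Cn n → ℝ≥0∞} (hG : Measurable G) : Measurable (avg G) :=
  (measurable_avgKer.mul (hG.comp measurable_snd)).lintegral_prod_right'

/-- Where `ρ < 1 / 2`, the inequalities `(3 / 4) |1 - ⟨x, w⟩|² < om w * om x` and `om w ≤ 2 |1 - ⟨x,
w⟩|` force `om w ≤ 6 * om x`, so the roles of `w` and `x` can be exchanged. The exponent `n + 2`
counts `n + 1` for the Jacobian and one for the weight. -/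
lemma avgKer_le {w x : Cn n} (hw : w ∈ ball n) (hx : x ∈ ball n) {κ : ℕ} (hκ : κ ≤ 1) :
    avgKer w x * weight w ^ κ ≤
      ENNReal.ofReal (6 ^ (n + 2)) * (ENNReal.ofReal (jac x w) * weight x ^ κ) := by
  have hj : 0 ≤ jac w x := jac_nonneg hw x
  have hj' : 0 ≤ jac x w := jac_nonneg hx w
  have how := om_pos hw
  have hox := om_pos hx
  have hD := norm_one_sub_inner_pos hw (mem_ball_iff.1 hx).le
  rw [avgKer_eq hw hx]
  split_ifs with h
  · have h1 := one_sub_pseudoHyp_sq hw hx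
    have h2 : 3 / 4 < om w * om x / ‖1 - inner ℂ w x‖ ^ 2 := by
      rw [← h1]
      nlinarith [pseudoHyp_nonneg w x]
    rw [lt_div_iff₀ (by positivity)] at h2
    have h3 := om_le_two_mul_norm hx hw
    have h4 : om w ≤ 6 * om x := by
      by_contra! hc
      nlinarith
    have h5 : jac w x ≤ 6 ^ (n + 1) * jac x w := by
      unfold jac
      rw [← mul_pow, norm_one_sub_inner_comm x w, ← mul_div_assoc]
      gcongr
    have h6 : om w ^ κ ≤ 6 * om x ^ κ := by
      interval_cases κ
      · simp
      · simpa using h4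
    rw [weight_eq, weight_eq, ← ENNReal.ofReal_pow how.le, ← ENNReal.ofReal_pow hox.le,
      ← ENNReal.ofReal_mul hj, ← ENNReal.ofReal_mul hj', ← ENNReal.ofReal_mul (by positivity)]
    refine ENNReal.ofReal_le_ofReal ?_
    calc jac w x * om w ^ κ ≤ (6 ^ (n + 1) * jac x w) * (6 * om x ^ κ) := by gcongr
      _ = _ := by ring
  · simp

/-- Schur's test with constant test functions: integrals over `x` are at most the integral of a
Jacobian, which is one, and integrals over `w` are reduced to that case by `avgKer_le`. -/
lemma lintegral_avg_sq_le {κ : ℕ} (hκ : κ ≤ 1) {G : Cn n → ℝ≥0∞} (hG : Measurable G) :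
    ∫⁻ w, avg G w ^ 2 * weight w ^ κ ∂(ballMeasure n) ≤
      ENNReal.ofReal (6 ^ (n + 2)) * ∫⁻ x, G x ^ 2 * weight x ^ κ ∂(ballMeasure n) := by
  have h := lintegral_sq_lintegral_le (μ := ballMeasure n) (K := avgKer) (A := 1)
    (B := ENNReal.ofReal (6 ^ (n + 2))) measurable_avgKer
    (s := fun _ => 1) (b := fun _ => 1) (v := fun w => weight w ^ κ) (g := G) measurable_const
    measurable_const (measurable_weight.pow_const κ) hG (by simp) (by simp) ?_ ?_
  · simpa [avg] using h
  · filter_upwards [ae_mem_ball n] with w hw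
    simp only [one_pow, mul_one]
    rw [← lintegral_jac hw]
    refine lintegral_mono_ae ?_
    filter_upwards [ae_mem_ball n] with x hx
    rw [avgKer_eq hw hx]
    split_ifs <;> simp
  · filter_upwards [ae_mem_ball n] with x hx
    simp only [one_pow, one_mul]
    calc ∫⁻ w, avgKer w x * weight w ^ κ ∂(ballMeasure n)
        ≤ ∫⁻ w, ENNReal.ofReal (6 ^ (n + 2)) * (ENNReal.ofReal (jac x w) * weight x ^ κ)
            ∂(ballMeasure n) := by
          refine lintegral_mono_ae ?_
          filter_upwards [ae_mem_ball n] with w hw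
          exact avgKer_le hw hx hκ
      _ = ENNReal.ofReal (6 ^ (n + 2)) * weight x ^ κ := by
          have hm : Measurable fun w => ENNReal.ofReal (jac x w) :=
            (measurable_jac.comp measurable_prodMk_left).ennreal_ofReal
          rw [lintegral_const_mul _ (hm.mul_const _), lintegral_mul_const _ hm, lintegral_jac hx,
            one_mul]

/-- The square root of the defect. -/
noncomputable def rom (z : Cn n) : ℝ := Real.sqrt (om z)

/-- The fourth root of the defect. -/
noncomputable def qom (z : Cn n) : ℝ := Real.sqrt (rom z)

lemma rom_pos {z : Cn n} (hz : z ∈ ball n) : 0 < rom z := Real.sqrt_pos.2 (om_pos hz)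

lemma qom_pos {z : Cn n} (hz : z ∈ ball n) : 0 < qom z := Real.sqrt_pos.2 (rom_pos hz)

lemma rom_sq {z : Cn n} (hz : z ∈ ball n) : rom z ^ 2 = om z := Real.sq_sqrt (om_pos hz).le

lemma qom_sq {z : Cn n} (hz : z ∈ ball n) : qom z ^ 2 = rom z := Real.sq_sqrt (rom_pos hz).le

lemma qom_pow {z : Cn n} (hz : z ∈ ball n) : qom z ^ 4 = om z := by
  rw [← rom_sq hz, ← qom_sq hz]
  ring

lemma continuous_qom : Continuous (qom (n := n)) :=
  Real.continuous_sqrt.comp (Real.continuous_sqrt.comp continuous_om)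

lemma om_smul_ge {z : Cn n} (hz : z ∈ ball n) {r : ℝ} (h0 : 0 ≤ r) (h1 : r ≤ 1) :
    1 - r ≤ om ((r : ℂ) • z) := by
  rw [mem_ball_iff] at hz
  unfold om
  rw [norm_smul, Complex.norm_real, Real.norm_of_nonneg h0, mul_pow]
  have : ‖z‖ ^ 2 ≤ 1 := by nlinarith [norm_nonneg z]
  nlinarith [sq_nonneg r, sq_nonneg ‖z‖]

/-- Take the first `k` for which `e = 16^(-k)` is at most `|1 - ⟨z, w⟩|`. The point `a = (1 - e) z`
satisfies `om a ≥ e` and `|1 - ⟨w, a⟩| ≤ 17 e`, so the Jacobian of `φ_a` at `w` is at least `(17²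
e)^(-(n + 1))`. The base `16` is chosen so that the fourth root `d` is at least `2^(-k)`. -/
lemma exists_dyadic {z w : Cn n} (hz : z ∈ ball n) (hw : w ∈ ball n) {K : ℕ}
    (hK : (1 / 16 : ℝ) ^ K ≤ 1 - ‖z‖) {d : ℝ} (hd : 0 < d) (hd4 : d ^ 4 = ‖1 - inner ℂ w z‖) :
    ∃ k ∈ Finset.range (K + 1), (‖1 - inner ℂ w z‖ ^ (n + 1) * d)⁻¹ ≤
      17 ^ (2 * (n + 1)) * (2 ^ k * jac (((1 - (1 / 16) ^ k : ℝ) : ℂ) • z) w) := by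
  have hD0 := norm_one_sub_inner_pos hw (mem_ball_iff.1 hz).le
  have hex : ∃ k, (1 / 16 : ℝ) ^ k ≤ ‖1 - inner ℂ w z‖ := ⟨K, by
    have h1 := norm_inner_le_norm (𝕜 := ℂ) w z
    have h2 := norm_sub_norm_le (1 : ℂ) (inner ℂ w z)
    rw [norm_one] at h2
    rw [mem_ball_iff] at hw
    nlinarith [norm_nonneg w, norm_nonneg z]⟩
  classical
  set k := Nat.find hex with hk
  have hkD := Nat.find_spec hex
  rw [← hk] at hkD
  have hkK : k ≤ K := Nat.find_min' hex (by
    have h1 := norm_inner_le_norm (𝕜 := ℂ) w z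
    have h2 := norm_sub_norm_le (1 : ℂ) (inner ℂ w z)
    rw [norm_one] at h2
    rw [mem_ball_iff] at hw
    nlinarith [norm_nonneg w, norm_nonneg z])
  refine ⟨k, Finset.mem_range.2 (by omega), ?_⟩
  set e : ℝ := (1 / 16) ^ k with he
  have he0 : 0 < e := by positivity
  have he1 : e ≤ 1 := pow_le_one₀ (by norm_num) (by norm_num)
  have hup : ‖1 - inner ℂ w z‖ ≤ 16 * e := by
    rcases Nat.eq_zero_or_pos k with h0 | hpos
    · rw [he, h0]
      linarith [norm_one_sub_inner_le_two hz hw]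
    · have := Nat.find_min hex (m := k - 1) (by omega)
      push Not at this
      refine this.le.trans_eq ?_
      rw [he]
      obtain ⟨j, hj⟩ : ∃ j, k = j + 1 := ⟨k - 1, by omega⟩
      rw [hj, Nat.add_sub_cancel, pow_succ]
      ring
  set a : Cn n := ((1 - e : ℝ) : ℂ) • z with ha
  have haom : e ≤ om a := by
    have := om_smul_ge hz (r := 1 - e) (by linarith) (by linarith)
    linarith
  have hab : a ∈ ball n := mem_ball_of_om_pos (he0.trans_le haom)
  have haom0 := om_pos hab
  have hE0 := norm_one_sub_inner_pos hab (mem_ball_iff.1 hw).le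
  have hE : ‖1 - inner ℂ a w‖ ≤ 17 * e := by
    rw [norm_one_sub_inner_comm]
    have h3 : 1 - inner ℂ w a = (1 - inner ℂ w z) + (e : ℂ) * inner ℂ w z := by
      rw [ha, inner_smul_right]
      push_cast
      ring
    rw [h3]
    have h4 := norm_inner_lt_one hw (mem_ball_iff.1 hz).le
    calc _ ≤ ‖1 - inner ℂ w z‖ + ‖(e : ℂ) * inner ℂ w z‖ := norm_add_le _ _
      _ ≤ 16 * e + e * 1 := by
        rw [norm_mul, Complex.norm_real, Real.norm_of_nonneg he0.le]
        gcongr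
      _ = 17 * e := by ring
  have hd2 : (2 ^ k)⁻¹ ≤ d := by
    have : ((2 ^ k)⁻¹ : ℝ) ^ 4 ≤ d ^ 4 := by
      rw [hd4]
      refine le_trans (le_of_eq ?_) hkD
      rw [he, ← inv_pow, ← pow_mul, mul_comm, pow_mul]
      norm_num
    exact le_of_pow_le_pow_left₀ (by norm_num) hd.le this
  have hjac : (17 ^ (2 * (n + 1)) * e ^ (n + 1))⁻¹ ≤ jac a w := by
    unfold jac
    calc (17 ^ (2 * (n + 1)) * e ^ (n + 1))⁻¹ = (e / (17 * e) ^ 2) ^ (n + 1) := by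
          rw [pow_mul, ← mul_pow, ← inv_pow]
          congr 1
          field_simp
      _ ≤ _ := by gcongr
  calc (‖1 - inner ℂ w z‖ ^ (n + 1) * d)⁻¹ ≤ (e ^ (n + 1) * (2 ^ k)⁻¹)⁻¹ := by gcongr
    _ = 17 ^ (2 * (n + 1)) * (2 ^ k * (17 ^ (2 * (n + 1)) * e ^ (n + 1))⁻¹) := by
      field_simp
    _ ≤ _ := by gcongr

end Estimates


/-! ### Forelli–Rudin estimates and off-diagonal decay -/

section ForelliRudin

variable {n : ℕ}

/-- By `exists_dyadic` the integrand is dominated by the sum over `k ≤ K` of `2^k` times a Jacobian.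
Every Jacobian has integral one, which leaves a geometric sum of size `2^K`; since `16^(-K)` is
comparable to `1 - |z|`, this is of the order of `1 / qom z`. -/
lemma lintegral_inv_norm_pow_le (n : ℕ) : ∃ C : ℝ, 0 < C ∧ ∀ z ∈ ball n,
    ∫⁻ w, ENNReal.ofReal ((‖1 - inner ℂ w z‖ ^ (n + 1) * Real.sqrt (Real.sqrt ‖1 - inner ℂ w z‖))⁻¹)
      ∂(ballMeasure n) ≤ ENNReal.ofReal (C / qom z) := by
  refine ⟨17 ^ (2 * (n + 1)) * 8, by positivity, fun z hz => ?_⟩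
  have hz1 : 0 < 1 - ‖z‖ := by
    rw [mem_ball_iff] at hz
    linarith
  have hq := qom_pos hz
  have hex : ∃ K, (1 / 16 : ℝ) ^ K ≤ 1 - ‖z‖ :=
    (exists_pow_lt_of_lt_one hz1 (by norm_num)).imp fun _ h => h.le
  classical
  set K := Nat.find hex with hK
  have hK1 := Nat.find_spec hex
  rw [← hK] at hK1
  have hq1 : qom z ≤ 1 := by
    have := qom_pow hz
    have h2 := om_le_one z
    by_contra! hc
    have : 1 < qom z ^ 4 := one_lt_pow₀ hc (by norm_num)
    linarith
  have hK2 : (2 : ℝ) ^ K ≤ 4 / qom z := by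
    rw [le_div_iff₀ hq]
    rcases Nat.eq_zero_or_pos K with h0 | hpos
    · rw [h0]
      linarith
    · obtain ⟨j, hj⟩ : ∃ j, K = j + 1 := ⟨K - 1, by omega⟩
      have hm := Nat.find_min hex (m := j) (by omega)
      push Not at hm
      have h1 : om z ≤ 2 * (1 - ‖z‖) := by
        rw [mem_ball_iff] at hz
        unfold om
        nlinarith [norm_nonneg z]
      have h2 : (2 ^ j * qom z) ^ 4 ≤ 2 ^ 4 := by
        rw [mul_pow, qom_pow hz]
        have h3 : ((2 : ℝ) ^ j) ^ 4 * (1 / 16) ^ j = 1 := by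
          rw [← pow_mul, mul_comm j 4, pow_mul, ← mul_pow]
          norm_num
        have h4 : (0 : ℝ) < (2 ^ j) ^ 4 := by positivity
        nlinarith
      have h5 := le_of_pow_le_pow_left₀ (by norm_num) (by norm_num) h2
      rw [hj, pow_succ]
      linarith
  set D : ℝ := 17 ^ (2 * (n + 1)) with hD
  set J : ℕ → Cn n → ℝ := fun k w => jac (((1 - (1 / 16) ^ k : ℝ) : ℂ) • z) w with hJ
  have hball : ∀ k : ℕ, ((1 - (1 / 16) ^ k : ℝ) : ℂ) • z ∈ ball n := fun k => by
    have h1 : (1 / 16 : ℝ) ^ k ≤ 1 := pow_le_one₀ (by norm_num) (by norm_num)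
    have h0 : (0 : ℝ) < (1 / 16 : ℝ) ^ k := by positivity
    have := om_smul_ge hz (r := 1 - (1 / 16) ^ k) (by linarith) (by linarith)
    exact mem_ball_of_om_pos (by linarith)
  have hJ0 : ∀ k w, 0 ≤ J k w := fun k w => jac_nonneg (hball k) w
  calc _ ≤ ∫⁻ w, ∑ k ∈ Finset.range (K + 1), ENNReal.ofReal (D * 2 ^ k) * ENNReal.ofReal (J k w)
        ∂(ballMeasure n) := by
        refine lintegral_mono_ae ?_
        filter_upwards [ae_mem_ball n] with w hw
        have hd0 := norm_one_sub_inner_pos hw (mem_ball_iff.1 hz).le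
        obtain ⟨k, hk, hle⟩ := exists_dyadic (n := n) hz hw hK1
          (d := Real.sqrt (Real.sqrt ‖1 - inner ℂ w z‖))
          (Real.sqrt_pos.2 (Real.sqrt_pos.2 hd0)) (by
            rw [show 4 = 2 * 2 from rfl, pow_mul, Real.sq_sqrt (Real.sqrt_nonneg _),
              Real.sq_sqrt hd0.le])
        refine (ENNReal.ofReal_le_ofReal hle).trans ?_
        rw [← mul_assoc, ENNReal.ofReal_mul (by positivity)]
        exact Finset.single_le_sum (f := fun k =>
          ENNReal.ofReal (D * 2 ^ k) * ENNReal.ofReal (J k w)) (fun _ _ => zero_le) hk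
    _ = ∑ k ∈ Finset.range (K + 1), ENNReal.ofReal (D * 2 ^ k) := by
        have hm : ∀ k, Measurable fun w => ENNReal.ofReal (J k w) := fun k =>
          (measurable_jac.comp measurable_prodMk_left).ennreal_ofReal
        rw [lintegral_finsetSum _ fun k _ => (hm k).const_mul _]
        refine Finset.sum_congr rfl fun k _ => ?_
        rw [lintegral_const_mul _ (hm k), lintegral_jac (hball k), mul_one]
    _ ≤ ENNReal.ofReal (D * 8 / qom z) := by
        rw [← ENNReal.ofReal_sum_of_nonneg (fun k _ => by positivity)]
        refine ENNReal.ofReal_le_ofReal ?_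
        rw [← Finset.mul_sum, mul_div_assoc]
        gcongr
        have : ∑ k ∈ Finset.range (K + 1), (2 : ℝ) ^ k = 2 * 2 ^ K - 1 := by
          rw [geom_sum_eq (by norm_num), pow_succ]
          ring
        rw [this]
        have : 8 / qom z = 2 * (4 / qom z) := by ring
        linarith

lemma ballMeasure_shell_le (n : ℕ) {s : ℝ} (hs0 : 0 < s) (hs1 : s ≤ 1) :
    ballMeasure n {u | 1 - ‖u‖ ≤ s} ≤
      ENNReal.ofReal ((Module.finrank ℝ (Cn n) + 1) * s) := by
  set m := Module.finrank ℝ (Cn n)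
  rcases hs1.eq_or_lt with rfl | hs1
  · refine prob_le_one.trans ?_
    rw [ENNReal.one_le_ofReal]
    have : (0 : ℝ) ≤ m := Nat.cast_nonneg _
    linarith
  · have hc : {u : Cn n | 1 - ‖u‖ ≤ s} = (Metric.ball 0 (1 - s))ᶜ := by
      ext u
      simp
      constructor <;> intro h <;> linarith
    have hv1 : volume (ball n) ≠ 0 := (Metric.measure_ball_pos volume _ (by norm_num)).ne'
    have hv1' : volume (ball n) ≠ ∞ := measure_ball_lt_top.ne
    have hb : ballMeasure n (Metric.ball 0 (1 - s)) = ENNReal.ofReal ((1 - s) ^ m) := by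
      rw [ballMeasure, Measure.smul_apply, Measure.restrict_apply Metric.isOpen_ball.measurableSet,
        Set.inter_eq_left.2 (show Metric.ball 0 (1 - s) ⊆ ball n from
          Metric.ball_subset_ball (by linarith)),
        Measure.addHaar_ball_of_pos _ _ (by linarith), smul_eq_mul, mul_comm, mul_assoc]
      rw [show Metric.ball (0 : Cn n) 1 = ball n from rfl, ENNReal.mul_inv_cancel hv1 hv1', mul_one]
    rw [hc, prob_compl_eq_one_sub Metric.isOpen_ball.measurableSet, hb, ← ENNReal.ofReal_one,
      ← ENNReal.ofReal_sub _ (by have : 0 ≤ 1 - s := by linarith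
                                 positivity)]
    refine ENNReal.ofReal_le_ofReal ?_
    have := one_add_mul_le_pow (a := -s) (by linarith) m
    have h2 : (1 + -s) = 1 - s := by ring
    rw [h2] at this
    nlinarith

/-- A shell of width `4^(-k)` has measure `O(4^(-k))`, and the part of it not in the next shell has
integrand at most `2^(k + 1)`; the resulting series is geometric with ratio `1 / 2`. -/
lemma lintegral_inv_rom_lt_top (n : ℕ) :
    ∫⁻ u, ENNReal.ofReal (1 / rom u) ∂(ballMeasure n) < ∞ := by
  set m : ℝ := (Module.finrank ℝ (Cn n) : ℝ)
  have hm0 : 0 ≤ m := Nat.cast_nonneg _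
  have hset : ∀ k : ℕ, MeasurableSet {u : Cn n | 1 - ‖u‖ ≤ (1 / 4 : ℝ) ^ k} := fun k =>
    measurableSet_le (by fun_prop) measurable_const
  calc ∫⁻ u, ENNReal.ofReal (1 / rom u) ∂(ballMeasure n)
      ≤ ∫⁻ u, ∑' k : ℕ, {u : Cn n | 1 - ‖u‖ ≤ (1 / 4 : ℝ) ^ k}.indicator
          (fun _ => ENNReal.ofReal (2 ^ (k + 1))) u ∂(ballMeasure n) := by
        refine lintegral_mono_ae ?_
        filter_upwards [ae_mem_ball n] with u hu
        have hu1 : 0 < 1 - ‖u‖ := by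
          rw [mem_ball_iff] at hu
          linarith
        have hex : ∃ k, (1 / 4 : ℝ) ^ (k + 1) ≤ 1 - ‖u‖ := by
          obtain ⟨k, hk⟩ := exists_pow_lt_of_lt_one hu1 (by norm_num : (1 / 4 : ℝ) < 1)
          exact ⟨k, (pow_le_pow_of_le_one (by norm_num) (by norm_num) (Nat.le_succ k)).trans hk.le⟩
        classical
        set k := Nat.find hex with hk
        have h1 := Nat.find_spec hex
        rw [← hk] at h1
        have h2 : 1 - ‖u‖ ≤ (1 / 4 : ℝ) ^ k := by
          rcases Nat.eq_zero_or_pos k with h0 | hpos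
          · rw [h0]
            simp
          · obtain ⟨j, hj⟩ : ∃ j, k = j + 1 := ⟨k - 1, by omega⟩
            have := Nat.find_min hex (m := j) (by omega)
            push Not at this
            rw [hj]
            exact this.le
        refine le_trans ?_ (ENNReal.le_tsum k)
        rw [Set.indicator_of_mem (by exact h2)]
        refine ENNReal.ofReal_le_ofReal ?_
        have h3 : 1 - ‖u‖ ≤ om u := by
          rw [mem_ball_iff] at hu
          unfold om
          nlinarith [norm_nonneg u]
        have h4 : ((2 : ℝ) ^ (k + 1))⁻¹ ≤ rom u := by
          refine Real.le_sqrt_of_sq_le ?_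
          refine le_trans (le_of_eq ?_) (h1.trans h3)
          rw [← inv_pow, ← pow_mul, mul_comm, pow_mul]
          norm_num
        rw [one_div]
        exact inv_le_of_inv_le₀ (by positivity) h4
    _ = ∑' k : ℕ, ENNReal.ofReal (2 ^ (k + 1)) *
          ballMeasure n {u : Cn n | 1 - ‖u‖ ≤ (1 / 4 : ℝ) ^ k} := by
        rw [lintegral_tsum fun k => (measurable_const.indicator (hset k)).aemeasurable]
        simp only [lintegral_indicator_const (hset _)]
    _ ≤ ∑' k : ℕ, ENNReal.ofReal (2 * (m + 1) * (1 / 2) ^ k) := by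
        refine ENNReal.tsum_le_tsum fun k => ?_
        refine (mul_le_mul_right (ballMeasure_shell_le n (by positivity)
          (pow_le_one₀ (by norm_num) (by norm_num))) _).trans_eq ?_
        rw [← ENNReal.ofReal_mul (by positivity)]
        congr 1
        have : (1 / 4 : ℝ) ^ k = (1 / 2) ^ k * (1 / 2) ^ k := by
          rw [← mul_pow]
          norm_num
        rw [this, pow_succ]
        have h2 : (2 : ℝ) ^ k * (1 / 2) ^ k = 1 := by
          rw [← mul_pow]
          norm_num
        linear_combination (2 * (m + 1) * (1 / 2) ^ k) * h2
    _ < ∞ := by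
        have hs : Summable fun k : ℕ => 2 * (m + 1) * (1 / 2 : ℝ) ^ k :=
          (summable_geometric_of_lt_one (by norm_num) (by norm_num)).mul_left _
        rw [← ENNReal.ofReal_tsum_of_nonneg (fun k => by positivity) hs]
        exact ENNReal.ofReal_lt_top

/-- The absolute value of the kernel that remains after the growth of the polynomials has been
absorbed. -/
noncomputable def hker (z w : Cn n) : ℝ≥0∞ :=
  ENNReal.ofReal (om w ^ (n + 2) / ‖1 - inner ℂ w z‖ ^ (2 * n + 3))

/-- The part of `hker` at a hyperbolic distance that is large for small `θ`. -/
noncomputable def farKer (θ : ℝ) (z w : Cn n) : ℝ≥0∞ :=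
  {p : Cn n × Cn n | om p.1 * om p.2 / ‖1 - inner ℂ p.1 p.2‖ ^ 2 ≤ θ ^ 4}.indicator
    (fun p => hker p.1 p.2) (z, w)

lemma measurable_hker : Measurable (Function.uncurry (hker (n := n))) := by
  refine Measurable.ennreal_ofReal ?_
  have h1 : Measurable (fun p : Cn n × Cn n => om p.2) := (continuous_om.comp continuous_snd).measurable
  have h2 : Measurable (fun p : Cn n × Cn n => ‖1 - inner ℂ p.2 p.1‖) :=
    (by fun_prop : Continuous fun p : Cn n × Cn n => ‖1 - inner ℂ p.2 p.1‖).measurable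
  exact (h1.pow_const _).div (h2.pow_const _)

lemma measurable_farKer (θ : ℝ) : Measurable (Function.uncurry (farKer (n := n) θ)) :=
  measurable_hker.indicator (measurableSet_le measurable_ratio measurable_const)

lemma farKer_le (θ : ℝ) (z w : Cn n) : farKer θ z w ≤ hker z w := by
  unfold farKer
  exact Set.indicator_le_self' (f := fun p : Cn n × Cn n => hker p.1 p.2) (fun _ _ => zero_le) (z, w)

/-- With `d⁴ = |1 - ⟨z, w⟩|`, the defining inequality of the far region reads `qom z * qom w ≤ θ *
d²`. Using it once gains a factor `θ`; the remaining power of `qom w` is absorbed by `qom w ≤ 2 d`.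
The fourth power of `θ` in `farKer` makes this gain linear. -/
lemma farKer_mul_le {θ : ℝ} (hθ : 0 < θ) {z w : Cn n} (hz : z ∈ ball n) (hw : w ∈ ball n) :
    farKer θ z w * ENNReal.ofReal (1 / qom w) ^ 2 ≤
      ENNReal.ofReal (θ * 2 ^ (4 * n + 5) / qom z) * ENNReal.ofReal
        ((‖1 - inner ℂ w z‖ ^ (n + 1) * Real.sqrt (Real.sqrt ‖1 - inner ℂ w z‖))⁻¹) := by
  have hD := norm_one_sub_inner_pos hw (mem_ball_iff.1 hz).le
  have hqz := qom_pos hz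
  have hqw := qom_pos hw
  unfold farKer
  by_cases h : om z * om w / ‖1 - inner ℂ z w‖ ^ 2 ≤ θ ^ 4
  · rw [Set.indicator_of_mem (by exact h)]
    simp only [hker]
    have hle := om_le_two_mul_norm hz hw
    set d := Real.sqrt (Real.sqrt ‖1 - inner ℂ w z‖) with hd
    have hd0 : 0 < d := Real.sqrt_pos.2 (Real.sqrt_pos.2 hD)
    have hd4 : d ^ 4 = ‖1 - inner ℂ w z‖ := by
      rw [show 4 = 2 * 2 from rfl, pow_mul, Real.sq_sqrt (Real.sqrt_nonneg _),
        Real.sq_sqrt hD.le]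
    rw [norm_one_sub_inner_comm z w, ← qom_pow hz, ← qom_pow hw, ← hd4] at h
    rw [← hd4, ← qom_pow hw] at hle ⊢
    have h1 : qom z * qom w ≤ θ * d ^ 2 := by
      rw [div_le_iff₀ (by positivity)] at h
      refine le_of_pow_le_pow_left₀ (n := 4) (by norm_num) (by positivity) ?_
      calc (qom z * qom w) ^ 4 = qom z ^ 4 * qom w ^ 4 := by ring
        _ ≤ _ := h
        _ = (θ * d ^ 2) ^ 4 := by ring
    have h2 : qom w ≤ 2 * d := by
      refine le_of_pow_le_pow_left₀ (n := 4) (by norm_num) (by positivity) ?_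
      calc qom w ^ 4 ≤ 2 * d ^ 4 := hle
        _ ≤ (2 * d) ^ 4 := by nlinarith [pow_pos hd0 4]
    rw [← ENNReal.ofReal_pow (by positivity), ← ENNReal.ofReal_mul (by positivity),
      ← ENNReal.ofReal_mul (by positivity)]
    refine ENNReal.ofReal_le_ofReal ?_
    have h3 : qom w ^ (4 * n + 5) ≤ (2 * d) ^ (4 * n + 5) := by gcongr
    have e1 : (qom w ^ 4) ^ (n + 2) / (d ^ 4) ^ (2 * n + 3) * (1 / qom w) ^ 2 =
        qom w ^ (4 * n + 5) * (qom z * qom w) / (qom z * d ^ (8 * n + 12)) := by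
      have a1 : (qom w ^ 4) ^ (n + 2) = qom w ^ (4 * n + 5) * qom w * qom w ^ 2 := by ring
      have a2 : (d ^ 4) ^ (2 * n + 3) = d ^ (8 * n + 12) := by rw [← pow_mul]; ring_nf
      rw [a1, a2]
      field_simp
    rw [e1]
    calc qom w ^ (4 * n + 5) * (qom z * qom w) / (qom z * d ^ (8 * n + 12))
        ≤ (2 * d) ^ (4 * n + 5) * (θ * d ^ 2) / (qom z * d ^ (8 * n + 12)) := by gcongr
      _ = _ := by
        have a3 : d ^ (8 * n + 12) = d ^ (4 * n + 5) * d ^ 2 * ((d ^ 4) ^ (n + 1) * d) := by ring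
        rw [a3, mul_pow]
        field_simp
  · rw [Set.indicator_of_notMem (by exact h), zero_mul]
    exact zero_le

/-- Under `z = φ_w(u)` the product of the Jacobian and `hker` is `|1 - ⟨u, w⟩| ≤ 2`, while `rom
(φ_w(u)) = rom w * rom u / |1 - ⟨u, w⟩|`. The dependence on `w` factors out, and `1 / rom u` remains
to be integrated. -/
lemma lintegral_hker_mul_le {w : Cn n} (hw : w ∈ ball n) {κ : ℕ} (hκ : κ ≤ 1) :
    ∫⁻ z, hker z w * (ENNReal.ofReal (1 / qom z) ^ 2 * weight z ^ κ) ∂(ballMeasure n) ≤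
      (4 * ∫⁻ u, ENNReal.ofReal (1 / rom u) ∂(ballMeasure n)) *
        (ENNReal.ofReal (1 / qom w) ^ 2 * weight w ^ κ) := by
  have how := om_pos hw
  have hrw := rom_pos hw
  have hq : ∀ {x : Cn n}, x ∈ ball n → ENNReal.ofReal (1 / qom x) ^ 2 = ENNReal.ofReal (1 / rom x) :=
    fun {x} hx => by
      have := qom_pos hx
      rw [← ENNReal.ofReal_pow (by positivity), div_pow, one_pow, qom_sq hx]
  rw [lintegral_mobius hw, mul_assoc, ← lintegral_mul_const' _ _ (by
    rw [hq hw]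
    exact ENNReal.mul_ne_top ENNReal.ofReal_ne_top (ENNReal.pow_ne_top ENNReal.ofReal_ne_top)),
    ← lintegral_const_mul' _ _ (by norm_num)]
  refine lintegral_mono_ae ?_
  filter_upwards [ae_mem_ball n] with u hu
  have hm := mobius_mem_ball hw hu
  have hE := norm_one_sub_inner_pos hw (mem_ball_iff.1 hu).le
  have hE2 := norm_one_sub_inner_le_two hu hw
  have hou := om_pos hu
  have hru := rom_pos hu
  have hru1 : rom u ≤ 1 := Real.sqrt_le_one.2 (om_le_one u)
  have hr : rom (mobius w u) = rom w * rom u / ‖1 - inner ℂ w u‖ := by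
    unfold rom
    rw [om_mobius hw hu, Real.sqrt_div (by positivity), Real.sqrt_mul how.le, Real.sqrt_sq hE.le]
  have hj := jac_nonneg hw u
  rw [hq hm, hq hw, weight_eq, weight_eq, ← ENNReal.ofReal_pow (om_pos hm).le,
    ← ENNReal.ofReal_pow how.le, hker]
  have h4 : (4 : ℝ≥0∞) = ENNReal.ofReal 4 := by norm_num
  have hrm := rom_pos hm
  rw [h4, ← ENNReal.ofReal_mul (by positivity), ← ENNReal.ofReal_mul (by positivity),
    ← ENNReal.ofReal_mul hj, ← ENNReal.ofReal_mul (by positivity),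
    ← ENNReal.ofReal_mul (by positivity), ← ENNReal.ofReal_mul (by positivity)]
  refine ENNReal.ofReal_le_ofReal ?_
  rw [one_sub_inner_mobius_left hw hu, norm_div, Complex.norm_real, Real.norm_of_nonneg how.le,
    hr, ← rom_sq hm, hr, jac, ← rom_sq hw]
  set E := ‖1 - inner ℂ w u‖
  have e0 : (rom w ^ 2 / E ^ 2) ^ (n + 1) * ((rom w ^ 2) ^ (n + 2) / (rom w ^ 2 / E) ^ (2 * n + 3))
      = E := by
    have a1 : (rom w ^ 2 / E) ^ (2 * n + 3) =
        (rom w ^ 2) ^ (n + 1) * (rom w ^ 2) ^ (n + 2) / ((E ^ 2) ^ (n + 1) * E) := by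
      rw [div_pow]
      congr 1 <;> ring
    rw [a1, div_pow]
    field_simp
  rw [← mul_assoc, e0]
  interval_cases κ
  · simp only [pow_zero, mul_one]
    have e1 : E * (1 / (rom w * rom u / E)) = E ^ 2 * (1 / rom u * (1 / rom w)) := by
      field_simp
    rw [e1]
    gcongr
    nlinarith
  · simp only [pow_one]
    have e1 : E * (1 / (rom w * rom u / E) * (rom w * rom u / E) ^ 2) = rom w * rom u := by
      field_simp
    have e2 : 4 * (1 / rom u * (1 / rom w * rom w ^ 2)) = 4 * rom w * (1 / rom u) := by
      field_simp
    rw [e1, e2]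
    have : 1 ≤ 1 / rom u := by rwa [le_div_iff₀ hru, one_mul]
    nlinarith

/-- The off-diagonal decay of the integral operator with kernel `hker`. -/
lemma exists_farKer_bound (n : ℕ) : ∃ A : ℝ, 0 < A ∧ ∀ θ : ℝ, 0 < θ → ∀ κ ≤ 1,
    ∀ g : Cn n → ℝ≥0∞, Measurable g →
      ∫⁻ z, (∫⁻ w, farKer θ z w * g w ∂(ballMeasure n)) ^ 2 * weight z ^ κ ∂(ballMeasure n) ≤
        ENNReal.ofReal (A * θ) * ∫⁻ w, g w ^ 2 * weight w ^ κ ∂(ballMeasure n) := by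
  obtain ⟨C, hC, hFR⟩ := lintegral_inv_norm_pow_le n
  have hI := (lintegral_inv_rom_lt_top n).ne
  set I0 := ∫⁻ u, ENNReal.ofReal (1 / rom u) ∂(ballMeasure n)
  have hI4 : 4 * I0 ≠ ∞ := ENNReal.mul_ne_top (by norm_num) hI
  refine ⟨2 ^ (4 * n + 5) * C * ((4 * I0).toReal + 1), by positivity, fun θ hθ κ hκ g hg => ?_⟩
  have hqm : Measurable fun z : Cn n => ENNReal.ofReal (1 / qom z) :=
    ((measurable_const.div continuous_qom.measurable)).ennreal_ofReal
  -- The test function is `(1 - |z|²)^(-1/4)`. The restriction to the far region is used only for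
  -- the integrals over `w`, which supply `θ`; for the integrals over `z` the full kernel is good
  -- enough.
  have h := lintegral_sq_lintegral_le (μ := ballMeasure n) (K := farKer θ)
    (A := ENNReal.ofReal (θ * 2 ^ (4 * n + 5) * C)) (B := 4 * I0) (measurable_farKer θ)
    (s := fun z => ENNReal.ofReal (1 / qom z)) (b := fun z => ENNReal.ofReal (1 / qom z) ^ 2)
    (v := fun z => weight z ^ κ) (g := g) hqm (hqm.pow_const 2) (measurable_weight.pow_const κ) hg
    ?_ (by simp) ?_ ?_
  · refine h.trans ?_
    gcongr
    calc ENNReal.ofReal (θ * 2 ^ (4 * n + 5) * C) * (4 * I0)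
        = ENNReal.ofReal (θ * 2 ^ (4 * n + 5) * C) * ENNReal.ofReal (4 * I0).toReal := by
          rw [ENNReal.ofReal_toReal hI4]
      _ ≤ _ := by
          rw [← ENNReal.ofReal_mul (by positivity)]
          refine ENNReal.ofReal_le_ofReal ?_
          have : 0 ≤ θ * 2 ^ (4 * n + 5) * C := by positivity
          nlinarith
  · filter_upwards [ae_mem_ball n] with z hz
    have := qom_pos hz
    rw [ne_eq, ENNReal.ofReal_eq_zero, not_le]
    positivity
  · filter_upwards [ae_mem_ball n] with z hz
    have hqz := qom_pos hz
    calc ∫⁻ w, farKer θ z w * ENNReal.ofReal (1 / qom w) ^ 2 ∂(ballMeasure n)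
        ≤ ∫⁻ w, ENNReal.ofReal (θ * 2 ^ (4 * n + 5) / qom z) * ENNReal.ofReal
            ((‖1 - inner ℂ w z‖ ^ (n + 1) * Real.sqrt (Real.sqrt ‖1 - inner ℂ w z‖))⁻¹)
              ∂(ballMeasure n) := by
          refine lintegral_mono_ae ?_
          filter_upwards [ae_mem_ball n] with w hw
          exact farKer_mul_le hθ hz hw
      _ ≤ ENNReal.ofReal (θ * 2 ^ (4 * n + 5) / qom z) * ENNReal.ofReal (C / qom z) := by
          rw [lintegral_const_mul' _ _ ENNReal.ofReal_ne_top]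
          gcongr
          exact hFR z hz
      _ = _ := by
          rw [← ENNReal.ofReal_mul (by positivity), ← ENNReal.ofReal_pow (by positivity),
            ← ENNReal.ofReal_mul (by positivity)]
          congr 1
          field_simp
  · filter_upwards [ae_mem_ball n] with w hw
    refine le_trans ?_ (lintegral_hker_mul_le hw hκ)
    gcongr
    exact farKer_le θ _ w

lemma farKer_one {z w : Cn n} (hz : z ∈ ball n) (hw : w ∈ ball n) : farKer 1 z w = hker z w := by
  unfold farKer
  rw [Set.indicator_of_mem]
  simp only [Set.mem_ofPred_eq, one_pow]
  rw [← one_sub_pseudoHyp_sq hz hw]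
  nlinarith [sq_nonneg (pseudoHyp z w)]

end ForelliRudin


/-! ### The Bergman space -/

section Bergman

variable {n : ℕ}

lemma eqOn_ball_of_ae_eq {f g : Cn n → ℂ} (h : f =ᵐ[ballMeasure n] g) (hf : ContinuousOn f (ball n))
    (hg : ContinuousOn g (ball n)) : Set.EqOn f g (ball n) := by
  have hv : (volume (ball n))⁻¹ ≠ 0 := ENNReal.inv_ne_zero.2 measure_ball_lt_top.ne
  have h' : f =ᵐ[volume.restrict (ball n)] g := by
    have := h
    rw [ballMeasure] at this
    exact (Measure.ae_ennreal_smul_measure_eq hv _) ▸ this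
  exact Measure.eqOn_open_of_ae_eq h' (isOpen_ball n) hf hg

lemma fn_eq_of_ae_eq (f : bergmanSpace n) {g : Cn n → ℂ} (hg : ContinuousOn g (ball n))
    (h : (f : Lp ℂ 2 (ballMeasure n)) =ᵐ[ballMeasure n] g) {z : Cn n} (hz : z ∈ ball n) :
    fn f z = g z :=
  eqOn_ball_of_ae_eq ((coe_ae_eq_fn f).symm.trans h) (differentiableOn_fn f).continuousOn hg hz

lemma fn_add (f g : bergmanSpace n) {z : Cn n} (hz : z ∈ ball n) :
    fn (f + g) z = fn f z + fn g z := by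
  refine fn_eq_of_ae_eq (f + g) (g := fun z => fn f z + fn g z)
    ((differentiableOn_fn f).continuousOn.add (differentiableOn_fn g).continuousOn) ?_ hz
  exact (Lp.coeFn_add _ _).trans ((coe_ae_eq_fn f).add (coe_ae_eq_fn g))

lemma fn_smul (c : ℂ) (f : bergmanSpace n) {z : Cn n} (hz : z ∈ ball n) :
    fn (c • f) z = c * fn f z := by
  refine fn_eq_of_ae_eq (c • f) (g := fun z => c * fn f z)
    (continuousOn_const.mul (differentiableOn_fn f).continuousOn) ?_ hz
  exact (Lp.coeFn_smul c _).trans ((coe_ae_eq_fn f).const_smul c)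

lemma fn_sub (f g : bergmanSpace n) {z : Cn n} (hz : z ∈ ball n) :
    fn (f - g) z = fn f z - fn g z := by
  refine fn_eq_of_ae_eq (f - g) (g := fun z => fn f z - fn g z)
    ((differentiableOn_fn f).continuousOn.sub (differentiableOn_fn g).continuousOn) ?_ hz
  exact (Lp.coeFn_sub _ _).trans ((coe_ae_eq_fn f).sub (coe_ae_eq_fn g))

lemma fn_polyToBergman (p : MvPolynomial (Fin n) ℂ) {z : Cn n} (hz : z ∈ ball n) :
    fn (polyToBergman n p) z = polyEval p z :=
  fn_eq_of_ae_eq _ (differentiable_polyEval p).continuous.continuousOn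
    (MemLp.coeFn_toLp (memLp_polyEval p)) hz

lemma enorm_sq_eq_lintegral (F : Lp ℂ 2 (ballMeasure n)) :
    ‖F‖ₑ ^ 2 = ∫⁻ z, ‖F z‖ₑ ^ 2 ∂(ballMeasure n) := by
  rw [Lp.enorm_def, eLpNorm_eq_lintegral_rpow_enorm_toReal (by norm_num) (by norm_num)]
  rw [← ENNReal.rpow_natCast, ← ENNReal.rpow_mul]
  norm_num

lemma enorm_sq_eq (f : bergmanSpace n) : ‖f‖ₑ ^ 2 = ∫⁻ z, ‖fn f z‖ₑ ^ 2 ∂(ballMeasure n) := by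
  have h : ‖f‖ₑ = ‖(f : Lp ℂ 2 (ballMeasure n))‖ₑ := rfl
  rw [h, enorm_sq_eq_lintegral]
  refine lintegral_congr_ae ?_
  filter_upwards [coe_ae_eq_fn f] with z hz
  rw [hz]

lemma norm_le_of_forall {f g : bergmanSpace n} (h : ∀ z ∈ ball n, ‖fn f z‖ ≤ ‖fn g z‖) :
    ‖f‖ ≤ ‖g‖ := by
  have h1 : ‖f‖ₑ ^ 2 ≤ ‖g‖ₑ ^ 2 := by
    rw [enorm_sq_eq, enorm_sq_eq]
    refine lintegral_mono_ae ?_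
    filter_upwards [ae_mem_ball n] with z hz
    gcongr
    exact enorm_le_iff_norm_le.2 (h z hz)
  have h2 : ‖f‖ₑ ≤ ‖g‖ₑ := by
    by_contra! hc
    exact absurd h1 (not_le.2 (ENNReal.pow_lt_pow_left two_ne_zero hc))
  exact enorm_le_iff_norm_le.1 h2

lemma lintegral_enorm_le (F : Lp ℂ 2 (ballMeasure n)) :
    ∫⁻ z, ‖F z‖ₑ ∂(ballMeasure n) ≤ ‖F‖ₑ := by
  have h := eLpNorm_le_eLpNorm_of_exponent_le (μ := ballMeasure n) (p := 1) (q := 2) (by norm_num)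
    (Lp.aestronglyMeasurable F)
  rwa [eLpNorm_one_eq_lintegral_enorm, ← Lp.enorm_def] at h

/-- This is `enorm_polyEval_mul_le` for the constant polynomial `1` and `N = 0`; the Jacobian in the
average is bounded while `|w| ≤ r`. -/
lemma exists_norm_fn_le (n : ℕ) {r : ℝ} (hr : r < 1) : ∃ C : ℝ, 0 < C ∧
    ∀ f : bergmanSpace n, ∀ w : Cn n, ‖w‖ ≤ r → ‖fn f w‖ ≤ C * ‖f‖ := by
  obtain ⟨C, hC, h⟩ := enorm_polyEval_mul_le n 0
  have hr1 : 0 < 1 - r := by linarith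
  refine ⟨C * (1 / (1 - r) ^ 2) ^ (n + 1) + 1, by positivity, fun f w hw => ?_⟩
  have hwb : w ∈ ball n := mem_ball_iff.2 (hw.trans_lt hr)
  have h1 := h 1 (by simp) (fn f) w hwb ((differentiableOn_fn f).mono fun x hx => hx.1) 0
    (zero_mem_ball n)
  simp only [polyEval, map_one, enorm_one, one_mul, pow_zero, mul_one] at h1
  have h2 : ∫⁻ x, avgKer w x * ‖fn f x‖ₑ ∂(ballMeasure n) ≤
      ENNReal.ofReal ((1 / (1 - r) ^ 2) ^ (n + 1)) * ‖f‖ₑ := by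
    calc ∫⁻ x, avgKer w x * ‖fn f x‖ₑ ∂(ballMeasure n)
        ≤ ∫⁻ x, ENNReal.ofReal ((1 / (1 - r) ^ 2) ^ (n + 1)) *
            ‖(f : Lp ℂ 2 (ballMeasure n)) x‖ₑ ∂(ballMeasure n) := by
          refine lintegral_mono_ae ?_
          filter_upwards [ae_mem_ball n, coe_ae_eq_fn f] with x hx hfx
          rw [hfx]
          gcongr
          rw [avgKer_eq hwb hx]
          split_ifs
          · refine ENNReal.ofReal_le_ofReal ?_
            unfold jac
            have h3 : 1 - r ≤ ‖1 - inner ℂ w x‖ := by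
              have h4 := norm_inner_le_norm (𝕜 := ℂ) w x
              have h5 := norm_sub_norm_le (1 : ℂ) (inner ℂ w x)
              rw [norm_one] at h5
              rw [mem_ball_iff] at hx
              nlinarith [norm_nonneg w, norm_nonneg x]
            have := om_pos hwb
            gcongr
            exact om_le_one w
          · exact zero_le
      _ ≤ _ := by
          rw [lintegral_const_mul' _ _ ENNReal.ofReal_ne_top]
          gcongr
          exact lintegral_enorm_le _
  have h3 : ‖fn f w‖ₑ ≤ ENNReal.ofReal (C * (1 / (1 - r) ^ 2) ^ (n + 1)) * ‖f‖ₑ := by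
    rw [ENNReal.ofReal_mul hC, mul_assoc]
    refine h1.trans ?_
    gcongr
  rw [← ofReal_norm, ← ofReal_norm, ← ENNReal.ofReal_mul (by positivity),
    ENNReal.ofReal_le_ofReal_iff (by positivity)] at h3
  nlinarith [norm_nonneg f]

lemma exists_dist_fn_le (n : ℕ) {r : ℝ} (hr : r < 1) : ∃ L : ℝ, 0 < L ∧
    ∀ f : bergmanSpace n, ∀ w : Cn n, ‖w‖ ≤ r → ∀ x : Cn n, ‖x - w‖ < (1 - r) / 2 →
      ‖fn f x - fn f w‖ ≤ L * ‖f‖ * ‖x - w‖ := by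
  obtain ⟨C, hC, h⟩ := exists_norm_fn_le n (r := (1 + r) / 2) (by linarith)
  have hr1 : 0 < (1 - r) / 2 := by linarith
  refine ⟨2 * C / ((1 - r) / 2), by positivity, fun f w hw x hx => ?_⟩
  have hb : ∀ y ∈ Metric.ball w ((1 - r) / 2), ‖y‖ ≤ (1 + r) / 2 := fun y hy => by
    rw [mem_ball_iff_norm] at hy
    have := norm_add_le w (y - w)
    rw [add_sub_cancel] at this
    linarith
  have h1 := Complex.dist_le_div_mul_dist_of_mapsTo_ball (f := fn f) (c := w) (R₁ := (1 - r) / 2)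
    (R₂ := 2 * C * ‖f‖) (z := x)
    ((differentiableOn_fn f).mono fun y hy => mem_ball_iff.2 ((hb y hy).trans_lt (by linarith)))
    (fun y hy => by
      rw [mem_closedBall_iff_norm]
      have h2 := h f y (hb y hy)
      have h3 := h f w (hw.trans (by linarith))
      have := norm_sub_le (fn f y) (fn f w)
      linarith) (mem_ball_iff_norm.2 hx)
  rw [dist_eq_norm, dist_eq_norm] at h1
  refine h1.trans_eq ?_
  ring

lemma norm_fderiv_fn_sub_le {L r : ℝ} (hr : r < 1) (hL : ∀ f : bergmanSpace n, ∀ w : Cn n, ‖w‖ ≤ r →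
    ∀ x : Cn n, ‖x - w‖ < (1 - r) / 2 → ‖fn f x - fn f w‖ ≤ L * ‖f‖ * ‖x - w‖) (hL0 : 0 < L)
    (f g : bergmanSpace n) {w : Cn n} (hw : ‖w‖ ≤ r) :
    ‖fderiv ℂ (fn f) w - fderiv ℂ (fn g) w‖ ≤ L * ‖f - g‖ := by
  have hwb : w ∈ ball n := mem_ball_iff.2 (hw.trans_lt hr)
  have hd : ∀ f : bergmanSpace n, DifferentiableAt ℂ (fn f) w := fun f =>
    (differentiableOn_fn f).differentiableAt ((isOpen_ball n).mem_nhds hwb)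
  rw [← fderiv_sub (hd f) (hd g)]
  refine norm_fderiv_le_of_lip' ℂ (by positivity) ?_
  have h1 : ∀ᶠ x in nhds w, x ∈ ball n := (isOpen_ball n).mem_nhds hwb
  have h2 : ∀ᶠ x in nhds w, x ∈ Metric.ball w ((1 - r) / 2) :=
    Metric.ball_mem_nhds w (by linarith)
  filter_upwards [h1, h2] with x hx hx2
  have := hL (f - g) w hw x (mem_ball_iff_norm.1 hx2)
  rwa [fn_sub _ _ hx, fn_sub _ _ hwb] at this

-- Bounds on point evaluations and on their difference quotients make an `L²`-Cauchy sequence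
-- converge pointwise, and its derivatives converge uniformly on smaller balls. The pointwise limit
-- is thus holomorphic, and it represents the `L²` limit because a subsequence converges almost
-- everywhere.
open Filter Topology in
lemma isClosed_bergmanSpace (n : ℕ) :
    IsClosed (bergmanSpace n : Set (Lp ℂ 2 (ballMeasure n))) := by
  refine isClosed_of_closure_subset fun F hF => ?_
  obtain ⟨u, hu, hlim⟩ := mem_closure_iff_seq_limit.1 hF
  set f : ℕ → bergmanSpace n := fun k => ⟨u k, hu k⟩ with hf
  have hcau : CauchySeq f := by
    have := hlim.cauchySeq
    rw [Metric.cauchySeq_iff] at this ⊢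
    exact this
  have hptc : ∀ z ∈ ball n, CauchySeq fun k => fn (f k) z := fun z hz => by
    obtain ⟨C, hC, h⟩ := exists_norm_fn_le n (mem_ball_iff.1 hz)
    rw [Metric.cauchySeq_iff] at hcau ⊢
    intro ε hε
    obtain ⟨N, hN⟩ := hcau (ε / C) (by positivity)
    refine ⟨N, fun k hk m hm => ?_⟩
    have h1 := hN k hk m hm
    rw [dist_eq_norm] at h1 ⊢
    rw [← fn_sub _ _ hz]
    refine (h (f k - f m) z le_rfl).trans_lt ?_
    rwa [lt_div_iff₀' hC] at h1
  choose! g hg using fun z hz => cauchySeq_tendsto_of_complete (hptc z hz)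
  have hdiff : DifferentiableOn ℂ g (ball n) := by
    intro z hz
    obtain ⟨r, hzr, hr⟩ := exists_between (mem_ball_iff.1 hz)
    obtain ⟨L, hL0, hL⟩ := exists_dist_fn_le n hr
    have hunif : UniformCauchySeqOn (fun k => fderiv ℂ (fn (f k))) atTop (Metric.ball 0 r) := by
      rw [Metric.uniformCauchySeqOn_iff]
      intro ε hε
      rw [Metric.cauchySeq_iff] at hcau
      obtain ⟨N, hN⟩ := hcau (ε / L) (by positivity)
      refine ⟨N, fun k hk m hm x hx => ?_⟩
      have h1 := hN k hk m hm
      rw [dist_eq_norm] at h1 ⊢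
      refine (norm_fderiv_fn_sub_le hr hL hL0 (f k) (f m) (mem_ball_zero_iff.1 hx).le).trans_lt ?_
      rwa [lt_div_iff₀' hL0] at h1
    have hptd : ∀ x ∈ Metric.ball (0 : Cn n) r, ∃ D, Tendsto (fun k => fderiv ℂ (fn (f k)) x) atTop (𝓝 D) :=
      fun x hx => cauchySeq_tendsto_of_complete (hunif.cauchySeq hx)
    choose! D hD using hptd
    have hlimD := hunif.tendstoUniformlyOn_of_tendsto (f := D) hD
    have hsub : Metric.ball (0 : Cn n) r ⊆ ball n := Metric.ball_subset_ball hr.le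
    have := hasFDerivAt_of_tendstoUniformlyOn (𝕜 := ℂ) (f := fun k => fn (f k)) (g := g)
      Metric.isOpen_ball hlimD
      (fun k x hx => ((differentiableOn_fn (f k)).differentiableAt
        ((isOpen_ball n).mem_nhds (hsub hx))).hasFDerivAt) (fun x hx => hg x (hsub hx))
      (x := z) (by simpa using hzr)
    exact this.differentiableAt.differentiableWithinAt
  refine ⟨g, hdiff, ?_⟩
  obtain ⟨ns, hns, hae⟩ := (tendstoInMeasure_of_tendsto_Lp hlim).exists_seq_tendsto_ae
  have hall : ∀ᵐ z ∂(ballMeasure n), ∀ k, (u k) z = fn (f k) z :=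
    ae_all_iff.2 fun k => coe_ae_eq_fn (f k)
  filter_upwards [hae, hall, ae_mem_ball n] with z hz1 hz2 hz3
  simp only [hz2] at hz1
  exact tendsto_nhds_unique hz1 ((hg z hz3).comp hns.tendsto_atTop)

instance completeSpace_bergmanSpace : CompleteSpace (bergmanSpace n) :=
  (isClosed_bergmanSpace n).completeSpace_coe

variable (I : Ideal (MvPolynomial (Fin n) ℂ))

lemma isClosed_idealClosure : IsClosed (idealClosure I : Set (bergmanSpace n)) :=
  Submodule.isClosed_topologicalClosure _

instance completeSpace_idealClosure : CompleteSpace (idealClosure I) :=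
  (isClosed_idealClosure I).completeSpace_coe

variable {I}

lemma mem_idealClosure_iff {f : bergmanSpace n} :
    f ∈ idealClosure I ↔ ∀ ε > 0, ∃ p ∈ I, ‖f - polyToBergman n p‖ < ε := by
  rw [idealClosure, ← SetLike.mem_coe, Submodule.topologicalClosure_coe, Metric.mem_closure_iff]
  simp only [dist_eq_norm]
  constructor
  · intro h ε hε
    obtain ⟨b, ⟨p, hp, rfl⟩, hb⟩ := h ε hε
    exact ⟨p, hp, hb⟩
  · intro h ε hε
    obtain ⟨p, hp, hb⟩ := h ε hε
    exact ⟨_, ⟨p, hp, rfl⟩, hb⟩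

lemma polyToBergman_mem_idealClosure {p : MvPolynomial (Fin n) ℂ} (hp : p ∈ I) :
    polyToBergman n p ∈ idealClosure I :=
  mem_idealClosure_iff.2 fun ε hε => ⟨p, hp, by simpa using hε⟩

/-- Multiplication by a coordinate does not increase norms and preserves the ideal, so it carries
approximations of `f` to approximations of the product. -/
lemma isHilbertSubmodule_idealClosure : IsHilbertSubmodule (idealClosure I) := by
  refine ⟨isClosed_idealClosure I, fun f hf k g hg => ?_⟩
  rw [mem_idealClosure_iff] at hf ⊢
  intro ε hε
  obtain ⟨p, hp, hfp⟩ := hf ε hε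
  refine ⟨MvPolynomial.X k * p, I.mul_mem_left _ hp, lt_of_le_of_lt ?_ hfp⟩
  refine norm_le_of_forall fun z hz => ?_
  rw [fn_sub _ _ hz, fn_sub _ _ hz, hg z hz, fn_polyToBergman _ hz, fn_polyToBergman _ hz]
  have h1 : polyEval (MvPolynomial.X k * p) z = z k * polyEval p z := by simp [polyEval]
  rw [h1, ← mul_sub, norm_mul]
  have h2 : ‖z k‖ ≤ 1 := (PiLp.norm_apply_le z k).trans (mem_ball_iff.1 hz).le
  exact mul_le_of_le_one_left (norm_nonneg _) h2

/-- Evaluation at a point of the ball is represented, up to a small error, by a polynomial of the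
ideal. -/
lemma exists_poly_repr {w : Cn n} (hw : w ∈ ball n) {η : ℝ} (hη : 0 < η) :
    ∃ q ∈ I, ∀ u ∈ idealClosure I, ‖fn u w - inner ℂ (polyToBergman n q) u‖ ≤ η * ‖u‖ := by
  obtain ⟨C, hC, h⟩ := exists_norm_fn_le n (mem_ball_iff.1 hw)
  let ev : idealClosure I →ₗ[ℂ] ℂ :=
    { toFun := fun u => fn (u : bergmanSpace n) w
      map_add' := fun u v => fn_add _ _ hw
      map_smul' := fun c u => fn_smul c _ hw }
  let evc : idealClosure I →L[ℂ] ℂ := ev.mkContinuous C fun u => h u w le_rfl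
  -- The Riesz representative of the evaluation lies in the closure of the ideal, hence is a limit
  -- of polynomials of the ideal.
  set k := (InnerProductSpace.toDual ℂ (idealClosure I)).symm evc with hk
  have hkr : ∀ u : idealClosure I, inner ℂ k u = fn (u : bergmanSpace n) w := fun u => by
    rw [hk, InnerProductSpace.toDual_symm_apply]
    rfl
  obtain ⟨q, hq, hqk⟩ := mem_idealClosure_iff.1 k.2 η hη
  refine ⟨q, hq, fun u hu => ?_⟩
  have h1 := hkr ⟨u, hu⟩
  rw [Submodule.coe_inner] at h1
  rw [← h1, ← inner_sub_left]
  refine (norm_inner_le_norm _ _).trans ?_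
  gcongr

/-- Evaluations depend on the point in a Lipschitz way, so the polynomial that represents evaluation
at a point of a finite net serves a whole ball about it; the balls are then made disjoint. This is
the compactness that turns the cut-off to `|z| ≤ r` into an operator of finite rank. -/
lemma exists_finite_poly_repr (I : Ideal (MvPolynomial (Fin n) ℂ)) {r : ℝ} (hr : r < 1) {η : ℝ}
    (hη : 0 < η) :
    ∃ (m : ℕ) (B : Fin m → Set (Cn n)) (q : Fin m → MvPolynomial (Fin n) ℂ),
      (∀ k, MeasurableSet (B k)) ∧ (Set.univ : Set (Fin m)).PairwiseDisjoint B ∧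
      Metric.closedBall 0 r ⊆ ⋃ k, B k ∧ (∀ k, q k ∈ I) ∧
      ∀ k, ∀ w ∈ B k, ‖w‖ ≤ r → ∀ u ∈ idealClosure I,
        ‖fn u w - inner ℂ (polyToBergman n (q k)) u‖ ≤ η * ‖u‖ := by
  obtain ⟨L, hL0, hL⟩ := exists_dist_fn_le n hr
  -- The first bound keeps the Lipschitz estimate valid, the second limits the oscillation of `u` to
  -- `η / 2 * ‖u‖`; the other half of `η` is the error at the net point.
  set s := min ((1 - r) / 2) (η / (2 * L)) with hs
  have hs0 : 0 < s := lt_min (by linarith) (by positivity)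
  obtain ⟨t, htr, hfin, ht⟩ := (isCompact_closedBall (0 : Cn n) r).finite_cover_balls hs0
  classical
  obtain ⟨m, e, he⟩ : ∃ (m : ℕ) (e : Fin m → Cn n), Set.range e = t := by
    have := hfin.to_subtype
    obtain ⟨m, ⟨e⟩⟩ := Finite.exists_equiv_fin t
    exact ⟨m, fun k => (e.symm k : Cn n), by
      ext x
      constructor
      · rintro ⟨k, rfl⟩
        exact (e.symm k).2
      · intro hx
        exact ⟨e ⟨x, hx⟩, by simp⟩⟩
  have her : ∀ k, ‖e k‖ ≤ r := fun k => by
    have : e k ∈ t := he ▸ Set.mem_range_self k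
    simpa using htr this
  choose q hq hqe using fun k => exists_poly_repr (I := I)
    (mem_ball_iff.2 ((her k).trans_lt hr)) (half_pos hη)
  refine ⟨m, disjointed fun k => Metric.ball (e k) s, q,
    fun k => disjointedRec (fun _ _ ht => ht.diff Metric.isOpen_ball.measurableSet)
      Metric.isOpen_ball.measurableSet,
    fun i _ j _ hij => disjoint_disjointed _ hij, ?_, hq, fun k w hw hwr u hu => ?_⟩
  · rw [iUnion_disjointed]
    refine ht.trans ?_
    rw [← he]
    simp
  · have hwk : w ∈ Metric.ball (e k) s := disjointed_subset _ k hw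
    rw [mem_ball_iff_norm] at hwk
    have h1 := hL u (e k) (her k) w (hwk.trans_le (min_le_left _ _))
    have h2 := hqe k u hu
    have h3 : L * ‖u‖ * ‖w - e k‖ ≤ η / 2 * ‖u‖ := by
      have h4 : ‖w - e k‖ ≤ η / (2 * L) := hwk.le.trans (min_le_right _ _)
      calc L * ‖u‖ * ‖w - e k‖ ≤ L * ‖u‖ * (η / (2 * L)) := by gcongr
        _ = η / 2 * ‖u‖ := by field_simp
    calc ‖fn u w - inner ℂ (polyToBergman n (q k)) u‖
        = ‖(fn u w - fn u (e k)) + (fn u (e k) - inner ℂ (polyToBergman n (q k)) u)‖ := by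
          congr 1
          ring
      _ ≤ _ := norm_add_le _ _
      _ ≤ η * ‖u‖ := by linarith

end Bergman


/-! ### Membership in the closure of the ideal by duality -/

section Orthogonality

variable {n : ℕ} {I : Ideal (MvPolynomial (Fin n) ℂ)}

/-- Square integrable functions that are orthogonal to everything that is orthogonal to the ideal
belong to its closure. -/
lemma exists_mem_idealClosure (h : Lp ℂ 2 (ballMeasure n))
    (H : ∀ u : Lp ℂ 2 (ballMeasure n),
      (∀ p ∈ I, inner ℂ u (polyToBergman n p : Lp ℂ 2 (ballMeasure n)) = 0) → inner ℂ u h = 0) :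
    ∃ f ∈ idealClosure I, (f : Lp ℂ 2 (ballMeasure n)) = h := by
  set J : Submodule ℂ (bergmanSpace n) := (I.restrictScalars ℂ).map (polyToBergman n) with hJ
  set J' : Submodule ℂ (Lp ℂ 2 (ballMeasure n)) := J.map (bergmanSpace n).subtype with hJ'
  have h1 : h ∈ J'ᗮᗮ := by
    rw [Submodule.mem_orthogonal]
    intro u hu
    refine H u fun p hp => ?_
    rw [Submodule.mem_orthogonal] at hu
    have h0 : inner ℂ (polyToBergman n p : Lp ℂ 2 (ballMeasure n)) u = 0 :=
      hu _ ⟨polyToBergman n p, ⟨p, hp, rfl⟩, rfl⟩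
    rw [← inner_conj_symm, h0, map_zero]
  rw [Submodule.orthogonal_orthogonal_eq_closure, ← SetLike.mem_coe,
    Submodule.topologicalClosure_coe] at h1
  have hsub : (J' : Set (Lp ℂ 2 (ballMeasure n))) ⊆ bergmanSpace n := by
    rintro _ ⟨x, _, rfl⟩
    exact x.2
  have h2 : h ∈ bergmanSpace n := closure_minimal hsub (isClosed_bergmanSpace n) h1
  refine ⟨⟨h, h2⟩, ?_, rfl⟩
  rw [idealClosure, ← SetLike.mem_coe, Submodule.topologicalClosure_coe,
    Topology.IsInducing.subtypeVal.closure_eq_preimage_closure_image]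
  exact h1

/-- The negative binomial series. Its partial sums are polynomials in `z`, so their products with
elements of the ideal stay in the ideal. -/
lemma hasSum_bker (l : ℕ) {z w : Cn n} (hw : w ∈ ball n) (hz : z ∈ ball n) :
    HasSum (fun k : ℕ => ((n + l + k).choose (n + l) : ℂ) * (om w : ℂ) ^ l * inner ℂ w z ^ k)
      (bker l z w) := by
  have hlt : ‖inner ℂ w z‖ < 1 := norm_inner_lt_one hw (mem_ball_iff.1 hz).le
  have h := (hasSum_choose_mul_geometric_of_norm_lt_one (n + l) hlt).mul_left ((om w : ℂ) ^ l)
  have e1 : bker l z w = (om w : ℂ) ^ l * (1 / (1 - inner ℂ w z) ^ (n + l + 1)) := by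
    rw [bker, mul_one_div, add_right_comm]
  rw [e1]
  refine h.congr_fun fun k => ?_
  rw [add_comm k]
  ring

/-- The product of a polynomial of the ideal with a kernel function is orthogonal to everything
that is orthogonal to the ideal. -/
lemma integral_star_mul_bker_eq_zero {u : Lp ℂ 2 (ballMeasure n)}
    (hu : ∀ p ∈ I, inner ℂ u (polyToBergman n p : Lp ℂ 2 (ballMeasure n)) = 0)
    {p : MvPolynomial (Fin n) ℂ} (hp : p ∈ I) (l : ℕ) {w : Cn n} (hw : w ∈ ball n) :
    ∫ z, (starRingEnd ℂ) (u z) * (polyEval p z * bker l z w) ∂(ballMeasure n) = 0 := by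
  have hint : Integrable (fun z => (starRingEnd ℂ) (u z)) (ballMeasure n) := by
    have : Integrable (fun z => u z) (ballMeasure n) :=
      (Lp.memLp u).integrable (by norm_num)
    exact (integrable_norm_iff (Complex.continuous_conj.comp_aestronglyMeasurable
      this.aestronglyMeasurable)).1 (by simpa using this.norm)
  obtain ⟨B, hB⟩ := (isCompact_closedBall (0 : Cn n) 1).exists_bound_of_continuousOn
    (differentiable_polyEval p).continuous.continuousOn
  have hw1 : ‖w‖ < 1 := mem_ball_iff.1 hw
  set c : ℕ → ℂ := fun k => ((n + l + k).choose (n + l) : ℂ) * (om w : ℂ) ^ l with hc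
  have hlin : ∀ z : Cn n, polyEval (∑ i, MvPolynomial.C ((starRingEnd ℂ) (w i)) * MvPolynomial.X i) z
      = inner ℂ w z := fun z => by
    simp [polyEval, PiLp.inner_apply, mul_comm]
  have hterm : ∀ k : ℕ, ∫ z, (starRingEnd ℂ) (u z) * (polyEval p z * (c k * inner ℂ w z ^ k))
      ∂(ballMeasure n) = 0 := fun k => by
    set q := (∑ i, MvPolynomial.C ((starRingEnd ℂ) (w i)) * MvPolynomial.X i) ^ k * p with hq
    have h1 := hu q (I.mul_mem_left _ hp)
    rw [L2.inner_def] at h1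
    have h2 : ∫ z, (starRingEnd ℂ) (u z) * polyEval q z ∂(ballMeasure n) = 0 := by
      rw [← h1]
      refine integral_congr_ae ?_
      filter_upwards [MemLp.coeFn_toLp (memLp_polyEval q)] with z hz
      have : ((polyToBergman n q : bergmanSpace n) : Lp ℂ 2 (ballMeasure n)) z = polyEval q z := hz
      rw [this, RCLike.inner_apply, mul_comm]
    have h3 : ∀ z, (starRingEnd ℂ) (u z) * (polyEval p z * (c k * inner ℂ w z ^ k)) =
        c k * ((starRingEnd ℂ) (u z) * polyEval q z) := fun z => by
      have : polyEval q z = inner ℂ w z ^ k * polyEval p z := by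
        rw [← hlin z, hq]
        simp [polyEval]
      rw [this]
      ring
    simp only [h3]
    rw [integral_const_mul, h2, mul_zero]
  have hsum : Summable fun k : ℕ => ‖c k‖ * ‖w‖ ^ k := by
    have h1 : ‖(‖w‖ : ℂ)‖ < 1 := by simpa using hw1
    have h2 := (summable_choose_mul_geometric_of_norm_lt_one (n + l) h1).norm.mul_left
      (‖(om w : ℂ) ^ l‖)
    refine h2.congr fun k => ?_
    rw [hc]
    simp only [norm_mul, norm_pow, Complex.norm_real, norm_norm, add_comm k]
    ring
  have hB0 : 0 ≤ B := (norm_nonneg _).trans (hB 0 (by simp))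
  -- Termwise integration is allowed because `|⟨z, w⟩| ≤ |w| < 1` for all `z` in the ball, which
  -- makes the series converge uniformly.
  have hHS := hasSum_integral_of_dominated_convergence (μ := ballMeasure n)
    (F := fun (k : ℕ) z => (starRingEnd ℂ) (u z) * (polyEval p z * (c k * inner ℂ w z ^ k)))
    (f := fun z => (starRingEnd ℂ) (u z) * (polyEval p z * bker l z w))
    (fun k z => ‖u z‖ * (B * (‖c k‖ * ‖w‖ ^ k))) ?_ ?_ ?_ ?_ ?_
  · simp only [hterm] at hHS
    exact hHS.unique hasSum_zero
  · intro k
    refine hint.aestronglyMeasurable.mul (Continuous.aestronglyMeasurable ?_)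
    have := (differentiable_polyEval p).continuous
    fun_prop
  · intro k
    filter_upwards [ae_mem_ball n] with z hz
    have h1 : ‖inner ℂ w z‖ ≤ ‖w‖ := by
      refine (norm_inner_le_norm w z).trans ?_
      have := mem_ball_iff.1 hz
      nlinarith [norm_nonneg w]
    rw [norm_mul, norm_mul, norm_mul, norm_pow, RCLike.norm_conj]
    gcongr
    exact hB z (by simpa using (mem_ball_iff.1 hz).le)
  · filter_upwards with z
    exact (hsum.mul_left B).mul_left _
  · simp only [tsum_mul_left]
    have : Integrable (fun z => u z) (ballMeasure n) := (Lp.memLp u).integrable (by norm_num)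
    exact this.norm.mul_const _
  · filter_upwards [ae_mem_ball n] with z hz
    exact ((hasSum_bker l hw hz).mul_left _).mul_left _

end Orthogonality


/-! ### A Lipschitz partition of unity -/

section Partition

variable {n : ℕ}

/-- A function that is one on `E`, vanishes at hyperbolic distance at least `R` from `E`, and is
Lipschitz with constant `1 / R`. -/
noncomputable def bump (E : Set (Cn n)) (R : ℝ) (z : Cn n) : ℝ :=
  ⨆ e : E, max 0 (1 - bergmanDist z e / R)

lemma bump_bddAbove {E : Set (Cn n)} (hE : E ⊆ ball n) {R : ℝ} (hR : 0 < R) {z : Cn n}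
    (hz : z ∈ ball n) : BddAbove (Set.range fun e : E => max 0 (1 - bergmanDist z e / R)) := by
  refine ⟨1, ?_⟩
  rintro _ ⟨e, rfl⟩
  have := bergmanDist_nonneg hz (hE e.2)
  have : 0 ≤ bergmanDist z e / R := by positivity
  exact max_le zero_le_one (by linarith)

lemma bump_nonneg (E : Set (Cn n)) (R : ℝ) (z : Cn n) : 0 ≤ bump E R z :=
  Real.iSup_nonneg fun _ => le_max_left _ _

lemma bump_le_one {E : Set (Cn n)} (hE : E ⊆ ball n) {R : ℝ} (hR : 0 < R) {z : Cn n}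
    (hz : z ∈ ball n) : bump E R z ≤ 1 := by
  refine Real.iSup_le (fun e => ?_) zero_le_one
  have := bergmanDist_nonneg hz (hE e.2)
  have : 0 ≤ bergmanDist z e / R := by positivity
  exact max_le zero_le_one (by linarith)

lemma bump_eq_one {E : Set (Cn n)} (hE : E ⊆ ball n) {R : ℝ} (hR : 0 < R) {z : Cn n}
    (hz : z ∈ E) : bump E R z = 1 := by
  refine le_antisymm (bump_le_one hE hR (hE hz)) ?_
  refine le_trans ?_ (le_ciSup (bump_bddAbove hE hR (hE hz)) ⟨z, hz⟩)
  simp [bergmanDist_self]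

lemma mem_bergmanNhd_of_bump_ne_zero {E : Set (Cn n)} {R : ℝ} (hR : 0 < R) {z : Cn n}
    (hz : z ∈ ball n) (h : bump E R z ≠ 0) : z ∈ bergmanNhd E R := by
  by_contra hc
  refine h (le_antisymm (Real.iSup_le (fun e => ?_) le_rfl) (bump_nonneg _ _ _))
  have h1 : R ≤ bergmanDist z e := by
    by_contra! h2
    exact hc ⟨hz, e, e.2, h2⟩
  have h2 : 1 ≤ bergmanDist z e / R := by rwa [le_div_iff₀ hR, one_mul]
  exact max_le le_rfl (by linarith)

lemma bump_le_add {E : Set (Cn n)} (hE : E ⊆ ball n) {R : ℝ} (hR : 0 < R) {z w : Cn n}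
    (hz : z ∈ ball n) (hw : w ∈ ball n) : bump E R z ≤ bump E R w + bergmanDist z w / R := by
  have hd := bergmanDist_nonneg hz hw
  have hd' : 0 ≤ bergmanDist z w / R := by positivity
  refine Real.iSup_le (fun e => ?_) (add_nonneg (bump_nonneg _ _ _) hd')
  have h1 := le_ciSup (bump_bddAbove hE hR hw) e
  have h2 := bergmanDist_triangle hw hz (hE e.2)
  rw [bergmanDist_comm hw hz] at h2
  have h3 : bergmanDist w e / R ≤ bergmanDist z w / R + bergmanDist z e / R := by
    rw [← add_div]
    gcongr
  change max 0 (1 - bergmanDist w e / R) ≤ bump E R w at h1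
  rcases max_le_iff.1 h1 with ⟨h4, h5⟩
  exact max_le (by linarith) (by linarith)

lemma abs_bump_sub_le {E : Set (Cn n)} (hE : E ⊆ ball n) {R : ℝ} (hR : 0 < R) {z w : Cn n}
    (hz : z ∈ ball n) (hw : w ∈ ball n) : |bump E R z - bump E R w| ≤ bergmanDist z w / R := by
  have h1 := bump_le_add hE hR hz hw
  have h2 := bump_le_add hE hR hw hz
  rw [bergmanDist_comm hw hz] at h2
  exact abs_le.2 ⟨by linarith, by linarith⟩

lemma continuousOn_of_abs_sub_le {φ : Cn n → ℝ} {L : ℝ}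
    (h : ∀ z ∈ ball n, ∀ w ∈ ball n, |φ z - φ w| ≤ L * bergmanDist z w) :
    ContinuousOn φ (ball n) := by
  intro w hw
  have h1 := ((continuousOn_bergmanDist hw) w hw).const_mul L
  have h2 : Filter.Tendsto (fun z => L * bergmanDist z w) (nhdsWithin w (ball n)) (nhds 0) := by
    have : L * bergmanDist w w = 0 := by rw [bergmanDist_self, mul_zero]
    rw [← this]
    exact h1
  rw [ContinuousWithinAt, tendsto_iff_norm_sub_tendsto_zero]
  refine squeeze_zero' (Filter.Eventually.of_forall fun _ => norm_nonneg _) ?_ h2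
  filter_upwards [self_mem_nhdsWithin] with z hz
  exact h z hz w hw

/-- Dividing by `max 1 a` instead of `a` keeps Lipschitz bounds without any lower bound for `a`. -/
lemma abs_div_max_sub_le {x y a b : ℝ} (hx0 : 0 ≤ x) (hx1 : x ≤ 1) :
    |x / max 1 a - y / max 1 b| ≤ |x - y| + |a - b| := by
  have ha : 1 ≤ max 1 a := le_max_left _ _
  have hb : 1 ≤ max 1 b := le_max_left _ _
  have hab : |max 1 b - max 1 a| ≤ |a - b| := by
    have := abs_max_sub_max_le_abs b a 1
    rw [max_comm 1 b, max_comm 1 a, abs_sub_comm a b]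
    exact this
  have e : x / max 1 a - y / max 1 b =
      (x - y) / max 1 b + x / max 1 a * ((max 1 b - max 1 a) / max 1 b) := by
    field_simp
    ring
  rw [e]
  refine (abs_add_le _ _).trans ?_
  have h1 : |(x - y) / max 1 b| ≤ |x - y| := by
    rw [abs_div, abs_of_pos (by linarith : 0 < max 1 b)]
    exact div_le_self (abs_nonneg _) hb
  have h2 : |(max 1 b - max 1 a) / max 1 b| ≤ |a - b| := by
    rw [abs_div, abs_of_pos (by linarith : 0 < max 1 b)]
    exact (div_le_self (abs_nonneg _) hb).trans hab
  have h3 : |x / max 1 a| ≤ 1 := by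
    rw [abs_of_nonneg (by positivity)]
    exact div_le_one_of_le₀ (hx1.trans ha) (by positivity)
  rw [abs_mul]
  have := mul_le_mul h3 h2 (abs_nonneg _) zero_le_one
  linarith

/-- The bumps are divided by the maximum of `1` and their sum. On the union of the `E i` the sum is
at least one, so the quotients add up to one there; elsewhere the deficit `m` remains. For two
points together at most `2 M` bumps are nonzero, so the sum is Lipschitz with constant `2 M / R`,
and the numerator contributes another `1 / R`. -/
lemma exists_partition {Λ : Type*} {E : Λ → Set (Cn n)} (hE : ∀ i, E i ⊆ ball n) {R : ℝ}
    (hR : 0 < R) {M : ℕ} (hM : ∀ z ∈ ball n, {i | z ∈ bergmanNhd (E i) R}.encard ≤ M) :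
    ∃ (χ : Λ → Cn n → ℝ) (m : Cn n → ℝ), (∀ i, Measurable (χ i)) ∧ Measurable m ∧
      (∀ i z, 0 ≤ χ i z) ∧ (∀ i z, χ i z ≠ 0 → z ∈ bergmanNhd (E i) R) ∧
      (∀ z, 0 ≤ m z ∧ m z ≤ 1) ∧ (∀ z ∈ ball n, HasSum (fun i => χ i z) (1 - m z)) ∧
      (∀ z ∈ ⋃ i, E i, m z = 0) ∧
      ∀ i, ∀ z ∈ ball n, ∀ w ∈ ball n, |χ i z - χ i w| ≤ (2 * M + 1) / R * bergmanDist z w := by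
  classical
  have hfin : ∀ z ∈ ball n, {i | z ∈ bergmanNhd (E i) R}.Finite := fun z hz =>
    Set.finite_of_encard_le_coe (hM z hz)
  set A : Cn n → Finset Λ := fun z => if hz : z ∈ ball n then (hfin z hz).toFinset else ∅ with hA
  have hAmem : ∀ z ∈ ball n, ∀ i, i ∈ A z ↔ z ∈ bergmanNhd (E i) R := fun z hz i => by
    simp [hA, hz]
  have hAcard : ∀ z ∈ ball n, (A z).card ≤ M := fun z hz => by
    have h1 := hM z hz
    rw [(hfin z hz).encard_eq_coe_toFinset_card] at h1
    simp only [hA, dif_pos hz]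
    exact_mod_cast h1
  have hzero : ∀ z ∈ ball n, ∀ i ∉ A z, bump (E i) R z = 0 := fun z hz i hi => by
    by_contra hc
    exact hi ((hAmem z hz i).2 (mem_bergmanNhd_of_bump_ne_zero hR hz hc))
  set a : Cn n → ℝ := fun z => ∑ i ∈ A z, bump (E i) R z with ha
  have hsum : ∀ z ∈ ball n, ∀ s : Finset Λ, A z ⊆ s → ∑ i ∈ s, bump (E i) R z = a z :=
    fun z hz s hs => (Finset.sum_subset hs fun i _ hi => hzero z hz i hi).symm
  have ha0 : ∀ z, 0 ≤ a z := fun z => Finset.sum_nonneg fun i _ => bump_nonneg _ _ _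
  have haL : ∀ z ∈ ball n, ∀ w ∈ ball n, |a z - a w| ≤ 2 * M / R * bergmanDist z w := by
    intro z hz w hw
    rw [← hsum z hz _ (Finset.subset_union_left (s₂ := A w)),
      ← hsum w hw _ (Finset.subset_union_right (s₁ := A z)), ← Finset.sum_sub_distrib]
    have hd := bergmanDist_nonneg hz hw
    have hcard : ((A z ∪ A w).card : ℝ) ≤ 2 * M := by
      have := (Finset.card_union_le (A z) (A w)).trans (add_le_add (hAcard z hz) (hAcard w hw))
      have h2 : (A z ∪ A w).card ≤ 2 * M := by omega
      exact_mod_cast h2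
    calc _ ≤ ∑ i ∈ A z ∪ A w, |bump (E i) R z - bump (E i) R w| := Finset.abs_sum_le_sum_abs _ _
      _ ≤ ∑ _i ∈ A z ∪ A w, bergmanDist z w / R :=
        Finset.sum_le_sum fun i _ => abs_bump_sub_le (hE i) hR hz hw
      _ = (A z ∪ A w).card * (bergmanDist z w / R) := by rw [Finset.sum_const, nsmul_eq_mul]
      _ ≤ 2 * M * (bergmanDist z w / R) := by gcongr
      _ = _ := by ring
  set φ : Λ → Cn n → ℝ := fun i z => bump (E i) R z / max 1 (a z) with hφ
  have hφL : ∀ i, ∀ z ∈ ball n, ∀ w ∈ ball n,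
      |φ i z - φ i w| ≤ (2 * M + 1) / R * bergmanDist z w := by
    intro i z hz w hw
    refine (abs_div_max_sub_le (bump_nonneg _ _ _) (bump_le_one (hE i) hR hz)).trans ?_
    refine (add_le_add (abs_bump_sub_le (hE i) hR hz hw) (haL z hz w hw)).trans_eq ?_
    ring
  have hac : ContinuousOn a (ball n) := continuousOn_of_abs_sub_le haL
  have hmax : ∀ z, 0 < max 1 (a z) := fun z => lt_of_lt_of_le one_pos (le_max_left _ _)
  set m : Cn n → ℝ := (ball n).indicator fun z => 1 - a z / max 1 (a z) with hm
  refine ⟨fun i => (ball n).indicator (φ i), m, fun i => ?_, ?_, fun i z => ?_, fun i z h => ?_,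
    fun z => ?_, fun z hz => ?_, fun z hz => ?_, fun i z hz w hw => ?_⟩
  · exact measurable_indicator_of_continuousOn (measurableSet_ball n)
      (continuousOn_of_abs_sub_le (hφL i))
  · exact measurable_indicator_of_continuousOn (measurableSet_ball n)
      (continuousOn_const.sub (hac.div (continuousOn_const.sup hac) fun z _ => (hmax z).ne'))
  · exact Set.indicator_nonneg (fun z _ => div_nonneg (bump_nonneg _ _ _) (hmax z).le) z
  · beta_reduce at h
    have hz := Set.mem_of_indicator_ne_zero h
    rw [Set.indicator_of_mem hz] at h
    exact mem_bergmanNhd_of_bump_ne_zero hR hz fun h0 => h (by simp [hφ, h0])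
  · by_cases hz : z ∈ ball n
    · rw [hm, Set.indicator_of_mem hz]
      have h1 : a z / max 1 (a z) ≤ 1 := div_le_one_of_le₀ (le_max_right _ _) (hmax z).le
      have h2 : 0 ≤ a z / max 1 (a z) := div_nonneg (ha0 z) (hmax z).le
      constructor <;> linarith
    · rw [hm, Set.indicator_of_notMem hz]
      norm_num
  · have h1 : 1 - m z = ∑ i ∈ A z, (ball n).indicator (φ i) z := by
      simp only [hm, Set.indicator_of_mem hz, hφ, ← Finset.sum_div]
      ring
    rw [h1]
    refine hasSum_sum_of_ne_finset_zero fun i hi => ?_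
    simp [hφ, hzero z hz i hi]
  · obtain ⟨i, hi⟩ := Set.mem_iUnion.1 hz
    have hzb := hE i hi
    rw [hm, Set.indicator_of_mem hzb]
    have h1 : 1 ≤ a z := by
      rw [← bump_eq_one (hE i) hR hi]
      have hiA : i ∈ A z := by
        rw [hAmem z hzb]
        exact ⟨hzb, z, hi, by rwa [bergmanDist_self]⟩
      exact Finset.single_le_sum (f := fun i => bump (E i) R z) (fun _ _ => bump_nonneg _ _ _) hiA
    rw [max_eq_right h1, div_self (by linarith)]
    ring
  · simp only [Set.indicator_of_mem hz, Set.indicator_of_mem hw]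
    exact hφL i z hz w hw

end Partition


/-! ### Glueing local decompositions -/

/-- Cauchy–Schwarz for counting measure against the indicator of the at most `M` active indices. -/
lemma sq_tsum_le {Λ : Type*} [Countable Λ] {M : ℕ} {a : Λ → ℝ≥0∞} {s : Set Λ} (hs : s.encard ≤ M)
    (ha : ∀ i, i ∉ s → a i = 0) : (∑' i, a i) ^ 2 ≤ M * ∑' i, a i ^ 2 := by
  let _ : MeasurableSpace Λ := ⊤
  have : DiscreteMeasurableSpace Λ := ⟨fun _ => trivial⟩
  classical
  have h := sq_lintegral_mul_le (μ := Measure.count) (f := s.indicator fun _ => (1 : ℝ≥0∞)) (g := a)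
    measurable_from_top.aemeasurable measurable_from_top.aemeasurable
  simp only [lintegral_count] at h
  have h1 : ∀ i, s.indicator (fun _ => (1 : ℝ≥0∞)) i * a i = a i := fun i => by
    by_cases hi : i ∈ s
    · simp [hi]
    · simp [ha i hi]
  have h2 : ∑' i, (s.indicator (fun _ => (1 : ℝ≥0∞)) i) ^ 2 ≤ M := by
    have hfin := Set.finite_of_encard_le_coe hs
    have h3 : ∀ i, (s.indicator (fun _ => (1 : ℝ≥0∞)) i) ^ 2 = s.indicator (fun _ => 1) i := fun i => by
      by_cases hi : i ∈ s <;> simp [hi]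
    simp only [h3]
    rw [hfin.encard_eq_coe_toFinset_card] at hs
    rw [tsum_eq_sum (s := hfin.toFinset) (fun i hi => by simpa using hi),
      Finset.sum_congr rfl (g := fun _ => (1 : ℝ≥0∞)) (fun i hi => by
        simpa using hi)]
    simp only [Finset.sum_const, nsmul_eq_mul, mul_one]
    exact_mod_cast hs
  simp only [h1] at h
  refine h.trans ?_
  gcongr

lemma tsum_indicator_le {Λ X : Type*} {M : ℕ} {F : Λ → Set X} {z : X}
    (hs : {i | z ∈ F i}.encard ≤ M) (g : X → ℝ≥0∞) :
    ∑' i, (F i).indicator g z ≤ M * g z := by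
  classical
  have hfin := Set.finite_of_encard_le_coe hs
  rw [hfin.encard_eq_coe_toFinset_card] at hs
  rw [tsum_eq_sum (s := hfin.toFinset) (fun i hi => by
      have hi' : z ∉ F i := by simpa using hi
      exact Set.indicator_of_notMem hi' g),
    Finset.sum_congr rfl (g := fun _ => g z) (fun i hi => by
      have hi' : z ∈ F i := by simpa using hi
      exact Set.indicator_of_mem hi' g)]
  rw [Finset.sum_const, nsmul_eq_mul]
  gcongr
  exact_mod_cast hs

/-- A family of local sets with bounded overlap, polynomials of bounded degree, and a Lipschitz
partition of unity. -/
structure Cover (n N M : ℕ) (R : ℝ) where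
  /-- The index set of the local sets. -/
  Λ : Type
  /-- The index sets of the polynomials. -/
  Γ : Λ → Type
  /-- The local sets. -/
  E : Λ → Set (Cn n)
  /-- The polynomials. -/
  p : (i : Λ) → Γ i → MvPolynomial (Fin n) ℂ
  /-- The partition of unity. -/
  χ : Λ → Cn n → ℝ
  /-- The part of the unit that is not covered. -/
  m : Cn n → ℝ
  countable_Λ : Countable Λ
  countable_Γ : ∀ i, Countable (Γ i)
  E_subset : ∀ i, E i ⊆ ball n
  degree_le : ∀ i j, (p i j).totalDegree ≤ N
  overlap : ∀ z ∈ ball n, {i | z ∈ bergmanNhd (E i) (3 * R)}.encard ≤ M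
  measurable_χ : ∀ i, Measurable (χ i)
  measurable_m : Measurable m
  χ_nonneg : ∀ i z, 0 ≤ χ i z
  χ_support : ∀ i z, χ i z ≠ 0 → z ∈ bergmanNhd (E i) R
  m_mem : ∀ z, 0 ≤ m z ∧ m z ≤ 1
  hasSum_χ : ∀ z ∈ ball n, HasSum (fun i => χ i z) (1 - m z)
  lipschitz_χ : ∀ i, ∀ z ∈ ball n, ∀ w ∈ ball n,
    |χ i z - χ i w| ≤ (2 * M + 1) / R * bergmanDist z w
  le_R : 1 / 2 * Real.log ((1 + 1 / 2) / (1 - 1 / 2)) ≤ R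

namespace Cover

variable {n N M : ℕ} {R : ℝ} (D : Cover n N M R)

instance : Countable D.Λ := D.countable_Λ

instance (i : D.Λ) : Countable (D.Γ i) := D.countable_Γ i

/-- The indices of the polynomials. -/
abbrev Idx : Type := Σ i, D.Γ i

/-- The polynomial with a given index, as a function. -/
noncomputable def P (x : D.Idx) : Cn n → ℂ := polyEval (D.p x.1 x.2)

/-- The domain of the coefficients. -/
def U (i : D.Λ) : Set (Cn n) := bergmanNhd (D.E i) (3 * R)

/-- The smaller neighbourhood on which averages of the coefficients are controlled. -/
def U' (i : D.Λ) : Set (Cn n) := bergmanNhd (D.E i) (2 * R)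

lemma R_pos (D : Cover n N M R) : 0 < R := by
  refine lt_of_lt_of_le ?_ D.le_R
  have := Real.log_pos (x := (1 + 1 / 2) / (1 - 1 / 2)) (by norm_num)
  linarith

lemma isOpen_U (i : D.Λ) : IsOpen (D.U i) := isOpen_bergmanNhd (D.E_subset i) _

lemma isOpen_U' (i : D.Λ) : IsOpen (D.U' i) := isOpen_bergmanNhd (D.E_subset i) _

lemma U_subset (i : D.Λ) : D.U i ⊆ ball n := fun _ hw => hw.1

lemma U'_subset_U (i : D.Λ) : D.U' i ⊆ D.U i :=
  bergmanNhd_mono (by linarith [D.R_pos])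

lemma χ_support' {i : D.Λ} {z : Cn n} (h : D.χ i z ≠ 0) : z ∈ D.U' i :=
  bergmanNhd_mono (by linarith [D.R_pos]) (D.χ_support i z h)

lemma χ_le_one (i : D.Λ) (z : Cn n) : D.χ i z ≤ 1 := by
  by_cases hz : D.χ i z = 0
  · rw [hz]
    exact zero_le_one
  · have hzb : z ∈ ball n := (D.χ_support i z hz).1
    have h1 := le_hasSum (D.hasSum_χ z hzb) i fun j _ => D.χ_nonneg j z
    have h2 := (D.m_mem z).1
    linarith

lemma mem_U_of_dist {i : D.Λ} {w x : Cn n} (hx : x ∈ D.U' i) (hw : w ∈ ball n)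
    (h : bergmanDist w x ≤ R) : w ∈ D.U i := by
  have := bergmanNhd_bergmanNhd (D.E_subset i) hx hw h
  rwa [show 2 * R + R = 3 * R by ring] at this

lemma bergmanDist_le_of_pseudoHyp {w x : Cn n} {t : ℝ} (h : pseudoHyp w x ≤ t) (ht : t < 1) :
    bergmanDist w x ≤ 1 / 2 * Real.log ((1 + t) / (1 - t)) :=
  log_ratio_mono (pseudoHyp_nonneg _ _) h ht

/-- The field `le_R` says that the discs `ρ < 1 / 2` have Bergman radius at most `R`. The three
radii are thus `R` for the support of the partition of unity, `2 R` for the centres of averages and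
`3 R` for the domain of the coefficients. -/
lemma near_subset_U {i : D.Λ} {w : Cn n} (hw : w ∈ D.U' i) :
    {x | x ∈ ball n ∧ pseudoHyp w x < 1 / 2} ⊆ D.U i := fun x hx => by
  refine D.mem_U_of_dist hw hx.1 ?_
  rw [bergmanDist_comm hx.1 hw.1]
  exact (bergmanDist_le_of_pseudoHyp hx.2.le (by norm_num)).trans D.le_R

variable (c : D.Idx → Cn n → ℂ)

/-- The coefficients, extended by zero. -/
noncomputable def ext (x : D.Idx) : Cn n → ℂ := (D.U x.1).indicator (c x)

/-- The size of one summand of the local decomposition. -/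
noncomputable def e (x : D.Idx) : Cn n → ℝ≥0∞ :=
  (D.U x.1).indicator fun w => ‖D.P x w * c x w‖ₑ

/-- The local average of the size of one summand. -/
noncomputable def W (x : D.Idx) : Cn n → ℝ≥0∞ := (D.U' x.1).indicator (avg (D.e c x))

/-- The sum of all local averages. -/
noncomputable def V (w : Cn n) : ℝ≥0∞ := ∑' x, D.W c x w

variable {c}

lemma continuous_P (x : D.Idx) : Continuous (D.P x) := (differentiable_polyEval _).continuous

lemma measurable_ext (hc : ∀ x, DifferentiableOn ℂ (c x) (D.U x.1)) (x : D.Idx) :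
    Measurable (D.ext c x) :=
  measurable_indicator_of_continuousOn (D.isOpen_U x.1).measurableSet (hc x).continuousOn

lemma measurable_e (hc : ∀ x, DifferentiableOn ℂ (c x) (D.U x.1)) (x : D.Idx) :
    Measurable (D.e c x) :=
  measurable_indicator_of_continuousOn (D.isOpen_U x.1).measurableSet
    (continuous_enorm.comp_continuousOn ((D.continuous_P x).continuousOn.mul (hc x).continuousOn))

lemma measurable_W (hc : ∀ x, DifferentiableOn ℂ (c x) (D.U x.1)) (x : D.Idx) :
    Measurable (D.W c x) :=
  (measurable_avg (D.measurable_e hc x)).indicator (D.isOpen_U' x.1).measurableSet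

lemma measurable_V (hc : ∀ x, DifferentiableOn ℂ (c x) (D.U x.1)) : Measurable (D.V c) :=
  Measurable.tsum fun x => D.measurable_W hc x

/-- The surplus `N` in the exponent of the kernel pays for the growth factor of
`enorm_polyEval_mul_le`, and exactly `hker` is left. The constant depends on `n` and `N` only, so it
is available before `R` and the cover are chosen. -/
lemma exists_kernel_bound (n N : ℕ) : ∃ C₀ : ℝ, 0 ≤ C₀ ∧ ∀ (M : ℕ) (R : ℝ) (D : Cover n N M R)
    (c : D.Idx → Cn n → ℂ), (∀ x, DifferentiableOn ℂ (c x) (D.U x.1)) →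
    ∀ x, ∀ z ∈ ball n, ∀ w ∈ D.U' x.1,
      ‖D.P x z * (c x w * bker (N + (n + 2)) z w)‖ₑ ≤
        ENNReal.ofReal C₀ * (hker z w * D.W c x w) := by
  obtain ⟨C, hC, h⟩ := enorm_polyEval_mul_le n N
  refine ⟨C, hC, fun M R D c hc x z hz w hw => ?_⟩
  have hwb : w ∈ ball n := hw.1
  have h1 := h (D.p x.1 x.2) (D.degree_le _ _) (c x) w hwb ((hc x).mono (D.near_subset_U hw)) z hz
  have h2 : ∫⁻ y, avgKer w y * ‖polyEval (D.p x.1 x.2) y * c x y‖ₑ ∂(ballMeasure n) =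
      D.W c x w := by
    rw [W, Set.indicator_of_mem hw, avg]
    refine lintegral_congr_ae ?_
    filter_upwards [ae_mem_ball n] with y hy
    rw [avgKer_eq hwb hy]
    split_ifs with hlt
    · rw [e, Set.indicator_of_mem (D.near_subset_U hw ⟨hy, hlt⟩)]
      rfl
    · simp
  rw [h2] at h1
  have hD := norm_one_sub_inner_pos hwb (mem_ball_iff.1 hz).le
  have ho := om_pos hwb
  have h3 : ‖bker (N + (n + 2)) z w‖ₑ = ENNReal.ofReal
      (om w ^ (N + (n + 2)) / ‖1 - inner ℂ w z‖ ^ (n + 1 + (N + (n + 2)))) := by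
    rw [← ofReal_norm, bker, norm_div, norm_pow, norm_pow, Complex.norm_real,
      Real.norm_of_nonneg ho.le]
  calc ‖D.P x z * (c x w * bker (N + (n + 2)) z w)‖ₑ
      = (‖polyEval (D.p x.1 x.2) z‖ₑ * ‖c x w‖ₑ) * ‖bker (N + (n + 2)) z w‖ₑ := by
        rw [enorm_mul, enorm_mul, mul_assoc]
        rfl
    _ ≤ (ENNReal.ofReal (C * (‖1 - inner ℂ w z‖ / om w) ^ N) * D.W c x w) *
          ‖bker (N + (n + 2)) z w‖ₑ := by gcongr
    _ = ENNReal.ofReal C * (hker z w * D.W c x w) := by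
        rw [h3, mul_right_comm, ← ENNReal.ofReal_mul (by positivity), hker, ← mul_assoc,
          ← ENNReal.ofReal_mul hC]
        congr 2
        have e1 : n + 1 + (N + (n + 2)) = N + (2 * n + 3) := by ring
        rw [e1, pow_add, pow_add, div_pow]
        field_simp
        ring

/-- Summation over `j` passes inside the average, bounded overlap replaces the square of the sum
over `i` by the sum of squares, and `lintegral_avg_sq_le` removes the averages. -/
lemma lintegral_V_sq_le (hc : ∀ x, DifferentiableOn ℂ (c x) (D.U x.1)) {κ : ℕ} (hκ : κ ≤ 1) :
    ∫⁻ w, D.V c w ^ 2 * weight w ^ κ ∂(ballMeasure n) ≤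
      M * (ENNReal.ofReal (6 ^ (n + 2)) * ∑' i, ∫⁻ w in D.U i,
        (∑' j, ‖polyEval (D.p i j) w * c ⟨i, j⟩ w‖ₑ) ^ 2 * weight w ^ κ ∂(ballMeasure n)) := by
  set G : D.Λ → Cn n → ℝ≥0∞ := fun i w => ∑' j, D.e c ⟨i, j⟩ w with hG
  have hGm : ∀ i, Measurable (G i) := fun i =>
    Measurable.tsum fun j => D.measurable_e hc ⟨i, j⟩
  have hV : ∀ w, D.V c w = ∑' i, (D.U' i).indicator (avg (G i)) w := fun w => by
    rw [V, ENNReal.tsum_sigma' fun x => D.W c x w]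
    refine tsum_congr fun i => ?_
    by_cases hw : w ∈ D.U' i
    · simp only [W, Set.indicator_of_mem hw, avg, hG]
      rw [← lintegral_tsum (f := fun j y => avgKer w y * D.e c ⟨i, j⟩ y) fun j => ((measurable_avgKer.comp measurable_prodMk_left).mul
        (D.measurable_e hc ⟨i, j⟩)).aemeasurable]
      simp only [ENNReal.tsum_mul_left]
    · simp only [W, Set.indicator_of_notMem hw, tsum_zero]
  have hGU : ∀ i w, G i w ^ 2 * weight w ^ κ = (D.U i).indicator (fun w =>
      (∑' j, ‖polyEval (D.p i j) w * c ⟨i, j⟩ w‖ₑ) ^ 2 * weight w ^ κ) w := fun i w => by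
    by_cases hw : w ∈ D.U i
    · simp only [hG, e, Set.indicator_of_mem hw, P]
    · simp [hG, e, Set.indicator_of_notMem hw]
  have hm : ∀ i, Measurable fun w => (avg (G i) w) ^ 2 * weight w ^ κ := fun i =>
    ((measurable_avg (hGm i)).pow_const 2).mul (measurable_weight.pow_const κ)
  calc ∫⁻ w, D.V c w ^ 2 * weight w ^ κ ∂(ballMeasure n)
      ≤ ∫⁻ w, M * ∑' i, avg (G i) w ^ 2 * weight w ^ κ ∂(ballMeasure n) := by
        refine lintegral_mono_ae ?_
        filter_upwards [ae_mem_ball n] with w hw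
        rw [hV w]
        have h1 := sq_tsum_le (a := fun i => (D.U' i).indicator (avg (G i)) w)
          (D.overlap w hw) (fun i hi => Set.indicator_of_notMem (fun h => hi (D.U'_subset_U i h)) _)
        calc _ ≤ (M * ∑' i, ((D.U' i).indicator (avg (G i)) w) ^ 2) * weight w ^ κ := by gcongr
          _ = M * ∑' i, ((D.U' i).indicator (avg (G i)) w) ^ 2 * weight w ^ κ := by
            rw [mul_assoc, ENNReal.tsum_mul_right]
          _ ≤ _ := by
            gcongr with i
            exact Set.indicator_le_self' (fun _ _ => zero_le) w
    _ = M * ∑' i, ∫⁻ w, avg (G i) w ^ 2 * weight w ^ κ ∂(ballMeasure n) := by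
        rw [lintegral_const_mul' _ _ (ENNReal.natCast_ne_top M),
          lintegral_tsum fun i => (hm i).aemeasurable]
    _ ≤ M * ∑' i, ENNReal.ofReal (6 ^ (n + 2)) *
          ∫⁻ w, G i w ^ 2 * weight w ^ κ ∂(ballMeasure n) := by
        gcongr with i
        exact lintegral_avg_sq_le hκ (hGm i)
    _ = _ := by
        rw [ENNReal.tsum_mul_left]
        congr 3
        funext i
        simp only [hGU]
        rw [lintegral_indicator (D.isOpen_U i).measurableSet]

end Cover


/-! ### The holomorphic gluing operator -/

lemma norm_one_sub_inner_ge {n : ℕ} {z w : Cn n} (hw : w ∈ ball n) : 1 - ‖z‖ ≤ ‖1 - inner ℂ w z‖ := by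
  have h1 : ‖inner ℂ w z‖ ≤ ‖z‖ := (norm_inner_le_norm w z).trans
    (by nlinarith [norm_nonneg z, norm_nonneg w, mem_ball_iff.1 hw])
  have h2 := norm_sub_norm_le (1 : ℂ) (inner ℂ w z)
  rw [norm_one] at h2
  linarith

lemma differentiableOn_integral_div {n : ℕ} (m : ℕ) {φ : Cn n → ℂ}
    (hφ : Integrable φ (ballMeasure n)) :
    DifferentiableOn ℂ (fun z => ∫ w, φ w / (1 - inner ℂ w z) ^ m ∂(ballMeasure n)) (ball n) := by
  intro z₀ hz₀
  refine DifferentiableAt.differentiableWithinAt ?_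
  have hz1 := mem_ball_iff.1 hz₀
  set d : ℝ := (1 - ‖z₀‖) / 2 with hd
  have hd0 : 0 < d := by rw [hd]; linarith
  have hin : ∀ z ∈ Metric.ball z₀ d, ‖z‖ ≤ 1 - d := fun z hz => by
    rw [mem_ball_iff_norm] at hz
    have := norm_le_norm_add_norm_sub' z z₀
    linarith
  have hmeas : ∀ z : Cn n, Measurable fun w : Cn n => (1 - inner ℂ w z : ℂ) := fun z =>
    (by fun_prop : Continuous fun w : Cn n => (1 - inner ℂ w z : ℂ)).measurable
  have hFm : ∀ z : Cn n, AEStronglyMeasurable (fun w => φ w / (1 - inner ℂ w z) ^ m)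
      (ballMeasure n) := fun z => by
    simp only [div_eq_mul_inv]
    exact hφ.aestronglyMeasurable.mul ((hmeas z).pow_const m).inv.aestronglyMeasurable
  set F' : Cn n → Cn n → (Cn n →L[ℂ] ℂ) := fun z w =>
    (φ w * (-(m * (1 - inner ℂ w z) ^ (m - 1)) / ((1 - inner ℂ w z) ^ m) ^ 2)) •
      (-(innerSL ℂ w)) with hF'
  refine (hasFDerivAt_integral_of_dominated_of_fderiv_le (𝕜 := ℂ) (μ := ballMeasure n)
    (F := fun z w => φ w / (1 - inner ℂ w z) ^ m) (F' := F') (x₀ := z₀)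
    (s := Metric.ball z₀ d) (bound := fun w => ‖φ w‖ * (m * 2 ^ (m - 1) / (d ^ m) ^ 2))
    (Metric.ball_mem_nhds _ hd0) (Filter.Eventually.of_forall hFm) ?_ ?_ ?_ ?_ ?_).differentiableAt
  · have h1 : Integrable (fun w => ‖φ w‖ * (d ^ m)⁻¹) (ballMeasure n) := hφ.norm.mul_const _
    refine h1.mono' (hFm z₀) ?_
    filter_upwards [ae_mem_ball n] with w hw
    rw [norm_div, norm_pow, div_eq_mul_inv]
    have h2 := norm_one_sub_inner_ge (z := z₀) hw
    have h3 := hin z₀ (Metric.mem_ball_self hd0)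
    gcongr
    linarith
  · refine AEStronglyMeasurable.smul (𝕜 := ℂ) (hφ.aestronglyMeasurable.mul
      (Measurable.aestronglyMeasurable ?_)) (Continuous.aestronglyMeasurable ?_)
    · exact ((measurable_const.mul ((hmeas z₀).pow_const _)).neg).div
        (((hmeas z₀).pow_const m).pow_const 2)
    · exact (innerSL ℂ).continuous.neg
  · filter_upwards [ae_mem_ball n] with w hw z hz
    have h2 := norm_one_sub_inner_ge (z := z) hw
    have h3 := hin z hz
    have h4 : d ≤ ‖1 - inner ℂ w z‖ := by linarith
    have h5 : ‖(1 - inner ℂ w z : ℂ)‖ ≤ 2 := by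
      have := norm_sub_le (1 : ℂ) (inner ℂ w z)
      have h6 := norm_inner_lt_one hw (u := z) (by linarith)
      rw [norm_one] at this
      linarith
    have h7 : ‖-(innerSL ℂ w)‖ ≤ 1 := by
      rw [norm_neg, innerSL_apply_norm]
      exact (mem_ball_iff.1 hw).le
    rw [hF', norm_smul, norm_mul, norm_div, norm_neg, norm_mul, norm_pow, norm_pow, norm_pow,
      RCLike.norm_natCast]
    calc _ ≤ ‖φ w‖ * (m * 2 ^ (m - 1) / (d ^ m) ^ 2) * 1 := by gcongr
      _ = _ := mul_one _
  · exact hφ.norm.mul_const _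
  · filter_upwards [ae_mem_ball n] with w hw z hz
    have h3 := hin z hz
    have hne : (1 - inner ℂ w z : ℂ) ≠ 0 := one_sub_inner_ne_zero hw (mem_ball_iff.2 (by linarith))
    have h1 : HasFDerivAt (fun z : Cn n => (1 - inner ℂ w z : ℂ)) (-(innerSL ℂ w)) z :=
      ((innerSL ℂ w).hasFDerivAt).const_sub 1
    have h2 := (((hasDerivAt_pow m (1 - inner ℂ w z : ℂ)).fun_inv (pow_ne_zero m hne)).const_mul
      (φ w)).comp_hasFDerivAt z h1
    exact h2

namespace Cover

variable {n N M : ℕ} {R : ℝ} (D : Cover n N M R) (c : D.Idx → Cn n → ℂ)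

/-- Coefficients for which the gluing construction is possible, with the constant `C₀` in the
pointwise bound. -/
structure Admissible (C₀ : ℝ) : Prop where
  differentiableOn : ∀ x, DifferentiableOn ℂ (c x) (D.U x.1)
  eq_zero : ∀ x, D.p x.1 x.2 = 0 → c x = 0
  lintegral_ne_top : ∫⁻ w, D.V c w ^ 2 ∂(ballMeasure n) ≠ ∞
  kernel_bound : ∀ x, ∀ z ∈ ball n, ∀ w ∈ D.U' x.1,
    ‖D.P x z * (c x w * bker (N + (n + 2)) z w)‖ₑ ≤
      ENNReal.ofReal C₀ * (hker z w * D.W c x w)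

/-- The integrand of the gluing operator. -/
noncomputable def ker (x : D.Idx) (z w : Cn n) : ℂ :=
  (D.χ x.1 w : ℂ) * (D.ext c x w * bker (N + (n + 2)) z w)

/-- The global coefficients. -/
noncomputable def coef (γ : ℂ) (x : D.Idx) (z : Cn n) : ℂ := γ * ∫ w, D.ker c x z w ∂(ballMeasure n)

/-- The part of an integrable function that is assembled from local pieces. -/
noncomputable def glue (γ : ℂ) (z : Cn n) : ℂ := ∑' x, D.P x z * D.coef c γ x z

lemma measurable_bker (l : ℕ) : Measurable (Function.uncurry (bker (n := n) l)) := by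
  have h1 : Measurable (fun p : Cn n × Cn n => (om p.2 : ℂ)) :=
    (Complex.continuous_ofReal.comp (continuous_om.comp continuous_snd)).measurable
  have h2 : Measurable (fun p : Cn n × Cn n => (1 - inner ℂ p.2 p.1 : ℂ)) :=
    (by fun_prop : Continuous fun p : Cn n × Cn n => (1 - inner ℂ p.2 p.1 : ℂ)).measurable
  exact (h1.pow_const _).div (h2.pow_const _)

lemma hker_le {z w : Cn n} (hz : z ∈ ball n) (hw : w ∈ ball n) :
    hker z w ≤ ENNReal.ofReal ((1 - ‖z‖) ^ (2 * n + 3))⁻¹ := by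
  have hz1 := mem_ball_iff.1 hz
  have h0 : 0 < 1 - ‖z‖ := by linarith
  rw [hker]
  refine ENNReal.ofReal_le_ofReal ?_
  rw [div_eq_mul_inv]
  calc om w ^ (n + 2) * (‖1 - inner ℂ w z‖ ^ (2 * n + 3))⁻¹
      ≤ 1 * ((1 - ‖z‖) ^ (2 * n + 3))⁻¹ := by
        gcongr
        · exact pow_le_one₀ (om_pos hw).le (om_le_one w)
        · exact norm_one_sub_inner_ge hw
    _ = _ := one_mul _

variable {c} {C₀ : ℝ} {D} (hc : D.Admissible c C₀)

namespace Admissible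
include hc

lemma measurable_ker (x : D.Idx) : Measurable (Function.uncurry (D.ker c x)) :=
  (Complex.measurable_ofReal.comp ((D.measurable_χ x.1).comp measurable_snd)).mul
    (((D.measurable_ext hc.differentiableOn x).comp measurable_snd).mul (measurable_bker _))

lemma enorm_ker_le (x : D.Idx) {z : Cn n} (hz : z ∈ ball n) (w : Cn n) :
    ‖D.P x z * D.ker c x z w‖ₑ ≤ ENNReal.ofReal C₀ * (hker z w * D.W c x w) := by
  by_cases h : D.χ x.1 w = 0
  · simp [ker, h]
  have hw := D.χ_support' h
  have h1 : D.ext c x w = c x w := Set.indicator_of_mem (D.U'_subset_U _ hw) _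
  rw [ker, h1, mul_left_comm, enorm_mul]
  calc _ ≤ 1 * ‖D.P x z * (c x w * bker (N + (n + 2)) z w)‖ₑ := by
        gcongr
        rw [← ofReal_norm, Complex.norm_real, Real.norm_of_nonneg (D.χ_nonneg _ _)]
        exact ENNReal.ofReal_le_one.2 (D.χ_le_one _ _)
    _ ≤ _ := by
        rw [one_mul]
        exact hc.kernel_bound x z hz w hw

lemma lintegral_V_ne_top : ∫⁻ w, D.V c w ∂(ballMeasure n) ≠ ∞ := by
  have h := sq_lintegral_mul_le (μ := ballMeasure n) (f := fun _ => 1) (g := D.V c)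
    measurable_const.aemeasurable (D.measurable_V hc.differentiableOn).aemeasurable
  simp only [one_mul, one_pow, lintegral_const, measure_univ] at h
  intro h'
  rw [h'] at h
  exact hc.lintegral_ne_top (top_unique (by simpa using h))

lemma tsum_lintegral_W : ∑' x, ∫⁻ w, D.W c x w ∂(ballMeasure n) = ∫⁻ w, D.V c w ∂(ballMeasure n) :=
  (lintegral_tsum fun x => (D.measurable_W hc.differentiableOn x).aemeasurable).symm

lemma lintegral_ker_le (x : D.Idx) {z : Cn n} (hz : z ∈ ball n) :
    ∫⁻ w, ‖D.P x z * D.ker c x z w‖ₑ ∂(ballMeasure n) ≤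
      ENNReal.ofReal (C₀ * ((1 - ‖z‖) ^ (2 * n + 3))⁻¹) * ∫⁻ w, D.W c x w ∂(ballMeasure n) := by
  rw [← lintegral_const_mul _ (D.measurable_W hc.differentiableOn x)]
  have h0 : 0 ≤ (1 - ‖z‖) := by linarith [mem_ball_iff.1 hz]
  rw [ENNReal.ofReal_mul' (by positivity)]
  refine lintegral_mono_ae ?_
  filter_upwards [ae_mem_ball n] with w hw
  refine (hc.enorm_ker_le x hz w).trans ?_
  rw [mul_assoc]
  gcongr
  exact hker_le hz hw

lemma lintegral_W_ne_top (x : D.Idx) : ∫⁻ w, D.W c x w ∂(ballMeasure n) ≠ ∞ := by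
  have h1 := ENNReal.le_tsum (f := fun x => ∫⁻ w, D.W c x w ∂(ballMeasure n)) x
  rw [hc.tsum_lintegral_W] at h1
  exact ne_top_of_le_ne_top hc.lintegral_V_ne_top h1

lemma integrable_P_mul_ker (x : D.Idx) {z : Cn n} (hz : z ∈ ball n) :
    Integrable (fun w => D.P x z * D.ker c x z w) (ballMeasure n) :=
  ⟨(((hc.measurable_ker x).comp measurable_prodMk_left).const_mul _).aestronglyMeasurable,
    (hc.lintegral_ker_le x hz).trans_lt
      (ENNReal.mul_ne_top ENNReal.ofReal_ne_top (hc.lintegral_W_ne_top x)).lt_top⟩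

end Admissible

lemma exists_P_ne_zero {x : D.Idx} (hx : D.p x.1 x.2 ≠ 0) : ∃ z ∈ ball n, D.P x z ≠ 0 := by
  by_contra! h
  have hcont : Continuous fun y : Fin n → ℂ => (WithLp.toLp 2 y : Cn n) :=
    PiLp.continuous_toLp 2 _
  obtain ⟨ε, hε, hball⟩ := Metric.isOpen_iff.1 ((isOpen_ball n).preimage hcont) 0 (by
    simpa using zero_mem_ball n)
  refine hx (MvPolynomial.funext_set (fun _ => Metric.ball (0 : ℂ) ε)
    (fun _ => infinite_of_mem_nhds 0 (Metric.ball_mem_nhds 0 hε)) fun y hy => ?_)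
  rw [map_zero]
  refine h _ (hball (a := y) ?_)
  rw [mem_ball_zero_iff, pi_norm_lt_iff hε]
  exact fun i => by simpa using hy i trivial

namespace Admissible
include hc

/-- The estimates control only products with the polynomial; dividing by a nonzero value `P(z)`
gives integrability of the coefficient itself. For the zero polynomial the estimates carry no
information, which is the reason for the field `eq_zero`. -/
lemma integrable_density (x : D.Idx) : Integrable (fun w => (D.χ x.1 w : ℂ) *
    (D.ext c x w * (om w : ℂ) ^ (N + (n + 2)))) (ballMeasure n) := by
  by_cases hx : D.p x.1 x.2 = 0
  · have h0 : ∀ w, D.ext c x w = 0 := fun w => by simp [ext, hc.eq_zero x hx]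
    simp [h0]
  obtain ⟨z, hz, hP⟩ := exists_P_ne_zero hx
  have h1 := (hc.integrable_P_mul_ker x hz).const_mul (D.P x z)⁻¹
  have h2 : Integrable (fun w => D.ker c x z w) (ballMeasure n) := by
    refine h1.congr (Filter.Eventually.of_forall fun w => ?_)
    simp only
    rw [inv_mul_cancel_left₀ hP]
  refine (h2.norm.const_mul (2 ^ (n + 1 + (N + (n + 2))))).mono' ?_ ?_
  · refine Measurable.aestronglyMeasurable ?_
    exact (Complex.measurable_ofReal.comp (D.measurable_χ x.1)).mul
      ((D.measurable_ext hc.differentiableOn x).mul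
        ((Complex.measurable_ofReal.comp continuous_om.measurable).pow_const _))
  · filter_upwards [ae_mem_ball n] with w hw
    have hD := norm_one_sub_inner_pos hw (mem_ball_iff.1 hz).le
    have hD2 := norm_one_sub_inner_le_two hz hw
    simp only [ker, bker, norm_mul, norm_div, norm_pow]
    calc _ = ‖(D.χ x.1 w : ℂ)‖ * (‖D.ext c x w‖ * (‖(om w : ℂ)‖ ^ (N + (n + 2)) /
          ‖1 - inner ℂ w z‖ ^ (n + 1 + (N + (n + 2))))) * ‖1 - inner ℂ w z‖ ^ (n + 1 + (N + (n + 2))) := by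
          field_simp
      _ ≤ ‖(D.χ x.1 w : ℂ)‖ * (‖D.ext c x w‖ * (‖(om w : ℂ)‖ ^ (N + (n + 2)) /
          ‖1 - inner ℂ w z‖ ^ (n + 1 + (N + (n + 2))))) * 2 ^ (n + 1 + (N + (n + 2))) := by
          gcongr
      _ = _ := by ring

lemma differentiableOn_coef (γ : ℂ) (x : D.Idx) : DifferentiableOn ℂ (D.coef c γ x) (ball n) := by
  have h := (differentiableOn_integral_div (n + 1 + (N + (n + 2))) (hc.integrable_density x)).const_mul γ
  refine h.congr fun z _ => ?_
  rw [coef]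
  congr 2
  funext w
  rw [ker, bker]
  ring

lemma integrable_ker (x : D.Idx) {z : Cn n} (hz : z ∈ ball n) :
    Integrable (fun w => D.ker c x z w) (ballMeasure n) := by
  have hz1 := mem_ball_iff.1 hz
  have h0 : 0 < 1 - ‖z‖ := by linarith
  refine ((hc.integrable_density x).norm.mul_const
    ((1 - ‖z‖) ^ (n + 1 + (N + (n + 2))))⁻¹).mono'
    ((hc.measurable_ker x).comp measurable_prodMk_left).aestronglyMeasurable ?_
  filter_upwards [ae_mem_ball n] with w hw
  simp only [ker, bker, norm_mul, norm_div, norm_pow]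
  have := norm_one_sub_inner_ge (z := z) hw
  rw [div_eq_mul_inv, ← mul_assoc, ← mul_assoc, ← mul_assoc]
  gcongr

lemma enorm_P_mul_coef_le (γ : ℂ) (x : D.Idx) {z : Cn n} (hz : z ∈ ball n) :
    ‖D.P x z * D.coef c γ x z‖ₑ ≤
      ‖γ‖ₑ * ENNReal.ofReal C₀ * ∫⁻ w, hker z w * D.W c x w ∂(ballMeasure n) := by
  rw [coef, mul_left_comm, ← integral_const_mul, enorm_mul, mul_assoc]
  gcongr
  refine (enorm_integral_le_lintegral_enorm _).trans ?_
  rw [← lintegral_const_mul' _ _ ENNReal.ofReal_ne_top]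
  exact lintegral_mono fun w => hc.enorm_ker_le x hz w

lemma tsum_enorm_le (γ : ℂ) {z : Cn n} (hz : z ∈ ball n) :
    ∑' x, ‖D.P x z * D.coef c γ x z‖ₑ ≤
      ‖γ‖ₑ * ENNReal.ofReal C₀ * ∫⁻ w, hker z w * D.V c w ∂(ballMeasure n) := by
  calc _ ≤ ∑' x, ‖γ‖ₑ * ENNReal.ofReal C₀ * ∫⁻ w, hker z w * D.W c x w ∂(ballMeasure n) :=
        ENNReal.tsum_le_tsum fun x => hc.enorm_P_mul_coef_le γ x hz
    _ = _ := by
        rw [ENNReal.tsum_mul_left, ← lintegral_tsum (f := fun x w => hker z w * D.W c x w) fun x =>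
          ((measurable_hker.comp measurable_prodMk_left).mul
            (D.measurable_W hc.differentiableOn x)).aemeasurable]
        simp only [ENNReal.tsum_mul_left, V]

lemma lintegral_tsum_sq_le (γ : ℂ) {A : ℝ} {κ : ℕ}
    (hA : ∀ g : Cn n → ℝ≥0∞, Measurable g →
      ∫⁻ z, (∫⁻ w, hker z w * g w ∂(ballMeasure n)) ^ 2 * weight z ^ κ ∂(ballMeasure n) ≤
        ENNReal.ofReal A * ∫⁻ w, g w ^ 2 * weight w ^ κ ∂(ballMeasure n)) :
    ∫⁻ z, (∑' x, ‖D.P x z * D.coef c γ x z‖ₑ) ^ 2 * weight z ^ κ ∂(ballMeasure n) ≤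
      (‖γ‖ₑ * ENNReal.ofReal C₀) ^ 2 * (ENNReal.ofReal A *
        ∫⁻ w, D.V c w ^ 2 * weight w ^ κ ∂(ballMeasure n)) := by
  calc _ ≤ ∫⁻ z, (‖γ‖ₑ * ENNReal.ofReal C₀) ^ 2 *
          ((∫⁻ w, hker z w * D.V c w ∂(ballMeasure n)) ^ 2 * weight z ^ κ) ∂(ballMeasure n) := by
        refine lintegral_mono_ae ?_
        filter_upwards [ae_mem_ball n] with z hz
        rw [← mul_assoc, ← mul_pow]
        gcongr
        exact hc.tsum_enorm_le γ hz
    _ ≤ _ := by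
        rw [lintegral_const_mul' _ _ (by finiteness)]
        gcongr
        exact hA _ (D.measurable_V hc.differentiableOn)

end Admissible

end Cover

lemma lintegral_hker_sq_le {n : ℕ} {A : ℝ} {g : Cn n → ℝ≥0∞} {κ : ℕ}
    (hA : ∫⁻ z, (∫⁻ w, farKer 1 z w * g w ∂(ballMeasure n)) ^ 2 * weight z ^ κ ∂(ballMeasure n) ≤
      ENNReal.ofReal (A * 1) * ∫⁻ w, g w ^ 2 * weight w ^ κ ∂(ballMeasure n)) :
    ∫⁻ z, (∫⁻ w, hker z w * g w ∂(ballMeasure n)) ^ 2 * weight z ^ κ ∂(ballMeasure n) ≤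
      ENNReal.ofReal A * ∫⁻ w, g w ^ 2 * weight w ^ κ ∂(ballMeasure n) := by
  rw [mul_one] at hA
  refine le_trans (le_of_eq ?_) hA
  refine lintegral_congr_ae ?_
  filter_upwards [ae_mem_ball n] with z hz
  congr 2
  refine lintegral_congr_ae ?_
  filter_upwards [ae_mem_ball n] with w hw
  rw [farKer_one hz hw]

lemma exists_hker_bound (n : ℕ) : ∃ A : ℝ, 0 < A ∧ ∀ κ ≤ 1, ∀ g : Cn n → ℝ≥0∞, Measurable g →
    ∫⁻ z, (∫⁻ w, hker z w * g w ∂(ballMeasure n)) ^ 2 * weight z ^ κ ∂(ballMeasure n) ≤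
      ENNReal.ofReal A * ∫⁻ w, g w ^ 2 * weight w ^ κ ∂(ballMeasure n) := by
  obtain ⟨A, hA, h⟩ := exists_farKer_bound n
  exact ⟨A, hA, fun κ hκ g hg => lintegral_hker_sq_le (h 1 one_pos κ hκ g hg)⟩


/-! ### The glued function belongs to the closure of the ideal -/

namespace Cover

variable {n N M : ℕ} {R : ℝ} {D : Cover n N M R} {c : D.Idx → Cn n → ℂ} {C₀ : ℝ}
  (hc : D.Admissible c C₀)

lemma lintegral_hker_le (D : Cover n N M R) (c : D.Idx → Cn n → ℂ) {z : Cn n} (hz : z ∈ ball n) :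
    ∫⁻ w, hker z w * D.V c w ∂(ballMeasure n) ≤
      ENNReal.ofReal ((1 - ‖z‖) ^ (2 * n + 3))⁻¹ * ∫⁻ w, D.V c w ∂(ballMeasure n) := by
  rw [← lintegral_const_mul' _ _ ENNReal.ofReal_ne_top]
  refine lintegral_mono_ae ?_
  filter_upwards [ae_mem_ball n] with w hw
  gcongr
  exact hker_le hz hw

lemma enorm_glue_le (D : Cover n N M R) (c : D.Idx → Cn n → ℂ) (γ : ℂ) (z : Cn n) :
    ‖D.glue c γ z‖ₑ ≤ ∑' x, ‖D.P x z * D.coef c γ x z‖ₑ := enorm_tsum_le_tsum_enorm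

namespace Admissible
include hc

lemma tsum_enorm_ne_top (γ : ℂ) {z : Cn n} (hz : z ∈ ball n) :
    ∑' x, ‖D.P x z * D.coef c γ x z‖ₑ ≠ ∞ := by
  have h1 := hc.lintegral_V_ne_top
  refine ne_top_of_le_ne_top ?_ ((hc.tsum_enorm_le γ hz).trans
    (mul_le_mul_right (D.lintegral_hker_le c hz) _))
  finiteness

lemma summable (γ : ℂ) {z : Cn n} (hz : z ∈ ball n) :
    Summable fun x => D.P x z * D.coef c γ x z :=
  Summable.of_enorm (hc.tsum_enorm_ne_top γ hz)

/-- The summands are dominated on each smaller ball by a convergent series of constants. Continuity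
is enough at this stage: it identifies the sum with the holomorphic representative that the duality
argument will produce. -/
lemma continuousOn_glue (γ : ℂ) : ContinuousOn (D.glue c γ) (ball n) := by
  intro z₀ hz₀
  have hz1 := mem_ball_iff.1 hz₀
  set r : ℝ := (1 + ‖z₀‖) / 2 with hr
  have hr1 : r < 1 := by rw [hr]; linarith
  have hr0 : ‖z₀‖ < r := by rw [hr]; linarith
  have hsub : Metric.ball (0 : Cn n) r ⊆ ball n := Metric.ball_subset_ball hr1.le
  set b : D.Idx → ℝ := fun x => (‖γ‖ₑ * ENNReal.ofReal C₀ *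
    (ENNReal.ofReal ((1 - r) ^ (2 * n + 3))⁻¹ * ∫⁻ w, D.W c x w ∂(ballMeasure n))).toReal with hb
  have hfin : ∀ x, ‖γ‖ₑ * ENNReal.ofReal C₀ *
      (ENNReal.ofReal ((1 - r) ^ (2 * n + 3))⁻¹ * ∫⁻ w, D.W c x w ∂(ballMeasure n)) ≠ ∞ := fun x => by
    have := hc.lintegral_W_ne_top x
    finiteness
  have hsum : Summable b := by
    refine ENNReal.summable_toReal ?_
    rw [ENNReal.tsum_mul_left, ENNReal.tsum_mul_left, hc.tsum_lintegral_W]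
    have := hc.lintegral_V_ne_top
    finiteness
  have hcont : ContinuousOn (D.glue c γ) (Metric.ball (0 : Cn n) r) := by
    refine continuousOn_tsum (u := b) (fun x => ?_) hsum fun x z hz => ?_
    · exact ((D.continuous_P x).continuousOn.mul (hc.differentiableOn_coef γ x).continuousOn).mono hsub
    · rw [← toReal_enorm]
      refine ENNReal.toReal_mono (hfin x) ?_
      refine (hc.enorm_P_mul_coef_le γ x (hsub hz)).trans ?_
      gcongr
      rw [← lintegral_const_mul' _ _ ENNReal.ofReal_ne_top]
      refine lintegral_mono_ae ?_
      filter_upwards [ae_mem_ball n] with w hw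
      gcongr
      refine (hker_le (hsub hz) hw).trans (ENNReal.ofReal_le_ofReal ?_)
      have : ‖z‖ < r := by simpa using hz
      have h2 : 0 < 1 - r := by linarith
      gcongr
  exact (hcont.continuousAt (Metric.isOpen_ball.mem_nhds (by simpa using hr0))).continuousWithinAt

lemma lintegral_hker_V_sq_ne_top :
    ∫⁻ z, (∫⁻ w, hker z w * D.V c w ∂(ballMeasure n)) ^ 2 ∂(ballMeasure n) ≠ ∞ := by
  obtain ⟨A, -, h⟩ := exists_hker_bound n
  have h1 := h 0 (by norm_num) _ (D.measurable_V hc.differentiableOn)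
  simp only [pow_zero, mul_one] at h1
  exact ne_top_of_le_ne_top (ENNReal.mul_ne_top ENNReal.ofReal_ne_top hc.lintegral_ne_top) h1

lemma measurable_lintegral_hker :
    Measurable fun z => ∫⁻ w, hker z w * D.V c w ∂(ballMeasure n) :=
  Measurable.lintegral_prod_right' (f := fun p : Cn n × Cn n => hker p.1 p.2 * D.V c p.2)
    (measurable_hker.mul ((D.measurable_V hc.differentiableOn).comp measurable_snd))

lemma memLp_glue (γ : ℂ) : MemLp (D.glue c γ) 2 (ballMeasure n) := by
  refine ⟨?_, ?_⟩
  · have h1 := (hc.continuousOn_glue γ).aestronglyMeasurable (μ := volume) (measurableSet_ball n)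
    exact h1.mono_ac Measure.smul_absolutelyContinuous
  · rw [eLpNorm_lt_top_iff_lintegral_rpow_enorm_lt_top (by norm_num) (by norm_num)]
    norm_num
    have h2 : ∫⁻ z, ‖D.glue c γ z‖ₑ ^ 2 ∂(ballMeasure n) ≤ (‖γ‖ₑ * ENNReal.ofReal C₀) ^ 2 *
        ∫⁻ z, (∫⁻ w, hker z w * D.V c w ∂(ballMeasure n)) ^ 2 ∂(ballMeasure n) := by
      rw [← lintegral_const_mul' _ _ (by finiteness)]
      refine lintegral_mono_ae ?_
      filter_upwards [ae_mem_ball n] with z hz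
      rw [← mul_pow]
      gcongr
      exact (D.enorm_glue_le c γ z).trans (hc.tsum_enorm_le γ hz)
    have := hc.lintegral_hker_V_sq_ne_top
    exact h2.trans_lt (by finiteness)

variable {I : Ideal (MvPolynomial (Fin n) ℂ)}

/-- After Fubini, the integral over `z` for fixed `w` pairs `u` with a polynomial of the ideal times
a kernel function, which gives zero. The assumption `huK` provides absolute convergence. -/
lemma integral_star_mul_eq_zero (hI : ∀ x : D.Idx, D.p x.1 x.2 ∈ I) {u : Lp ℂ 2 (ballMeasure n)}
    (hu : ∀ p ∈ I, inner ℂ u (polyToBergman n p : Lp ℂ 2 (ballMeasure n)) = 0)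
    (huK : ∫⁻ z, ‖u z‖ₑ * ∫⁻ w, hker z w * D.V c w ∂(ballMeasure n) ∂(ballMeasure n) ≠ ∞)
    (γ : ℂ) (x : D.Idx) :
    ∫ z, (starRingEnd ℂ) (u z) * (D.P x z * D.coef c γ x z) ∂(ballMeasure n) = 0 := by
  have h1 : ∀ z, (starRingEnd ℂ) (u z) * (D.P x z * D.coef c γ x z) =
      γ * ∫ w, (starRingEnd ℂ) (u z) * (D.P x z * D.ker c x z w) ∂(ballMeasure n) := fun z => by
    rw [integral_const_mul, integral_const_mul, coef]
    ring
  simp only [h1]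
  rw [integral_const_mul, integral_integral_swap]
  · have h2 : ∀ᵐ w ∂(ballMeasure n),
        ∫ z, (starRingEnd ℂ) (u z) * (D.P x z * D.ker c x z w) ∂(ballMeasure n) = 0 := by
      filter_upwards [ae_mem_ball n] with w hw
      have h3 := integral_star_mul_bker_eq_zero hu (hI x) (N + (n + 2)) hw
      have h4 : ∀ z, (starRingEnd ℂ) (u z) * (D.P x z * D.ker c x z w) =
          ((D.χ x.1 w : ℂ) * D.ext c x w) * ((starRingEnd ℂ) (u z) *
            (polyEval (D.p x.1 x.2) z * bker (N + (n + 2)) z w)) := fun z => by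
        rw [ker, P]
        ring
      simp only [h4]
      rw [integral_const_mul, h3, mul_zero]
    rw [integral_congr_ae h2, integral_zero, mul_zero]
  · have hm : AEStronglyMeasurable (Function.uncurry fun z w =>
        (starRingEnd ℂ) (u z) * (D.P x z * D.ker c x z w))
        ((ballMeasure n).prod (ballMeasure n)) := by
      refine (Complex.continuous_conj.comp_aestronglyMeasurable
        (Lp.aestronglyMeasurable u)).comp_fst.mul (Measurable.aestronglyMeasurable ?_)
      exact ((D.continuous_P x).measurable.comp measurable_fst).mul (hc.measurable_ker x)
    refine ⟨hm, ?_⟩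
    rw [hasFiniteIntegral_iff_enorm, lintegral_prod _ hm.enorm]
    refine lt_of_le_of_lt ?_ (ENNReal.mul_ne_top (ENNReal.ofReal_ne_top (r := C₀)) huK).lt_top
    rw [← lintegral_const_mul' _ _ ENNReal.ofReal_ne_top]
    refine lintegral_mono_ae ?_
    filter_upwards [ae_mem_ball n] with z hz
    simp only [Function.uncurry, enorm_mul (starRingEnd ℂ _), RCLike.enorm_conj]
    rw [lintegral_const_mul' _ _ enorm_ne_top, mul_left_comm]
    gcongr
    rw [← lintegral_const_mul' _ _ ENNReal.ofReal_ne_top]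
    refine lintegral_mono fun w => (hc.enorm_ker_le x hz w).trans ?_
    gcongr
    exact ENNReal.le_tsum (f := fun x => D.W c x w) x

/-- By `exists_mem_idealClosure` it suffices to test against functions orthogonal to the ideal, and
absolute integrability allows this term by term. Convergence of the series in norm is not needed. -/
lemma exists_fn_eq_glue (hI : ∀ x : D.Idx, D.p x.1 x.2 ∈ I) (γ : ℂ) :
    ∃ s ∈ idealClosure I, ∀ z ∈ ball n, fn s z = D.glue c γ z := by
  have hmem := hc.memLp_glue γ
  obtain ⟨s, hs, hse⟩ := exists_mem_idealClosure (I := I) (hmem.toLp (D.glue c γ)) fun u hu => by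
    have huK : ∫⁻ z, ‖u z‖ₑ * ∫⁻ w, hker z w * D.V c w ∂(ballMeasure n) ∂(ballMeasure n) ≠ ∞ := by
      have h1 := sq_lintegral_mul_le (μ := ballMeasure n) (f := fun z => ‖u z‖ₑ)
        (Lp.aestronglyMeasurable u).enorm hc.measurable_lintegral_hker.aemeasurable
      intro h2
      rw [h2, ← enorm_sq_eq_lintegral] at h1
      refine ENNReal.mul_ne_top ?_ hc.lintegral_hker_V_sq_ne_top (top_unique (by simpa using h1))
      finiteness
    have h0 : inner ℂ u (hmem.toLp (D.glue c γ)) =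
        ∫ z, ∑' x, (starRingEnd ℂ) (u z) * (D.P x z * D.coef c γ x z) ∂(ballMeasure n) := by
      rw [L2.inner_def]
      refine integral_congr_ae ?_
      filter_upwards [hmem.coeFn_toLp] with z hz
      rw [hz, RCLike.inner_apply, mul_comm, glue, tsum_mul_left]
    rw [h0, integral_tsum]
    · simp only [hc.integral_star_mul_eq_zero hI hu huK, tsum_zero]
    · intro x
      refine (Complex.continuous_conj.comp_aestronglyMeasurable (Lp.aestronglyMeasurable u)).mul ?_
      have h1 := ((D.continuous_P x).continuousOn.mul
        (hc.differentiableOn_coef γ x).continuousOn).aestronglyMeasurable (μ := volume)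
          (measurableSet_ball n)
      exact h1.mono_ac Measure.smul_absolutelyContinuous
    · rw [← lintegral_tsum]
      · refine ne_top_of_le_ne_top (ENNReal.mul_ne_top (a := ‖γ‖ₑ * ENNReal.ofReal C₀)
          (by finiteness) huK) ?_
        rw [← lintegral_const_mul' _ _ (by finiteness)]
        refine lintegral_mono_ae ?_
        filter_upwards [ae_mem_ball n] with z hz
        simp only [enorm_mul (starRingEnd ℂ _), RCLike.enorm_conj]
        rw [ENNReal.tsum_mul_left, mul_left_comm]
        gcongr
        exact hc.tsum_enorm_le γ hz
      · intro x
        refine AEStronglyMeasurable.enorm ?_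
        refine (Complex.continuous_conj.comp_aestronglyMeasurable (Lp.aestronglyMeasurable u)).mul ?_
        have h1 := ((D.continuous_P x).continuousOn.mul
          (hc.differentiableOn_coef γ x).continuousOn).aestronglyMeasurable (μ := volume)
            (measurableSet_ball n)
        exact h1.mono_ac Measure.smul_absolutelyContinuous
  refine ⟨s, hs, fun z hz => fn_eq_of_ae_eq s (hc.continuousOn_glue γ) ?_ hz⟩
  rw [hse]
  exact hmem.coeFn_toLp

lemma coef_add {c' : D.Idx → Cn n → ℂ} (hc' : D.Admissible c' C₀) (γ : ℂ) (x : D.Idx) {z : Cn n}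
    (hz : z ∈ ball n) :
    D.coef (fun x => c x + c' x) γ x z = D.coef c γ x z + D.coef c' γ x z := by
  rw [coef, coef, coef, ← mul_add, ← integral_add (hc.integrable_ker x hz) (hc'.integrable_ker x hz)]
  congr 2
  funext w
  simp only [ker, ext, Set.indicator_add', Pi.add_apply]
  ring

end Admissible

lemma coef_smul (D : Cover n N M R) (c : D.Idx → Cn n → ℂ) (a γ : ℂ) (x : D.Idx) (z : Cn n) :
    D.coef (fun x => a • c x) γ x z = a * D.coef c γ x z := by
  rw [coef, coef, mul_left_comm, ← integral_const_mul (r := a)]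
  congr 2
  funext w
  by_cases hw : w ∈ D.U x.1
  · simp only [ker, ext, Set.indicator_of_mem hw, Pi.smul_apply, smul_eq_mul]
    ring
  · simp [ker, ext, hw]

end Cover


/-! ### Pointwise estimates of the gluing error -/

lemma ennreal_add_sq_le (a b : ℝ≥0∞) : (a + b) ^ 2 ≤ 2 * a ^ 2 + 2 * b ^ 2 := by
  have h := ENNReal.rpow_add_le_mul_rpow_add_rpow a b (p := 2) (by norm_num)
  norm_num at h
  rwa [mul_add] at h

namespace Cover

variable {n N M : ℕ} {R : ℝ} (D : Cover n N M R) (c : D.Idx → Cn n → ℂ)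

/-- The gluing error of one summand. -/
noncomputable def defect (γ : ℂ) (x : D.Idx) (z : Cn n) : ℂ :=
  D.χ x.1 z * (D.P x z * D.ext c x z) - D.P x z * D.coef c γ x z

/-- The error of a local decomposition of `f`. -/
noncomputable def localErr (f : Cn n → ℂ) (i : D.Λ) : Cn n → ℝ≥0∞ :=
  (D.U i).indicator fun z => ‖(∑' j, polyEval (D.p i j) z * c ⟨i, j⟩ z) - f z‖ₑ

variable {c} {C₀ : ℝ} {D} (hc : D.Admissible c C₀)

namespace Admissible
include hc

/-- The sum of the `χ_i p_{ij} f_{ij}` is inserted between `(1 - m) f` and the glued function. The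
first difference consists of local errors with weights `χ_i ≤ 1`, the second of the defects. If the
defects are not summable, the right side is infinite. -/
lemma enorm_sub_glue_le (γ : ℂ) (f : Cn n → ℂ) {z : Cn n} (hz : z ∈ ball n) :
    ‖f z - D.glue c γ z - D.m z * f z‖ₑ ≤
      ∑' i, D.localErr c f i z + ∑' x, ‖D.defect c γ x z‖ₑ := by
  by_cases hfin : ∑' x, ‖D.defect c γ x z‖ₑ = ∞
  · rw [hfin, add_top]
    exact le_top
  have h1 : Summable fun x => D.defect c γ x z := Summable.of_enorm hfin
  have h2 := hc.summable γ hz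
  have h3 : Summable fun x : D.Idx => (D.χ x.1 z : ℂ) * (D.P x z * D.ext c x z) :=
    (h1.add h2).congr fun x => by
      rw [defect]
      ring
  have h4 : HasSum (fun i => (D.χ i z : ℂ) * f z) ((1 - D.m z) * f z) := by
    have := (Complex.hasSum_ofReal.2 (D.hasSum_χ z hz)).mul_right (f z)
    simpa using this
  have h5 : HasSum (fun i => ∑' j, (D.χ i z : ℂ) * (D.P ⟨i, j⟩ z * D.ext c ⟨i, j⟩ z))
      (∑' x : D.Idx, (D.χ x.1 z : ℂ) * (D.P x z * D.ext c x z)) :=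
    h3.hasSum.sigma fun i => (h3.sigma_factor i).hasSum
  have h6 : ∑' x, D.defect c γ x z =
      ∑' x : D.Idx, (D.χ x.1 z : ℂ) * (D.P x z * D.ext c x z) - D.glue c γ z :=
    h3.tsum_sub h2
  have h7 := (h4.sub h5).tsum_eq
  have h8 : f z - D.glue c γ z - D.m z * f z = ∑' i, ((D.χ i z : ℂ) * f z -
      ∑' j, (D.χ i z : ℂ) * (D.P ⟨i, j⟩ z * D.ext c ⟨i, j⟩ z)) + ∑' x, D.defect c γ x z := by
    rw [h6, h7]
    ring
  rw [h8]
  refine (enorm_add_le _ _).trans (add_le_add (enorm_tsum_le_tsum_enorm.trans ?_)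
    enorm_tsum_le_tsum_enorm)
  refine ENNReal.tsum_le_tsum fun i => ?_
  rw [tsum_mul_left, ← mul_sub, enorm_mul]
  by_cases hχ : D.χ i z = 0
  · simp [hχ]
  have hzU := D.U'_subset_U i (D.χ_support' hχ)
  rw [localErr, Set.indicator_of_mem hzU]
  have h9 : ∀ j, D.ext c ⟨i, j⟩ z = c ⟨i, j⟩ z := fun j => Set.indicator_of_mem hzU _
  simp only [h9, P]
  rw [← enorm_neg (f z - _), neg_sub]
  refine mul_le_of_le_one_left zero_le ?_
  rw [← ofReal_norm, Complex.norm_real, Real.norm_of_nonneg (D.χ_nonneg _ _)]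
  exact ENNReal.ofReal_le_one.2 (D.χ_le_one _ _)

/-- The radius of the local mean value property is `τ`, and `lam` bounds the oscillation of the
partition of unity on discs of that radius. -/
lemma enorm_defect_le {τ θ lam : ℝ} (hτ0 : 0 ≤ τ) (hτ1 : τ < 1) (hθ : 1 - τ ^ 2 ≤ θ ^ 4)
    (hR : 2 * (1 / 2 * Real.log ((1 + τ) / (1 - τ))) ≤ R)
    (hlam : (2 * M + 1) / R * (1 / 2 * Real.log ((1 + τ) / (1 - τ))) ≤ lam) {γ : ℂ}
    (hγ : γ * ∫ u in Metric.ball 0 τ, (om u : ℂ) ^ (N + (n + 2)) ∂(ballMeasure n) = 1)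
    (x : D.Idx) {z : Cn n} (hz : z ∈ ball n) :
    ‖D.defect c γ x z‖ₑ ≤ ‖γ‖ₑ * ENNReal.ofReal C₀ *
      ∫⁻ w, (farKer θ z w + ENNReal.ofReal lam * hker z w) * D.W c x w ∂(ballMeasure n) := by
  set i := x.1 with hi
  set l := N + (n + 2) with hl
  have hnm : MeasurableSet (near z τ) := (isOpen_near hz τ).measurableSet
  -- The first term is the kernel truncated to the disc, with the partition function frozen at its
  -- value at `z`. By the mean value property and the choice of `γ`, it reproduces the local summand
  -- exactly, so the defect is `γ` times the integral of `k`.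
  set k : Cn n → ℂ := fun w => (near z τ).indicator
    (fun w => (D.χ i z : ℂ) * (D.P x z * (D.ext c x w * bker l z w))) w -
      D.P x z * D.ker c x z w with hk
  have hzn : pseudoHyp z z ≤ τ := by
    rw [show pseudoHyp z z = 0 by simp [pseudoHyp, mobius_self]]
    exact hτ0
  -- Outside the disc `1 - ρ² ≤ 1 - τ² ≤ θ⁴`, so such points belong to the far region.
  have hfar : ∀ w ∈ ball n, w ∉ near z τ → farKer θ z w = hker z w := fun w hw hwn => by
    unfold farKer
    rw [Set.indicator_of_mem]
    simp only [Set.mem_ofPred_eq]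
    have h1 : τ ≤ pseudoHyp z w := by
      by_contra! h
      exact hwn ⟨hw, h⟩
    have h2 := one_sub_pseudoHyp_sq hz hw
    rw [← h2]
    nlinarith
  -- either the partition function vanishes near `z`, or the disc lies in the domain
  have key : (∀ w ∈ ball n, pseudoHyp z w ≤ τ → D.χ i w = 0) ∨
      {w | w ∈ ball n ∧ pseudoHyp z w ≤ τ} ⊆ D.U' i := by
    by_cases h : ∀ w ∈ ball n, pseudoHyp z w ≤ τ → D.χ i w = 0
    · exact Or.inl h
    right
    push Not at h
    obtain ⟨w₀, hw₀, hw₀τ, hχ⟩ := h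
    rintro w ⟨hw, hwτ⟩
    have h1 := D.χ_support i w₀ hχ
    have h2 : bergmanDist w w₀ ≤ R := by
      refine (bergmanDist_triangle hw hz hw₀).trans ?_
      rw [bergmanDist_comm hw hz]
      have h3 := bergmanDist_le_of_pseudoHyp hwτ hτ1
      have h4 := bergmanDist_le_of_pseudoHyp hw₀τ hτ1
      linarith
    have := bergmanNhd_bergmanNhd (D.E_subset i) h1 hw h2
    rwa [← two_mul] at this
  have hkm : ∀ w, near z τ ⊆ D.U' i → w ∈ near z τ → D.ext c x w = c x w := fun w h hw =>
    Set.indicator_of_mem (D.U'_subset_U i (h hw)) _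
  have hnc : near z τ ⊆ {w | w ∈ ball n ∧ pseudoHyp z w ≤ τ} := fun w hw => ⟨hw.1, hw.2.le⟩
  have hint2 := hc.integrable_P_mul_ker x hz
  have hint1 : Integrable ((near z τ).indicator
      (fun w => (D.χ i z : ℂ) * (D.P x z * (D.ext c x w * bker l z w)))) (ballMeasure n) := by
    rcases key with h | h
    · simp [h z hz hzn]
    · have hm : Measurable ((near z τ).indicator
          (fun w => (D.χ i z : ℂ) * (D.P x z * (D.ext c x w * bker l z w)))) :=
        ((((D.measurable_ext hc.differentiableOn x).mul ((measurable_bker l).comp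
          measurable_prodMk_left)).const_mul _).const_mul _).indicator hnm
      refine ⟨hm.aestronglyMeasurable, lt_of_le_of_lt ?_ (ENNReal.mul_ne_top
        (a := ‖(D.χ i z : ℂ)‖ₑ * ENNReal.ofReal (C₀ * ((1 - ‖z‖) ^ (2 * n + 3))⁻¹)) (by finiteness)
        (hc.lintegral_W_ne_top x)).lt_top⟩
      rw [← lintegral_const_mul' _ _ (by finiteness)]
      refine lintegral_mono_ae ?_
      filter_upwards [ae_mem_ball n] with w hw
      by_cases hwn : w ∈ near z τ
      · rw [Set.indicator_of_mem hwn, enorm_mul, mul_assoc]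
        gcongr
        rw [hkm w (hnc.trans h) hwn]
        refine (hc.kernel_bound x z hz w (h (hnc hwn))).trans ?_
        have h0 : 0 ≤ (1 - ‖z‖) := by linarith [mem_ball_iff.1 hz]
        rw [ENNReal.ofReal_mul' (by positivity), mul_assoc]
        gcongr
        exact hker_le hz hw
      · rw [Set.indicator_of_notMem hwn, enorm_zero]
        exact zero_le
  have hd : D.defect c γ x z = γ * ∫ w, k w ∂(ballMeasure n) := by
    rw [hk, integral_sub hint1 hint2, mul_sub, defect, integral_indicator hnm, integral_const_mul,
      integral_const_mul, integral_const_mul, coef]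
    rcases key with h | h
    · simp only [← hi, h z hz hzn]
      push_cast
      ring
    · have hg : ContinuousOn (D.ext c x) {w | w ∈ ball n ∧ pseudoHyp z w ≤ τ} :=
        ((hc.differentiableOn x).continuousOn.mono (h.trans (D.U'_subset_U i))).congr fun w hw =>
          Set.indicator_of_mem (D.U'_subset_U i (h hw)) _
      have hg' : DifferentiableOn ℂ (D.ext c x) (near z τ) :=
        ((hc.differentiableOn x).mono ((hnc.trans h).trans (D.U'_subset_U i))).congr fun w hw =>
          Set.indicator_of_mem (D.U'_subset_U i (h (hnc hw))) _
      have h1 := setIntegral_near_eq l hz hτ1 hg hg'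
      rw [h1, mul_left_comm (D.P x z) γ]
      congr 1
      calc _ = (D.χ i z : ℂ) * (D.P x z * D.ext c x z) * 1 := by rw [mul_one]
        _ = _ := by
          rw [← hγ]
          ring
  rw [hd, enorm_mul, mul_assoc]
  gcongr
  refine (enorm_integral_le_lintegral_enorm _).trans ?_
  rw [← lintegral_const_mul' _ _ ENNReal.ofReal_ne_top]
  refine lintegral_mono_ae ?_
  filter_upwards [ae_mem_ball n] with w hw
  -- Inside the disc only the oscillation of the partition function survives, which is at most
  -- `lam`; outside, the truncated term vanishes and the far kernel bounds the rest.
  by_cases hwn : w ∈ near z τ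
  · have hk1 : k w = ((D.χ i z - D.χ i w : ℝ) : ℂ) * (D.P x z * (D.ext c x w * bker l z w)) := by
      simp only [hk, Set.indicator_of_mem hwn, ker]
      push_cast
      ring
    rw [hk1]
    rcases key with h | h
    · rw [h z hz hzn, h w hw hwn.2.le]
      simp
    · rw [enorm_mul, hkm w (hnc.trans h) hwn]
      have h1 : ‖((D.χ i z - D.χ i w : ℝ) : ℂ)‖ₑ ≤ ENNReal.ofReal lam := by
        rw [← ofReal_norm, Complex.norm_real]
        refine ENNReal.ofReal_le_ofReal ((D.lipschitz_χ i z hz w hw).trans (le_trans ?_ hlam))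
        have := D.R_pos
        have h3 := bergmanDist_le_of_pseudoHyp hwn.2.le hτ1
        gcongr
      calc _ ≤ ENNReal.ofReal lam * (ENNReal.ofReal C₀ * (hker z w * D.W c x w)) := by
            gcongr
            exact hc.kernel_bound x z hz w (h (hnc hwn))
        _ = ENNReal.ofReal C₀ * ((0 + ENNReal.ofReal lam * hker z w) * D.W c x w) := by ring
        _ ≤ _ := by
          gcongr
          exact zero_le
  · have hk1 : k w = -(D.P x z * D.ker c x z w) := by
      simp only [hk, Set.indicator_of_notMem hwn, zero_sub]
    rw [hk1, enorm_neg]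
    refine (hc.enorm_ker_le x hz w).trans ?_
    gcongr
    rw [hfar w hw hwn]
    exact le_self_add

end Admissible

end Cover


/-! ### The gluing error in `L²` -/

namespace Cover

variable {n N M : ℕ} {R : ℝ} {D : Cover n N M R} {c : D.Idx → Cn n → ℂ} {C₀ : ℝ}

lemma measurable_localErr (hc : ∀ x, DifferentiableOn ℂ (c x) (D.U x.1)) {f : Cn n → ℂ}
    (hf : ContinuousOn f (ball n)) (i : D.Λ) : Measurable (D.localErr c f i) := by
  have h : D.localErr c f i = (D.U i).indicator fun z =>
      ‖(∑' j, D.P ⟨i, j⟩ z * D.ext c ⟨i, j⟩ z) - (ball n).indicator f z‖ₑ := by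
    funext z
    by_cases hz : z ∈ D.U i
    · have h1 : ∀ j, D.ext c ⟨i, j⟩ z = c ⟨i, j⟩ z := fun j => Set.indicator_of_mem hz _
      simp only [localErr, Set.indicator_of_mem hz, h1, Set.indicator_of_mem (D.U_subset i hz), P]
    · simp only [localErr, Set.indicator_of_notMem hz]
  rw [h]
  refine Measurable.indicator (Measurable.enorm (Measurable.sub (Measurable.tsum fun j => ?_) ?_))
    (D.isOpen_U i).measurableSet
  · exact (D.continuous_P _).measurable.mul (D.measurable_ext hc _)
  · exact measurable_indicator_of_continuousOn (measurableSet_ball n) hf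

lemma lintegral_tsum_localErr_sq_le (hc : ∀ x, DifferentiableOn ℂ (c x) (D.U x.1)) {f : Cn n → ℂ}
    (hf : ContinuousOn f (ball n)) :
    ∫⁻ z, (∑' i, D.localErr c f i z) ^ 2 ∂(ballMeasure n) ≤
      M * ∑' i, ∫⁻ z in D.U i,
        ‖(∑' j, polyEval (D.p i j) z * c ⟨i, j⟩ z) - f z‖ₑ ^ 2 ∂(ballMeasure n) := by
  have hm := fun i => D.measurable_localErr hc hf i
  calc _ ≤ ∫⁻ z, M * ∑' i, D.localErr c f i z ^ 2 ∂(ballMeasure n) := by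
        refine lintegral_mono_ae ?_
        filter_upwards [ae_mem_ball n] with z hz
        exact sq_tsum_le (D.overlap z hz) fun i hi =>
          Set.indicator_of_notMem (s := D.U i) hi _
    _ = M * ∑' i, ∫⁻ z, D.localErr c f i z ^ 2 ∂(ballMeasure n) := by
        rw [lintegral_const_mul' _ _ (ENNReal.natCast_ne_top M),
          lintegral_tsum fun i => ((hm i).pow_const 2).aemeasurable]
    _ = _ := by
        congr 2
        funext i
        rw [← lintegral_indicator (D.isOpen_U i).measurableSet]
        congr 1
        funext z
        by_cases hz : z ∈ D.U i
        · simp only [localErr, Set.indicator_of_mem hz]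
        · simp [localErr, Set.indicator_of_notMem hz]

/-- The far part contributes the small factor `A * θ`. The near part contributes `lam²` times the
norm bound of the full operator, which is `hA` for `θ = 1`. Splitting squares of sums twice gives
the factors `2` and `4`. -/
lemma Admissible.lintegral_err_sq_le (hc : D.Admissible c C₀) {A : ℝ} (hA0 : 0 ≤ A)
    (hA : ∀ θ : ℝ, 0 < θ → ∀ g : Cn n → ℝ≥0∞, Measurable g →
      ∫⁻ z, (∫⁻ w, farKer θ z w * g w ∂(ballMeasure n)) ^ 2 ∂(ballMeasure n) ≤
        ENNReal.ofReal (A * θ) * ∫⁻ w, g w ^ 2 ∂(ballMeasure n))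
    {τ θ lam : ℝ} (hτ0 : 0 ≤ τ) (hτ1 : τ < 1) (hθ0 : 0 < θ) (hθ : 1 - τ ^ 2 ≤ θ ^ 4)
    (hR : 2 * (1 / 2 * Real.log ((1 + τ) / (1 - τ))) ≤ R) (hlam0 : 0 ≤ lam)
    (hlam : (2 * M + 1) / R * (1 / 2 * Real.log ((1 + τ) / (1 - τ))) ≤ lam) {γ : ℂ}
    (hγ : γ * ∫ u in Metric.ball 0 τ, (om u : ℂ) ^ (N + (n + 2)) ∂(ballMeasure n) = 1)
    {f : Cn n → ℂ} (hf : ContinuousOn f (ball n)) :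
    ∫⁻ z, ‖f z - D.glue c γ z - D.m z * f z‖ₑ ^ 2 ∂(ballMeasure n) ≤
      2 * (M * ∑' i, ∫⁻ z in D.U i,
        ‖(∑' j, polyEval (D.p i j) z * c ⟨i, j⟩ z) - f z‖ₑ ^ 2 ∂(ballMeasure n)) +
      ENNReal.ofReal (4 * A * (θ + lam ^ 2)) * (‖γ‖ₑ * ENNReal.ofReal C₀) ^ 2 *
        ∫⁻ w, D.V c w ^ 2 ∂(ballMeasure n) := by
  have hVm := D.measurable_V hc.differentiableOn
  have hm1 : Measurable fun z => ∑' i, D.localErr c f i z :=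
    Measurable.tsum fun i => D.measurable_localErr hc.differentiableOn hf i
  have hd : ∀ z ∈ ball n, ∑' x, ‖D.defect c γ x z‖ₑ ≤ ‖γ‖ₑ * ENNReal.ofReal C₀ *
      (∫⁻ w, farKer θ z w * D.V c w ∂(ballMeasure n) +
        ENNReal.ofReal lam * ∫⁻ w, hker z w * D.V c w ∂(ballMeasure n)) := fun z hz => by
    calc _ ≤ ∑' x, ‖γ‖ₑ * ENNReal.ofReal C₀ *
          ∫⁻ w, (farKer θ z w + ENNReal.ofReal lam * hker z w) * D.W c x w ∂(ballMeasure n) :=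
          ENNReal.tsum_le_tsum fun x => hc.enorm_defect_le hτ0 hτ1 hθ hR hlam hγ x hz
      _ = ‖γ‖ₑ * ENNReal.ofReal C₀ *
          ∫⁻ w, (farKer θ z w + ENNReal.ofReal lam * hker z w) * D.V c w ∂(ballMeasure n) := by
          rw [ENNReal.tsum_mul_left, ← lintegral_tsum (f := fun x w =>
            (farKer θ z w + ENNReal.ofReal lam * hker z w) * D.W c x w) fun x =>
              ((((measurable_farKer θ).comp measurable_prodMk_left).add
                ((measurable_hker.comp measurable_prodMk_left).const_mul _)).mul
                (D.measurable_W hc.differentiableOn x)).aemeasurable]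
          simp only [ENNReal.tsum_mul_left, V]
      _ = _ := by
          rw [← lintegral_const_mul' _ _ ENNReal.ofReal_ne_top, ← lintegral_add_left
            (f := fun w => farKer θ z w * D.V c w) (((measurable_farKer θ).comp measurable_prodMk_left).mul hVm)]
          congr 2
          funext w
          ring
  have hH := lintegral_hker_sq_le (κ := 0) (by simpa using hA 1 one_pos _ hVm)
  simp only [pow_zero, mul_one] at hH
  have hF := hA θ hθ0 _ hVm
  have hmF : Measurable fun z => ∫⁻ w, farKer θ z w * D.V c w ∂(ballMeasure n) :=
    Measurable.lintegral_prod_right' (f := fun p : Cn n × Cn n => farKer θ p.1 p.2 * D.V c p.2)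
      ((measurable_farKer θ).mul (hVm.comp measurable_snd))
  have hγC : (‖γ‖ₑ * ENNReal.ofReal C₀) ^ 2 ≠ ∞ := by finiteness
  calc _ ≤ ∫⁻ z, (2 * (∑' i, D.localErr c f i z) ^ 2 + 2 * ((‖γ‖ₑ * ENNReal.ofReal C₀) ^ 2 *
        (2 * (∫⁻ w, farKer θ z w * D.V c w ∂(ballMeasure n)) ^ 2 +
          2 * (ENNReal.ofReal lam ^ 2 *
            (∫⁻ w, hker z w * D.V c w ∂(ballMeasure n)) ^ 2)))) ∂(ballMeasure n) := by
        refine lintegral_mono_ae ?_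
        filter_upwards [ae_mem_ball n] with z hz
        calc _ ≤ (∑' i, D.localErr c f i z + ∑' x, ‖D.defect c γ x z‖ₑ) ^ 2 := by
              gcongr
              exact hc.enorm_sub_glue_le γ f hz
          _ ≤ 2 * (∑' i, D.localErr c f i z) ^ 2 + 2 * (∑' x, ‖D.defect c γ x z‖ₑ) ^ 2 :=
              ennreal_add_sq_le _ _
          _ ≤ 2 * (∑' i, D.localErr c f i z) ^ 2 + 2 * (‖γ‖ₑ * ENNReal.ofReal C₀ *
              (∫⁻ w, farKer θ z w * D.V c w ∂(ballMeasure n) +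
              ENNReal.ofReal lam * ∫⁻ w, hker z w * D.V c w ∂(ballMeasure n))) ^ 2 := by
              gcongr
              exact hd z hz
          _ ≤ _ := by
              rw [mul_pow, ← mul_pow (ENNReal.ofReal lam)]
              gcongr
              exact ennreal_add_sq_le _ _
    _ = 2 * ∫⁻ z, (∑' i, D.localErr c f i z) ^ 2 ∂(ballMeasure n) +
        2 * ((‖γ‖ₑ * ENNReal.ofReal C₀) ^ 2 *
          (2 * ∫⁻ z, (∫⁻ w, farKer θ z w * D.V c w ∂(ballMeasure n)) ^ 2 ∂(ballMeasure n) +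
          2 * (ENNReal.ofReal lam ^ 2 *
            ∫⁻ z, (∫⁻ w, hker z w * D.V c w ∂(ballMeasure n)) ^ 2 ∂(ballMeasure n)))) := by
        rw [lintegral_add_left ((hm1.pow_const 2).const_mul 2),
          lintegral_const_mul' _ _ (by finiteness), lintegral_const_mul' _ _ (by finiteness),
          lintegral_const_mul' _ _ hγC, lintegral_add_left ((hmF.pow_const 2).const_mul 2),
          lintegral_const_mul' _ _ (by finiteness), lintegral_const_mul' _ _ (by finiteness),
          lintegral_const_mul' _ _ (by finiteness)]
    _ ≤ 2 * (M * ∑' i, ∫⁻ z in D.U i,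
          ‖(∑' j, polyEval (D.p i j) z * c ⟨i, j⟩ z) - f z‖ₑ ^ 2 ∂(ballMeasure n)) +
        2 * ((‖γ‖ₑ * ENNReal.ofReal C₀) ^ 2 *
          (2 * (ENNReal.ofReal (A * θ) * ∫⁻ w, D.V c w ^ 2 ∂(ballMeasure n)) +
          2 * (ENNReal.ofReal lam ^ 2 *
            (ENNReal.ofReal A * ∫⁻ w, D.V c w ^ 2 ∂(ballMeasure n))))) := by
        gcongr
        exact D.lintegral_tsum_localErr_sq_le hc.differentiableOn hf
    _ = _ := by
        have h4 : ENNReal.ofReal (4 * A * (θ + lam ^ 2)) =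
            4 * (ENNReal.ofReal (A * θ) + ENNReal.ofReal lam ^ 2 * ENNReal.ofReal A) := by
          rw [← ENNReal.ofReal_pow hlam0, ← ENNReal.ofReal_mul (by positivity),
            ← ENNReal.ofReal_add (by positivity) (by positivity),
            show (4 : ℝ≥0∞) = ENNReal.ofReal 4 by norm_num, ← ENNReal.ofReal_mul (by norm_num)]
          congr 1
          ring
        rw [h4]
        ring

end Cover


/-! ### The compact part -/

section Compact

variable {n : ℕ}

lemma ext_of_fn {f g : bergmanSpace n} (h : ∀ z ∈ ball n, fn f z = fn g z) : f = g := by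
  refine Subtype.ext (Lp.ext ?_)
  filter_upwards [coe_ae_eq_fn f, coe_ae_eq_fn g, ae_mem_ball n] with z h1 h2 hz
  rw [h1, h2, h z hz]

lemma memLp_fn (f : bergmanSpace n) : MemLp (fn f) 2 (ballMeasure n) :=
  (memLp_congr_ae (coe_ae_eq_fn f)).1 (Lp.memLp _)

lemma integrable_fn (f : bergmanSpace n) : Integrable (fn f) (ballMeasure n) :=
  (memLp_fn f).integrable (by norm_num)

lemma memLp_star_fn (f : bergmanSpace n) :
    MemLp (fun z => (starRingEnd ℂ) (fn f z)) 2 (ballMeasure n) :=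
  (memLp_fn f).star

lemma inner_eq_integral (u f : bergmanSpace n) :
    inner ℂ u f = ∫ z, (starRingEnd ℂ) (fn u z) * fn f z ∂(ballMeasure n) := by
  rw [Submodule.coe_inner, L2.inner_def]
  refine integral_congr_ae ?_
  filter_upwards [coe_ae_eq_fn u, coe_ae_eq_fn f] with z h1 h2
  rw [h1, h2, RCLike.inner_apply, mul_comm]

lemma integral_norm_fn_le (f : bergmanSpace n) : ∫ z, ‖fn f z‖ ∂(ballMeasure n) ≤ ‖f‖ := by
  have h := lintegral_enorm_le (f : Lp ℂ 2 (ballMeasure n))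
  rw [integral_norm_eq_lintegral_enorm (integrable_fn f).aestronglyMeasurable]
  have h1 : ∫⁻ z, ‖fn f z‖ₑ ∂(ballMeasure n) =
      ∫⁻ z, ‖(f : Lp ℂ 2 (ballMeasure n)) z‖ₑ ∂(ballMeasure n) := by
    refine lintegral_congr_ae ?_
    filter_upwards [coe_ae_eq_fn f] with z hz
    rw [hz]
  rw [h1]
  have h2 := ENNReal.toReal_mono (by finiteness) h
  simpa using h2

variable {m : Cn n → ℝ} (hm : Measurable m) (hm01 : ∀ z, 0 ≤ m z ∧ m z ≤ 1)

/-- The integral of a cut-off of `f` over a set. -/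
noncomputable def cutIntegral (m : Cn n → ℝ) (B : Set (Cn n)) (f : bergmanSpace n) : ℂ :=
  ∫ z in B, (m z : ℂ) * fn f z ∂(ballMeasure n)

include hm hm01 in
lemma integrable_cut (f : bergmanSpace n) :
    Integrable (fun z => (m z : ℂ) * fn f z) (ballMeasure n) := by
  refine (integrable_fn f).bdd_mul (c := 1) (Complex.measurable_ofReal.comp hm).aestronglyMeasurable
    (Filter.Eventually.of_forall fun z => ?_)
  simp only [Complex.norm_real, Real.norm_of_nonneg (hm01 z).1]
  exact (hm01 z).2

include hm hm01 in
lemma cutIntegral_add (B : Set (Cn n)) (f g : bergmanSpace n) :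
    cutIntegral m B (f + g) = cutIntegral m B f + cutIntegral m B g := by
  rw [cutIntegral, cutIntegral, cutIntegral, ← integral_add (integrable_cut hm hm01 f).integrableOn
    (integrable_cut hm hm01 g).integrableOn]
  refine integral_congr_ae (ae_restrict_of_ae ?_)
  filter_upwards [ae_mem_ball n] with z hz
  rw [fn_add f g hz, mul_add]

lemma cutIntegral_smul (m : Cn n → ℝ) (B : Set (Cn n)) (a : ℂ) (f : bergmanSpace n) :
    cutIntegral m B (a • f) = a * cutIntegral m B f := by
  rw [cutIntegral, cutIntegral, ← integral_const_mul]
  refine integral_congr_ae (ae_restrict_of_ae ?_)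
  filter_upwards [ae_mem_ball n] with z hz
  rw [fn_smul a f hz, mul_left_comm]

-- The cut-off vanishes for `|z| > δ`, and elsewhere the weight is at least `1 - δ²`. The
-- functionals are therefore bounded for the weighted norm as well.
include hm hm01 in
lemma enorm_cutIntegral_sq_le {δ : ℝ} (hδ0 : 0 < δ) (hδ : δ < 1)
    (hmδ : ∀ z ∈ ball n, δ < ‖z‖ → m z = 0) (B : Set (Cn n)) (f : bergmanSpace n) (κ : ℕ) :
    ‖cutIntegral m B f‖ₑ ^ 2 ≤ ENNReal.ofReal ((1 - δ ^ 2) ^ κ)⁻¹ *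
      ∫⁻ z, ‖fn f z‖ₑ ^ 2 * weight z ^ κ ∂(ballMeasure n) := by
  have hδ2 : 0 < 1 - δ ^ 2 := by nlinarith
  have h1 : ‖cutIntegral m B f‖ₑ ≤ ∫⁻ z, ‖(m z : ℂ) * fn f z‖ₑ ∂(ballMeasure n) :=
    (enorm_integral_le_lintegral_enorm _).trans (lintegral_mono' Measure.restrict_le_self le_rfl)
  have h2 := sq_lintegral_mul_le (μ := ballMeasure n) (f := fun _ => 1)
    (g := fun z => ‖(m z : ℂ) * fn f z‖ₑ) aemeasurable_const
    (integrable_cut hm hm01 f).aestronglyMeasurable.enorm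
  simp only [one_mul, one_pow, lintegral_const, measure_univ] at h2
  calc _ ≤ (∫⁻ z, ‖(m z : ℂ) * fn f z‖ₑ ∂(ballMeasure n)) ^ 2 := by gcongr
    _ ≤ ∫⁻ z, ‖(m z : ℂ) * fn f z‖ₑ ^ 2 ∂(ballMeasure n) := h2
    _ ≤ ∫⁻ z, ENNReal.ofReal ((1 - δ ^ 2) ^ κ)⁻¹ * (‖fn f z‖ₑ ^ 2 * weight z ^ κ)
          ∂(ballMeasure n) := by
        refine lintegral_mono_ae ?_
        filter_upwards [ae_mem_ball n] with z hz
        by_cases hzδ : δ < ‖z‖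
        · simp [hmδ z hz hzδ]
        have h3 : (1 : ℝ≥0∞) ≤ ENNReal.ofReal ((1 - δ ^ 2) ^ κ)⁻¹ * weight z ^ κ := by
          have ho : 0 < 1 - ‖z‖ ^ 2 := om_pos hz
          rw [weight, ← ENNReal.ofReal_pow ho.le, ← ENNReal.ofReal_mul (by positivity),
            ENNReal.one_le_ofReal, ← div_eq_inv_mul, one_le_div (by positivity)]
          have h5 : ‖z‖ ^ 2 ≤ δ ^ 2 := by
            have := not_lt.1 hzδ
            gcongr
          gcongr
        have h4 : ‖(m z : ℂ)‖ₑ ≤ 1 := by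
          rw [← ofReal_norm, Complex.norm_real, Real.norm_of_nonneg (hm01 z).1]
          exact ENNReal.ofReal_le_one.2 (hm01 z).2
        calc ‖(m z : ℂ) * fn f z‖ₑ ^ 2 ≤ (1 * ‖fn f z‖ₑ) ^ 2 * 1 := by
              rw [enorm_mul, mul_one]
              gcongr
          _ ≤ (1 * ‖fn f z‖ₑ) ^ 2 * (ENNReal.ofReal ((1 - δ ^ 2) ^ κ)⁻¹ * weight z ^ κ) := by gcongr
          _ = _ := by ring
    _ = _ := lintegral_const_mul' _ _ ENNReal.ofReal_ne_top

include hm hm01 in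
lemma integrable_star_mul_cut (u f : bergmanSpace n) :
    Integrable (fun z => (starRingEnd ℂ) (fn u z) * ((m z : ℂ) * fn f z)) (ballMeasure n) := by
  have h1 : Integrable (fun z => (starRingEnd ℂ) (fn u z) * fn f z) (ballMeasure n) :=
    (memLp_star_fn u).integrable_mul (memLp_fn f)
  refine (h1.bdd_mul (f := fun z => (m z : ℂ)) (c := 1)
    (Complex.measurable_ofReal.comp hm).aestronglyMeasurable
    (Filter.Eventually.of_forall fun z => ?_)).congr
    (Filter.Eventually.of_forall fun z => mul_left_comm _ _ _)
  rw [Complex.norm_real, Real.norm_of_nonneg (hm01 z).1]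
  exact (hm01 z).2

-- At a point with `|z| ≤ δ` exactly one set `B i` is active, and on it `u(z)` differs from `⟨u,
-- q_i⟩` by at most `η * ‖u‖`; at the other points of the ball `m` vanishes. Pairing `u` with the
-- cut-off of `f` is thus nearly pairing it with a combination of the `q_i`.
include hm hm01 in
lemma norm_integral_sub_sum_le {I : Ideal (MvPolynomial (Fin n) ℂ)} {δ η : ℝ}
    (hmδ : ∀ z ∈ ball n, δ < ‖z‖ → m z = 0) {k : ℕ} {B : Fin k → Set (Cn n)}
    {q : Fin k → MvPolynomial (Fin n) ℂ} (hB : ∀ i, MeasurableSet (B i))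
    (hdis : (Set.univ : Set (Fin k)).PairwiseDisjoint B) (hcov : Metric.closedBall 0 δ ⊆ ⋃ i, B i)
    (hq : ∀ i, ∀ w ∈ B i, ‖w‖ ≤ δ → ∀ u ∈ idealClosure I,
      ‖fn u w - inner ℂ (polyToBergman n (q i)) u‖ ≤ η * ‖u‖) (hη : 0 ≤ η)
    {u : bergmanSpace n} (hu : u ∈ idealClosure I) (f : bergmanSpace n) :
    ‖∫ z, (starRingEnd ℂ) (fn u z) * ((m z : ℂ) * fn f z) ∂(ballMeasure n) -
      ∑ i, cutIntegral m (B i) f * inner ℂ u (polyToBergman n (q i))‖ ≤ η * ‖u‖ * ‖f‖ := by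
  have hint := integrable_cut hm hm01 f
  have hint1 := integrable_star_mul_cut hm hm01 u f
  have hint2 : ∀ i, Integrable (fun z => (B i).indicator (fun z => (m z : ℂ) * fn f z) z *
      inner ℂ u (polyToBergman n (q i))) (ballMeasure n) := fun i =>
    (hint.indicator (hB i)).mul_const _
  have h0 : ∑ i, cutIntegral m (B i) f * inner ℂ u (polyToBergman n (q i)) =
      ∫ z, ∑ i, (B i).indicator (fun z => (m z : ℂ) * fn f z) z *
        inner ℂ u (polyToBergman n (q i)) ∂(ballMeasure n) := by
    rw [integral_finsetSum _ fun i _ => hint2 i]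
    refine Finset.sum_congr rfl fun i _ => ?_
    rw [integral_mul_const, integral_indicator (hB i), cutIntegral]
  rw [h0, ← integral_sub hint1 (integrable_finsetSum _ fun i _ => hint2 i)]
  refine (norm_integral_le_of_norm_le ((integrable_fn f).norm.const_mul (η * ‖u‖)) ?_).trans ?_
  · filter_upwards [ae_mem_ball n] with z hz
    by_cases hmz : m z = 0
    · have h1 : ∀ i, (B i).indicator (fun z => (m z : ℂ) * fn f z) z = 0 := fun i => by
        by_cases hzi : z ∈ B i <;> simp [hzi, hmz]
      simp only [h1, hmz, Complex.ofReal_zero, zero_mul, mul_zero, Finset.sum_const_zero, sub_zero,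
        norm_zero]
      positivity
    have hzδ : ‖z‖ ≤ δ := by
      by_contra! h
      exact hmz (hmδ z hz h)
    obtain ⟨i, hi⟩ := Set.mem_iUnion.1 (hcov (mem_closedBall_zero_iff.2 hzδ))
    rw [Finset.sum_eq_single i (fun j _ hj => by
      have : z ∉ B j := fun hzj =>
        Set.disjoint_left.1 (hdis (Set.mem_univ i) (Set.mem_univ j) hj.symm) hi hzj
      rw [Set.indicator_of_notMem this, zero_mul]) (fun h => (h (Finset.mem_univ i)).elim),
      Set.indicator_of_mem hi]
    have h1 : (starRingEnd ℂ) (fn u z) * ((m z : ℂ) * fn f z) -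
        (m z : ℂ) * fn f z * inner ℂ u (polyToBergman n (q i)) = (starRingEnd ℂ)
        (fn u z - inner ℂ (polyToBergman n (q i)) u) * ((m z : ℂ) * fn f z) := by
      have h3 : (starRingEnd ℂ) (inner ℂ (polyToBergman n (q i)) u) =
          inner ℂ u (polyToBergman n (q i)) :=
        inner_conj_symm (𝕜 := ℂ) (E := bergmanSpace n) u (polyToBergman n (q i))
      rw [map_sub, h3]
      ring
    rw [h1, norm_mul, norm_mul, RCLike.norm_conj, Complex.norm_real,
      Real.norm_of_nonneg (hm01 z).1]
    have h2 := hq i z hi hzδ u hu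
    exact mul_le_mul h2 (mul_le_of_le_one_left (norm_nonneg _) (hm01 z).2)
      (mul_nonneg (hm01 z).1 (norm_nonneg _)) (by positivity)
  · rw [integral_const_mul]
    gcongr
    exact integral_norm_fn_le f

lemma norm_integral_star_mul_le {u : bergmanSpace n} {a : Cn n → ℂ}
    (ha : AEMeasurable a (ballMeasure n)) {f : bergmanSpace n}
    (h : 16 * ∫⁻ z, ‖a z‖ₑ ^ 2 ∂(ballMeasure n) ≤ ‖f‖ₑ ^ 2) :
    ‖∫ z, (starRingEnd ℂ) (fn u z) * a z ∂(ballMeasure n)‖ ≤ 1 / 4 * ‖u‖ * ‖f‖ := by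
  have h1 := sq_lintegral_mul_le (μ := ballMeasure n) (f := fun z => ‖fn u z‖ₑ)
    (g := fun z => ‖a z‖ₑ) (memLp_fn u).aestronglyMeasurable.enorm ha.enorm
  rw [← enorm_sq_eq] at h1
  have h2 : ‖∫ z, (starRingEnd ℂ) (fn u z) * a z ∂(ballMeasure n)‖ₑ ≤
      ∫⁻ z, ‖fn u z‖ₑ * ‖a z‖ₑ ∂(ballMeasure n) := by
    refine (enorm_integral_le_lintegral_enorm _).trans (le_of_eq ?_)
    simp only [enorm_mul, RCLike.enorm_conj]
  have h3 : (4 * ‖∫ z, (starRingEnd ℂ) (fn u z) * a z ∂(ballMeasure n)‖ₑ) ^ 2 ≤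
      (‖u‖ₑ * ‖f‖ₑ) ^ 2 := by
    calc _ ≤ (4 * ∫⁻ z, ‖fn u z‖ₑ * ‖a z‖ₑ ∂(ballMeasure n)) ^ 2 := by gcongr
      _ = 16 * (∫⁻ z, ‖fn u z‖ₑ * ‖a z‖ₑ ∂(ballMeasure n)) ^ 2 := by
        rw [mul_pow]
        norm_num
      _ ≤ 16 * (‖u‖ₑ ^ 2 * ∫⁻ z, ‖a z‖ₑ ^ 2 ∂(ballMeasure n)) := by gcongr
      _ = ‖u‖ₑ ^ 2 * (16 * ∫⁻ z, ‖a z‖ₑ ^ 2 ∂(ballMeasure n)) := by ring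
      _ ≤ ‖u‖ₑ ^ 2 * ‖f‖ₑ ^ 2 := by gcongr
      _ = _ := by rw [mul_pow]
  have h4 := ENNReal.toReal_mono (by finiteness) h3
  simp only [ENNReal.toReal_pow, ENNReal.toReal_mul, toReal_enorm, ENNReal.toReal_ofNat] at h4
  have h5 := abs_le_of_sq_le_sq h4 (by positivity)
  have h6 := (le_abs_self _).trans h5
  linarith

end Compact


/-! ### From local to global division -/

section Division

variable {n : ℕ}

lemma norm_sq_eq_norm_inner_sub {E : Type*} [NormedAddCommGroup E] [InnerProductSpace ℂ E] {k : ℕ}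
    {u h : E} {a : Fin k → ℂ} {q : Fin k → E} (hu : u = h - ∑ i, a i • q i) :
    ‖u‖ ^ 2 = ‖inner ℂ u h - ∑ i, a i * inner ℂ u (q i)‖ := by
  have h1 : inner ℂ u u = inner ℂ u h - ∑ i, a i * inner ℂ u (q i) := by
    conv_lhs => rw [show inner ℂ u u = inner ℂ u (h - ∑ i, a i • q i) from congrArg _ hu]
    rw [inner_sub_right, inner_sum]
    simp only [inner_smul_right]
  rw [← h1, inner_self_eq_norm_sq_to_K]
  simp

/-- The Neumann series for the inverse of `1 - e`. -/
lemma exists_equiv_of_norm_le {E : Type*} [NormedAddCommGroup E] [NormedSpace ℂ E]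
    {P : Submodule ℂ E} [CompleteSpace P] (e : P →ₗ[ℂ] P)
    (he : ∀ f : P, ‖(e f : E)‖ ≤ 1 / 2 * ‖(f : E)‖) :
    ∃ T : P ≃L[ℂ] P, ∀ f, T f = f - e f := by
  set e' : P →L[ℂ] P := e.mkContinuous (1 / 2) he with he'
  have he1 : ‖e'‖ < 1 := lt_of_le_of_lt (e.mkContinuous_norm_le (by norm_num) he) (by norm_num)
  refine ⟨ContinuousLinearEquiv.unitsEquiv ℂ P (Units.oneSub e' he1), fun f => ?_⟩
  rw [ContinuousLinearEquiv.unitsEquiv_apply, Units.val_oneSub]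
  simp [he']

/-- The value of a function of the Bergman space at a point of the ball. -/
noncomputable def fnEval {z : Cn n} (hz : z ∈ ball n) : bergmanSpace n →ₗ[ℂ] ℂ where
  toFun f := fn f z
  map_add' f g := fn_add f g hz
  map_smul' a f := fn_smul a f hz

lemma fn_sum {k : ℕ} (a : Fin k → ℂ) (q : Fin k → bergmanSpace n) {z : Cn n} (hz : z ∈ ball n) :
    fn (∑ i, a i • q i) z = ∑ i, a i * fn (q i) z := by
  have h := map_sum (fnEval hz) (fun i => a i • q i) Finset.univ
  simp only [map_smul, smul_eq_mul] at h
  exact h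

lemma weight_pow_le_one (z : Cn n) (κ : ℕ) : weight z ^ κ ≤ 1 := by
  refine pow_le_one₀ zero_le ?_
  rw [weight]
  exact ENNReal.ofReal_le_one.2 (by nlinarith [sq_nonneg ‖z‖])

variable {I : Ideal (MvPolynomial (Fin n) ℂ)} {N M : ℕ} {R : ℝ} {D : Cover n N M R}
  {c : D.Idx → idealClosure I →ₗ[ℂ] (Cn n → ℂ)} {C₀ : ℝ}

lemma coef_map_add (hc : ∀ f, D.Admissible (fun x => c x f) C₀) (γ : ℂ) (f g : idealClosure I)
    (x : D.Idx) {z : Cn n} (hz : z ∈ ball n) :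
    D.coef (fun x => c x (f + g)) γ x z =
      D.coef (fun x => c x f) γ x z + D.coef (fun x => c x g) γ x z := by
  rw [← (hc f).coef_add (hc g) γ x hz]
  simp only [map_add]

lemma coef_map_smul (γ a : ℂ) (f : idealClosure I) (x : D.Idx) (z : Cn n) :
    D.coef (fun x => c x (a • f)) γ x z = a * D.coef (fun x => c x f) γ x z := by
  rw [← D.coef_smul]
  simp only [map_smul]

/-- The gluing operator. -/
lemma exists_glueMap (hI : ∀ x : D.Idx, D.p x.1 x.2 ∈ I)
    (hc : ∀ f, D.Admissible (fun x => c x f) C₀) (γ : ℂ) :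
    ∃ S : idealClosure I →ₗ[ℂ] idealClosure I, ∀ f, ∀ z ∈ ball n,
      fn (S f : bergmanSpace n) z = D.glue (fun x => c x f) γ z := by
  choose s hs hsfn using fun f : idealClosure I => (hc f).exists_fn_eq_glue hI γ
  refine ⟨{ toFun := fun f => ⟨s f, hs f⟩, map_add' := fun f g => ?_, map_smul' := fun a f => ?_ },
    fun f z hz => hsfn f z hz⟩
  · refine Subtype.ext (ext_of_fn fun z hz => ?_)
    rw [Submodule.coe_add, fn_add _ _ hz]
    simp only
    rw [hsfn _ z hz, hsfn _ z hz, hsfn _ z hz, Cover.glue, Cover.glue, Cover.glue,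
      ← ((hc f).summable γ hz).tsum_add ((hc g).summable γ hz)]
    simp only [coef_map_add hc γ f g _ hz, mul_add]
  · refine Subtype.ext (ext_of_fn fun z hz => ?_)
    rw [Submodule.coe_smul, RingHom.id_apply, fn_smul _ _ hz]
    simp only
    rw [hsfn _ z hz, hsfn _ z hz, Cover.glue, Cover.glue, ← tsum_mul_left]
    simp only [coef_map_smul, mul_left_comm]

/-- The finite rank operator given by integrals against a cut-off. -/
noncomputable def cutMap {m : Cn n → ℝ} (hm : Measurable m) (hm01 : ∀ z, 0 ≤ m z ∧ m z ≤ 1) {k : ℕ}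
    (B : Fin k → Set (Cn n)) (q : Fin k → idealClosure I) : idealClosure I →ₗ[ℂ] idealClosure I where
  toFun f := ∑ i, cutIntegral m (B i) (f : bergmanSpace n) • q i
  map_add' f g := by
    simp only [Submodule.coe_add, cutIntegral_add hm hm01, add_smul, Finset.sum_add_distrib]
  map_smul' a f := by
    simp only [Submodule.coe_smul, cutIntegral_smul, mul_smul, Finset.smul_sum, RingHom.id_apply]

lemma coe_cutMap {m : Cn n → ℝ} (hm : Measurable m) (hm01 : ∀ z, 0 ≤ m z ∧ m z ≤ 1) {k : ℕ}
    (B : Fin k → Set (Cn n)) (q : Fin k → idealClosure I) (f : idealClosure I) :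
    (cutMap hm hm01 B q f : bergmanSpace n) =
      ∑ i, cutIntegral m (B i) (f : bergmanSpace n) • (q i : bergmanSpace n) := by
  simp [cutMap]

lemma fn_cutMap {m : Cn n → ℝ} (hm : Measurable m) (hm01 : ∀ z, 0 ≤ m z ∧ m z ≤ 1) {k : ℕ}
    (B : Fin k → Set (Cn n)) (q : Fin k → idealClosure I) (f : idealClosure I) {z : Cn n}
    (hz : z ∈ ball n) :
    fn (cutMap hm hm01 B q f : bergmanSpace n) z =
      ∑ i, cutIntegral m (B i) (f : bergmanSpace n) * fn (q i : bergmanSpace n) z := by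
  rw [← fn_sum _ _ hz, coe_cutMap]

lemma lintegral_sum_sq_le {k : ℕ} {Q : ℝ≥0∞} {ℓ : Fin k → ℂ} {q : Fin k → Cn n → ℂ}
    (hq : ∀ i, ∀ z ∈ ball n, ‖q i z‖ₑ ≤ Q) {L : ℝ≥0∞} (hL : ∀ i, ‖ℓ i‖ₑ ^ 2 ≤ L) (κ : ℕ) :
    ∫⁻ z, (∑ i, ‖q i z * ℓ i‖ₑ) ^ 2 * weight z ^ κ ∂(ballMeasure n) ≤ (k * Q) ^ 2 * L := by
  calc _ ≤ ∫⁻ _, (k * Q) ^ 2 * L ∂(ballMeasure n) := by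
        refine lintegral_mono_ae ?_
        filter_upwards [ae_mem_ball n] with z hz
        have h1 : (∑ i, ‖q i z * ℓ i‖ₑ) ^ 2 ≤ k * ∑ i, ‖q i z * ℓ i‖ₑ ^ 2 := by
          have := sq_tsum_le (M := k) (a := fun i => ‖q i z * ℓ i‖ₑ) (s := Set.univ)
            (by simp [Set.encard_univ]) (by simp)
          simpa only [tsum_fintype] using this
        calc _ ≤ (k * ∑ i : Fin k, ‖q i z * ℓ i‖ₑ ^ 2) * 1 := by
              gcongr
              exact weight_pow_le_one z κ
          _ ≤ (k * ∑ i : Fin k, Q ^ 2 * L) * 1 := by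
              gcongr with i
              rw [enorm_mul, mul_pow]
              gcongr
              · exact hq i z hz
              · exact hL i
          _ = _ := by
              rw [Finset.sum_const, Finset.card_univ, Fintype.card_fin, nsmul_eq_mul]
              ring
    _ = _ := by simp

/-- The error `u` belongs to the closure of the ideal, so its norm can be measured by pairing it
with itself. This allows the non-holomorphic cut-off `m f` to be used in place of the finite rank
term: the two differ by at most `1 / 4` in such pairings, and `herr` contributes the other `1 / 4`,
since `16 = 4²`. -/
lemma norm_sub_glue_sub_cut_le {γ : ℂ} {δ : ℝ} (hmδ : ∀ z ∈ ball n, δ < ‖z‖ → D.m z = 0)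
    {f s : idealClosure I}
    (hs : ∀ z ∈ ball n, fn (s : bergmanSpace n) z = D.glue (fun x => c x f) γ z)
    (herr : 16 * ∫⁻ z, ‖fn (f : bergmanSpace n) z - D.glue (fun x => c x f) γ z -
      D.m z * fn (f : bergmanSpace n) z‖ₑ ^ 2 ∂(ballMeasure n) ≤ ‖(f : bergmanSpace n)‖ₑ ^ 2)
    {k : ℕ} {B : Fin k → Set (Cn n)}
    {q : Fin k → MvPolynomial (Fin n) ℂ} (hB : ∀ i, MeasurableSet (B i))
    (hdis : (Set.univ : Set (Fin k)).PairwiseDisjoint B) (hcov : Metric.closedBall 0 δ ⊆ ⋃ i, B i)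
    (hq : ∀ i, ∀ w ∈ B i, ‖w‖ ≤ δ → ∀ u ∈ idealClosure I,
      ‖fn u w - inner ℂ (polyToBergman n (q i)) u‖ ≤ 1 / 4 * ‖u‖)
    {u : bergmanSpace n} (huI : u ∈ idealClosure I) (hue : u = ((f : bergmanSpace n) - (s : bergmanSpace n)) -
        ∑ i, cutIntegral D.m (B i) (f : bergmanSpace n) • polyToBergman n (q i)) :
    ‖u‖ ≤ 1 / 2 * ‖(f : bergmanSpace n)‖ := by
  have h1 := norm_sq_eq_norm_inner_sub hue
  set a : Cn n → ℂ := fun z => fn (f : bergmanSpace n) z - fn (s : bergmanSpace n) z -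
    D.m z * fn (f : bergmanSpace n) z with ha
  have ham : AEMeasurable a (ballMeasure n) :=
    ((memLp_fn _).aestronglyMeasurable.aemeasurable.sub
      (memLp_fn _).aestronglyMeasurable.aemeasurable).sub
      (integrable_cut D.measurable_m D.m_mem _).aestronglyMeasurable.aemeasurable
  have hcut := integrable_star_mul_cut D.measurable_m D.m_mem u (f : bergmanSpace n)
  have h2 : inner ℂ u ((f : bergmanSpace n) - (s : bergmanSpace n)) =
      ∫ z, (starRingEnd ℂ) (fn u z) * a z ∂(ballMeasure n) +
      ∫ z, (starRingEnd ℂ) (fn u z) * (D.m z * fn (f : bergmanSpace n) z) ∂(ballMeasure n) := by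
    have h3 : Integrable (fun z => (starRingEnd ℂ) (fn u z) * fn ((f : bergmanSpace n) - (s : bergmanSpace n)) z)
      (ballMeasure n) := (memLp_star_fn u).integrable_mul (memLp_fn _)
    have h4 : (fun z => (starRingEnd ℂ) (fn u z) * fn ((f : bergmanSpace n) - (s : bergmanSpace n)) z -
        (starRingEnd ℂ) (fn u z) * (D.m z * fn (f : bergmanSpace n) z)) =ᵐ[ballMeasure n]
        fun z => (starRingEnd ℂ) (fn u z) * a z := by
      filter_upwards [ae_mem_ball n] with z hz
      rw [fn_sub _ _ hz, ha]
      ring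
    rw [← integral_add ((h3.sub hcut).congr h4) hcut, inner_eq_integral]
    refine integral_congr_ae ?_
    filter_upwards [ae_mem_ball n] with z hz
    rw [fn_sub _ _ hz, ha]
    ring
  have h5 : ‖∫ z, (starRingEnd ℂ) (fn u z) * a z ∂(ballMeasure n)‖ ≤
      1 / 4 * ‖u‖ * ‖(f : bergmanSpace n)‖ := by
    refine norm_integral_star_mul_le ham (le_trans (le_of_eq ?_) herr)
    congr 1
    refine lintegral_congr_ae ?_
    filter_upwards [ae_mem_ball n] with z hz
    rw [ha, ← hs z hz]
  have h6 := norm_integral_sub_sum_le D.measurable_m D.m_mem hmδ hB hdis hcov hq (by norm_num)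
    huI (f : bergmanSpace n)
  have h8 : ‖u‖ ^ 2 ≤ 1 / 2 * ‖u‖ * ‖(f : bergmanSpace n)‖ := by
    rw [h1, h2, add_sub_assoc]
    refine (norm_add_le _ _).trans ?_
    refine (add_le_add h5 h6).trans (le_of_eq ?_)
    ring
  by_cases h9 : ‖u‖ = 0
  · rw [h9]
    positivity
  · have h10 : 0 < ‖u‖ := lt_of_le_of_ne (norm_nonneg _) (Ne.symm h9)
    nlinarith

/-- The invertible operator is the gluing operator plus the finite rank operator. The polynomials of
the second occur as finitely many additional generators, with constants as coefficient functions. -/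
theorem exists_division (hI : ∀ x : D.Idx, D.p x.1 x.2 ∈ I)
    (hc : ∀ f, D.Admissible (fun x => c x f) C₀) (γ : ℂ) {δ : ℝ} (hδ0 : 0 < δ) (hδ1 : δ < 1)
    (hmδ : ∀ z ∈ ball n, δ < ‖z‖ → D.m z = 0) {K : ℝ≥0∞} (hK : K ≠ ∞)
    (hV : ∀ κ ≤ 1, ∀ f : idealClosure I,
      ∫⁻ w, D.V (fun x => c x f) w ^ 2 * weight w ^ κ ∂(ballMeasure n) ≤
        K * ∫⁻ z, ‖fn (f : bergmanSpace n) z‖ₑ ^ 2 * weight z ^ κ ∂(ballMeasure n))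
    (herr : ∀ f : idealClosure I, 16 * ∫⁻ z, ‖fn (f : bergmanSpace n) z -
      D.glue (fun x => c x f) γ z - D.m z * fn (f : bergmanSpace n) z‖ₑ ^ 2 ∂(ballMeasure n) ≤
        ‖(f : bergmanSpace n)‖ₑ ^ 2) :
    ∃ (Λ : Type) (h : Λ → bergmanSpace n), Countable Λ ∧ HasASDWith (idealClosure I) h ∧
      ∃ d : ℕ, ∀ i, ∃ q : MvPolynomial (Fin n) ℂ, q.totalDegree ≤ d ∧ h i = polyToBergman n q := by
  obtain ⟨S, hS⟩ := exists_glueMap hI hc γ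
  obtain ⟨k, B, q, hB, hdis, hcov, hqI, hq⟩ :=
    exists_finite_poly_repr I hδ1 (η := 1 / 4) (by norm_num)
  let qP : Fin k → idealClosure I := fun i =>
    ⟨polyToBergman n (q i), polyToBergman_mem_idealClosure (hqI i)⟩
  let V := cutMap D.measurable_m D.m_mem B qP
  let e : idealClosure I →ₗ[ℂ] idealClosure I := LinearMap.id - S - V
  have hnorm : ∀ f, ‖(e f : bergmanSpace n)‖ ≤ 1 / 2 * ‖(f : bergmanSpace n)‖ := fun f => by
    refine norm_sub_glue_sub_cut_le hmδ (hS f) (herr f) hB hdis hcov hq (e f).2 ?_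
    rw [← coe_cutMap D.measurable_m D.m_mem B qP f]
    rfl
  obtain ⟨T, hT⟩ := exists_equiv_of_norm_le e hnorm
  have hTf : ∀ f, T f = S f + V f := fun f => by
    rw [hT]
    change f - (f - S f - V f) = _
    abel
  let g : idealClosure I → D.Idx ⊕ Fin k → Cn n → ℂ := fun f =>
    Sum.elim (fun x => D.coef (fun x => c x f) γ x)
      (fun i _ => cutIntegral D.m (B i) (f : bergmanSpace n))
  let h : D.Idx ⊕ Fin k → MvPolynomial (Fin n) ℂ := Sum.elim (fun x => D.p x.1 x.2) q
  obtain ⟨Q, hQ⟩ : ∃ Q : ℝ, ∀ i, ∀ z ∈ ball n, ‖polyEval (q i) z‖ ≤ Q := by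
    choose b hb using fun i => (isCompact_closedBall (0 : Cn n) 1).exists_bound_of_continuousOn
      (differentiable_polyEval (q i)).continuous.continuousOn
    refine ⟨∑ i, |b i|, fun i z hz => (hb i z (Metric.ball_subset_closedBall hz)).trans
      ((le_abs_self _).trans ?_)⟩
    exact Finset.single_le_sum (f := fun i => |b i|) (fun i _ => abs_nonneg _) (Finset.mem_univ i)
  obtain ⟨A, hA0, hA⟩ := exists_hker_bound n
  -- One summand for the glued part and one for the finite rank part; the factors `2` come from
  -- squaring a sum of two terms.
  let C : ℕ → ℝ≥0∞ := fun κ => 2 * ((‖γ‖ₑ * ENNReal.ofReal C₀) ^ 2 * (ENNReal.ofReal A * K)) +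
    2 * ((k * ENNReal.ofReal Q) ^ 2 * ENNReal.ofReal ((1 - δ ^ 2) ^ κ)⁻¹)
  have hCtop : ∀ κ, C κ ≠ ∞ := fun κ => by
    simp only [C]
    finiteness
  have hbound : ∀ κ ≤ 1, ∀ f : idealClosure I,
      ∫⁻ z, (∑' i, ‖fn (polyToBergman n (h i)) z * g f i z‖ₑ) ^ 2 * weight z ^ κ ∂(ballMeasure n) ≤
      ENNReal.ofReal (C κ).toReal *
        ∫⁻ z, ‖fn (f : bergmanSpace n) z‖ₑ ^ 2 * weight z ^ κ ∂(ballMeasure n) := fun κ hκ f => by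
    rw [ENNReal.ofReal_toReal (hCtop κ)]
    set J := ∫⁻ z, ‖fn (f : bergmanSpace n) z‖ₑ ^ 2 * weight z ^ κ ∂(ballMeasure n) with hJ
    have hm2 : Measurable fun z => (∑ i, ‖polyEval (q i) z *
        cutIntegral D.m (B i) (f : bergmanSpace n)‖ₑ) ^ 2 * weight z ^ κ := by
      refine ((Finset.measurable_sum _ fun i _ => Measurable.enorm ?_).pow_const 2).mul
        (measurable_weight.pow_const κ)
      exact (differentiable_polyEval (q i)).continuous.measurable.mul_const _
    calc _ ≤ ∫⁻ z, (2 * ((∑' x, ‖D.P x z * D.coef (fun x => c x f) γ x z‖ₑ) ^ 2 * weight z ^ κ) +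
          2 * ((∑ i, ‖polyEval (q i) z * cutIntegral D.m (B i) (f : bergmanSpace n)‖ₑ) ^ 2 *
            weight z ^ κ)) ∂(ballMeasure n) := by
          refine lintegral_mono_ae ?_
          filter_upwards [ae_mem_ball n] with z hz
          rw [← mul_assoc, ← mul_assoc, ← add_mul]
          gcongr
          rw [ENNReal.summable.tsum_sum ENNReal.summable]
          simp only [g, h, Sum.elim_inl, Sum.elim_inr, fn_polyToBergman _ hz]
          rw [tsum_fintype fun i =>
            ‖polyEval (q i) z * cutIntegral D.m (B i) (f : bergmanSpace n)‖ₑ]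
          exact ennreal_add_sq_le _ _
      _ = 2 * ∫⁻ z, (∑' x, ‖D.P x z * D.coef (fun x => c x f) γ x z‖ₑ) ^ 2 * weight z ^ κ
            ∂(ballMeasure n) +
          2 * ∫⁻ z, (∑ i, ‖polyEval (q i) z * cutIntegral D.m (B i) (f : bergmanSpace n)‖ₑ) ^ 2 *
            weight z ^ κ ∂(ballMeasure n) := by
          rw [lintegral_add_right _ (hm2.const_mul 2), lintegral_const_mul' _ _ (by finiteness),
            lintegral_const_mul' _ _ (by finiteness)]
      _ ≤ 2 * ((‖γ‖ₑ * ENNReal.ofReal C₀) ^ 2 * (ENNReal.ofReal A * (K * J))) +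
          2 * ((k * ENNReal.ofReal Q) ^ 2 * (ENNReal.ofReal ((1 - δ ^ 2) ^ κ)⁻¹ * J)) := by
          gcongr
          · refine ((hc f).lintegral_tsum_sq_le γ (hA κ hκ)).trans ?_
            gcongr
            exact hV κ hκ f
          · refine lintegral_sum_sq_le (fun i z hz => ?_) (fun i => ?_) κ
            · rw [← ofReal_norm]
              exact ENNReal.ofReal_le_ofReal (hQ i z hz)
            · exact enorm_cutIntegral_sq_le D.measurable_m D.m_mem hδ0 hδ1 hmδ (B i) _ κ
      _ = C κ * J := by
          simp only [C]
          ring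
  refine ⟨D.Idx ⊕ Fin k, fun i => polyToBergman n (h i), inferInstance,
    ⟨isHilbertSubmodule_idealClosure, ?_, T, (C 0).toReal, (C 1).toReal, fun f =>
      ⟨g f, ?_, fun z hz => ?_, ?_, ?_⟩⟩, max N (Finset.univ.sup fun i => (q i).totalDegree), ?_⟩
  · rintro (x | i)
    · exact polyToBergman_mem_idealClosure (hI x)
    · exact polyToBergman_mem_idealClosure (hqI i)
  · rintro (x | i)
    · exact (hc f).differentiableOn_coef γ x
    · exact differentiableOn_const _
  · rw [hTf, Submodule.coe_add, fn_add _ _ hz, hS f z hz, fn_cutMap _ _ _ _ _ hz]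
    refine HasSum.sum ?_ ?_
    · refine ((hc f).summable γ hz).hasSum.congr_fun fun x => ?_
      simp only [Function.comp, g, h, Sum.elim_inl, fn_polyToBergman _ hz]
      rfl
    · have := hasSum_fintype fun i => cutIntegral D.m (B i) (f : bergmanSpace n) *
        fn (qP i : bergmanSpace n) z
      refine this.congr_fun fun i => ?_
      simp only [Function.comp, g, h, Sum.elim_inr, qP]
      rw [mul_comm]
  · simpa only [pow_zero, mul_one] using hbound 0 (by norm_num) f
  · simpa only [pow_one] using hbound 1 le_rfl f
  · rintro (x | i)
    · exact ⟨_, (D.degree_le _ _).trans (le_max_left _ _), rfl⟩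
    · exact ⟨_, (Finset.le_sup (f := fun i => (q i).totalDegree) (Finset.mem_univ i)).trans
        (le_max_right _ _), rfl⟩

end Division


/-! ### Sums over overlapping sets and the normalizing constant -/

section Constants

variable {n : ℕ}

lemma tsum_setLIntegral_le {Λ : Type*} [Countable Λ] {M : ℕ} {F : Λ → Set (Cn n)}
    (hF : ∀ i, MeasurableSet (F i)) (hM : ∀ z ∈ ball n, {i | z ∈ F i}.encard ≤ M)
    {g : Cn n → ℝ≥0∞} (hg : AEMeasurable g (ballMeasure n)) :
    ∑' i, ∫⁻ z in F i, g z ∂(ballMeasure n) ≤ M * ∫⁻ z, g z ∂(ballMeasure n) := by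
  calc _ = ∫⁻ z, ∑' i, (F i).indicator g z ∂(ballMeasure n) := by
        rw [lintegral_tsum fun i => hg.indicator (hF i)]
        refine tsum_congr fun i => ?_
        rw [lintegral_indicator (hF i)]
    _ ≤ ∫⁻ z, M * g z ∂(ballMeasure n) := by
        refine lintegral_mono_ae ?_
        filter_upwards [ae_mem_ball n] with z hz
        exact tsum_indicator_le (hM z hz) g
    _ = _ := lintegral_const_mul' _ _ (ENNReal.natCast_ne_top M)

/-- For `τ ≥ 1 / 2` the integral is at least its value at `1 / 2`. The bound on `γ` is uniform in
`τ`, so `τ` may be chosen afterwards in terms of it. -/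
lemma exists_inv_setIntegral_om_pow (n l : ℕ) : ∃ G : ℝ, 0 < G ∧ ∀ τ : ℝ, 1 / 2 ≤ τ → τ < 1 →
    ∃ γ : ℂ, ‖γ‖ ≤ G ∧ γ * ∫ u in Metric.ball 0 τ, (om u : ℂ) ^ l ∂(ballMeasure n) = 1 := by
  have hint : Integrable (fun u : Cn n => om u ^ l) (ballMeasure n) := by
    refine (integrable_const (1 : ℝ)).mono' (continuous_om.pow l).aestronglyMeasurable ?_
    filter_upwards [ae_mem_ball n] with z hz
    rw [norm_pow, Real.norm_of_nonneg (om_pos hz).le]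
    exact pow_le_one₀ (om_pos hz).le (om_le_one z)
  have hnn : ∀ᵐ u ∂(ballMeasure n), 0 ≤ om u ^ l := by
    filter_upwards [ae_mem_ball n] with z hz
    exact (pow_pos (om_pos hz) l).le
  set j : ℝ := ∫ u in Metric.ball (0 : Cn n) (1 / 2), om u ^ l ∂(ballMeasure n) with hj
  have hj0 : 0 < j := by
    have hpos : 0 < ballMeasure n (Metric.ball (0 : Cn n) (1 / 2)) := by
      rw [ballMeasure, Measure.smul_apply, Measure.restrict_apply Metric.isOpen_ball.measurableSet,
        Set.inter_eq_left.2 (show Metric.ball (0 : Cn n) (1 / 2) ⊆ ball n from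
          Metric.ball_subset_ball (by norm_num)), smul_eq_mul]
      exact ENNReal.mul_pos (ENNReal.inv_ne_zero.2 measure_ball_lt_top.ne)
        (Metric.measure_ball_pos volume _ (by norm_num)).ne'
    rw [hj, setIntegral_pos_iff_support_of_nonneg_ae (ae_restrict_of_ae hnn) hint.integrableOn,
      Set.inter_eq_right.2]
    · exact hpos
    · intro z hz
      have hz' : z ∈ ball n := Metric.ball_subset_ball (by norm_num) hz
      exact (pow_pos (om_pos hz') l).ne'
  refine ⟨j⁻¹, inv_pos.2 hj0, fun τ hτ hτ1 => ?_⟩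
  have hjτ : j ≤ ∫ u in Metric.ball (0 : Cn n) τ, om u ^ l ∂(ballMeasure n) :=
    setIntegral_mono_set hint.integrableOn (ae_restrict_of_ae hnn)
      (Metric.ball_subset_ball hτ).eventuallyLE
  have hcast : ∫ u in Metric.ball (0 : Cn n) τ, (om u : ℂ) ^ l ∂(ballMeasure n) =
      ((∫ u in Metric.ball (0 : Cn n) τ, om u ^ l ∂(ballMeasure n) : ℝ) : ℂ) := by
    rw [← integral_complex_ofReal]
    simp only [Complex.ofReal_pow]
  set t := ∫ u in Metric.ball (0 : Cn n) τ, om u ^ l ∂(ballMeasure n)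
  have ht : 0 < t := hj0.trans_le hjτ
  refine ⟨(t : ℂ)⁻¹, ?_, ?_⟩
  · rw [norm_inv, Complex.norm_real, Real.norm_of_nonneg ht.le]
    gcongr
  · rw [hcast]
    exact inv_mul_cancel₀ (by exact_mod_cast ht.ne')

end Constants

/-! ### From local decompositions to covers with linear coefficients -/

section LocalDecomposition

variable {n : ℕ} {I : Ideal (MvPolynomial (Fin n) ℂ)} {N M : ℕ} {C ε R δ C' : ℝ} {Λ : Type}
  {Γ : Λ → Type} {E F : Λ → Set (Cn n)} {p : (i : Λ) → Γ i → MvPolynomial (Fin n) ℂ}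

namespace IsLocalDecomposition

lemma E_subset_ball (h : IsLocalDecomposition I N M C ε R δ C' E F p) (i : Λ) : E i ⊆ ball n :=
  (h.E_subset i).trans (h.F_subset i)

lemma encard_le (h : IsLocalDecomposition I N M C ε R δ C' E F p) {r : ℝ} (hr : r ≤ 3 * R) {z : Cn n}
    (hz : z ∈ ball n) : {i | z ∈ bergmanNhd (E i) r}.encard ≤ M :=
  (Set.encard_le_encard fun i hi => h.nhd_subset i (bergmanNhd_mono hr hi)).trans (h.overlap z hz)

/-- Coefficients of zero polynomials are reset to zero, which changes no product and secures
`Admissible.eq_zero`. The unweighted bound keeps its own constant `C`, because `C'` may depend on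
`ε` and `R` and must not enter the smallness argument. -/
lemma exists_coefficients (h : IsLocalDecomposition I N M C ε R δ C' E F p) :
    ∃ c : (x : Σ i, Γ i) → idealClosure I →ₗ[ℂ] (Cn n → ℂ), (∀ x, p x.1 x.2 = 0 → c x = 0) ∧
      ∀ (f : idealClosure I) (i : Λ),
        (∀ j, DifferentiableOn ℂ (c ⟨i, j⟩ f) (bergmanNhd (E i) (3 * R))) ∧
        ∫⁻ z in bergmanNhd (E i) (3 * R),
            ‖(∑' j, polyEval (p i j) z * c ⟨i, j⟩ f z) - fn (f : bergmanSpace n) z‖ₑ ^ 2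
              ∂(ballMeasure n) ≤
          ENNReal.ofReal ε * ∫⁻ z in F i, ‖fn (f : bergmanSpace n) z‖ₑ ^ 2 ∂(ballMeasure n) ∧
        ∀ κ ≤ 1, ∫⁻ z in bergmanNhd (E i) (3 * R),
            (∑' j, ‖polyEval (p i j) z * c ⟨i, j⟩ f z‖ₑ) ^ 2 * weight z ^ κ ∂(ballMeasure n) ≤
          ENNReal.ofReal (if κ = 0 then C else C') *
            ∫⁻ z in F i, ‖fn (f : bergmanSpace n) z‖ₑ ^ 2 * weight z ^ κ ∂(ballMeasure n) := by
  classical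
  choose L hL using h.decomposition
  refine ⟨fun x => if p x.1 x.2 = 0 then 0 else L x.1 x.2, fun x hx => if_pos hx, fun f i => ?_⟩
  obtain ⟨h1, h2, h3, h4⟩ := hL i f
  have hmul : ∀ j z, polyEval (p i j) z *
      (if p i j = 0 then (0 : idealClosure I →ₗ[ℂ] (Cn n → ℂ)) else L i j) f z =
      polyEval (p i j) z * L i j f z := fun j z => by
    split_ifs with h0
    · simp [h0, polyEval]
    · rfl
  refine ⟨fun j => ?_, ?_, fun κ hκ => ?_⟩
  · simp only
    split_ifs
    · exact differentiableOn_const _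
    · exact h1 j
  · simp only [hmul]
    exact h2
  · simp only [hmul]
    interval_cases κ
    · simpa using h3
    · simpa using h4

/-- A local decomposition, as a cover with a partition of unity and linear coefficient maps. -/
lemma exists_cover (hΛ : Countable Λ) (hΓ : ∀ i, Countable (Γ i))
    (h : IsLocalDecomposition I N M C ε R δ C' E F p) (hR0 : 0 < R)
    (hR : 1 / 2 * Real.log ((1 + 1 / 2) / (1 - 1 / 2)) ≤ R) :
    ∃ (D : Cover n N M R) (F : D.Λ → Set (Cn n)) (c : D.Idx → idealClosure I →ₗ[ℂ] (Cn n → ℂ)),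
      (∀ z ∈ ball n, δ < ‖z‖ → D.m z = 0) ∧ (∀ i, MeasurableSet (F i)) ∧
      (∀ z ∈ ball n, {i | z ∈ F i}.encard ≤ M) ∧ (∀ x : D.Idx, D.p x.1 x.2 ∈ I) ∧
      (∀ x, D.p x.1 x.2 = 0 → c x = 0) ∧ (∀ f x, DifferentiableOn ℂ (c x f) (D.U x.1)) ∧
      ∀ (f : idealClosure I) (i : D.Λ),
        ∫⁻ z in D.U i,
            ‖(∑' j, polyEval (D.p i j) z * c ⟨i, j⟩ f z) - fn (f : bergmanSpace n) z‖ₑ ^ 2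
              ∂(ballMeasure n) ≤
          ENNReal.ofReal ε * ∫⁻ z in F i, ‖fn (f : bergmanSpace n) z‖ₑ ^ 2 ∂(ballMeasure n) ∧
        ∀ κ ≤ 1, ∫⁻ z in D.U i,
            (∑' j, ‖polyEval (D.p i j) z * c ⟨i, j⟩ f z‖ₑ) ^ 2 * weight z ^ κ ∂(ballMeasure n) ≤
          ENNReal.ofReal (if κ = 0 then C else C') *
            ∫⁻ z in F i, ‖fn (f : bergmanSpace n) z‖ₑ ^ 2 * weight z ^ κ ∂(ballMeasure n) := by
  obtain ⟨χ, m, h1, h2, h3, h4, h5, h6, h7, h8⟩ := exists_partition h.E_subset_ball hR0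
    (fun z hz => h.encard_le (by linarith) hz)
  obtain ⟨c, hc0, hc⟩ := h.exists_coefficients
  exact ⟨⟨Λ, Γ, E, p, χ, m, hΛ, hΓ, h.E_subset_ball, fun i j => (h.degree_lt i j).le,
    fun _ hz => h.encard_le le_rfl hz, h1, h2, h3, h4, h5, h6, h8, hR⟩, F, c,
    fun z hz hzδ => h7 z (h.cover_E ⟨hz, hzδ⟩), fun i => (h.isOpen_F i).measurableSet, h.overlap,
    fun x => h.mem_ideal x.1 x.2, hc0, fun f x => (hc f x.1).1 x.2, fun f i => (hc f i).2⟩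

end IsLocalDecomposition

lemma lintegral_V_sq_le_of_local {D : Cover n N M R} {c : D.Idx → Cn n → ℂ}
    (hc : ∀ x, DifferentiableOn ℂ (c x) (D.U x.1)) {f : bergmanSpace n} {F : D.Λ → Set (Cn n)}
    (hF : ∀ i, MeasurableSet (F i)) (hM : ∀ z ∈ ball n, {i | z ∈ F i}.encard ≤ M) {κ : ℕ} (hκ : κ ≤ 1)
    {K : ℝ≥0∞} (hK : ∀ i, ∫⁻ z in D.U i,
      (∑' j, ‖polyEval (D.p i j) z * c ⟨i, j⟩ z‖ₑ) ^ 2 * weight z ^ κ ∂(ballMeasure n) ≤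
        K * ∫⁻ z in F i, ‖fn f z‖ₑ ^ 2 * weight z ^ κ ∂(ballMeasure n)) :
    ∫⁻ w, D.V c w ^ 2 * weight w ^ κ ∂(ballMeasure n) ≤
      M * (ENNReal.ofReal (6 ^ (n + 2)) * (K * M)) *
        ∫⁻ z, ‖fn f z‖ₑ ^ 2 * weight z ^ κ ∂(ballMeasure n) := by
  calc _ ≤ _ := D.lintegral_V_sq_le hc hκ
    _ ≤ M * (ENNReal.ofReal (6 ^ (n + 2)) * ∑' i, K *
          ∫⁻ z in F i, ‖fn f z‖ₑ ^ 2 * weight z ^ κ ∂(ballMeasure n)) := by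
        gcongr with i
        exact hK i
    _ ≤ M * (ENNReal.ofReal (6 ^ (n + 2)) * (K * (M *
          ∫⁻ z, ‖fn f z‖ₑ ^ 2 * weight z ^ κ ∂(ballMeasure n)))) := by
        rw [ENNReal.tsum_mul_left]
        gcongr
        exact tsum_setLIntegral_le hF hM (((memLp_fn f).aestronglyMeasurable.enorm.pow_const 2).mul
          (measurable_weight.pow_const κ).aemeasurable)
    _ = _ := by ring

/-- Smallness of the error is reduced to the single real inequality `hconst`. -/
lemma err_const_le {M : ℕ} {A G C₀ C a ε θ lam : ℝ} {X S Y : ℝ≥0∞} {g : ℝ≥0∞} (hA : 0 ≤ A)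
    (hG : 0 ≤ G) (hC₀ : 0 ≤ C₀) (hC : 0 ≤ C) (ha : 0 ≤ a) (hε : 0 ≤ ε) (hθ : 0 ≤ θ)
    (hconst : 16 * (2 * (M * (ε * M)) +
      4 * A * (θ + lam ^ 2) * (G * C₀) ^ 2 * (M * (a * (C * M)))) ≤ 1)
    (hg : g ≤ ENNReal.ofReal G) (hS : S ≤ ENNReal.ofReal ε * (M * X))
    (hY : Y ≤ M * (ENNReal.ofReal a * (ENNReal.ofReal C * M)) * X) :
    16 * (2 * (M * S) + ENNReal.ofReal (4 * A * (θ + lam ^ 2)) *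
      (g * ENNReal.ofReal C₀) ^ 2 * Y) ≤ X := by
  calc _ ≤ 16 * (2 * (M * (ENNReal.ofReal ε * (M * X))) + ENNReal.ofReal (4 * A * (θ + lam ^ 2)) *
      (ENNReal.ofReal G * ENNReal.ofReal C₀) ^ 2 *
        (M * (ENNReal.ofReal a * (ENNReal.ofReal C * M)) * X)) := by gcongr
    _ = 16 * (2 * (M * (ENNReal.ofReal ε * M)) + ENNReal.ofReal (4 * A * (θ + lam ^ 2)) *
      (ENNReal.ofReal G * ENNReal.ofReal C₀) ^ 2 *
        (M * (ENNReal.ofReal a * (ENNReal.ofReal C * M)))) * X := by ring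
    _ = ENNReal.ofReal (16 * (2 * (M * (ε * M)) +
      4 * A * (θ + lam ^ 2) * (G * C₀) ^ 2 * (M * (a * (C * M))))) * X := by
        congr 1
        have hM : (0 : ℝ) ≤ M := Nat.cast_nonneg M
        have hMe : (M : ℝ≥0∞) = ENNReal.ofReal M := (ENNReal.ofReal_natCast M).symm
        have h16 : (16 : ℝ≥0∞) = ENNReal.ofReal 16 := by norm_num
        have h2 : (2 : ℝ≥0∞) = ENNReal.ofReal 2 := by norm_num
        rw [hMe, h16, h2]
        repeat first
          | rw [← ENNReal.ofReal_mul (by positivity)]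
          | rw [← ENNReal.ofReal_pow (by positivity)]
          | rw [← ENNReal.ofReal_add (by positivity) (by positivity)]
    _ ≤ 1 * X := by
        gcongr
        rw [← ENNReal.ofReal_one]
        exact ENNReal.ofReal_le_ofReal hconst
    _ = X := one_mul X

end LocalDecomposition

end BergmanASD

/-! ### Choice of the constants and conclusion -/

open BergmanASD in
theorem theorem3p3 {n : ℕ} (I : Ideal (MvPolynomial (Fin n) ℂ))
    (hI : BergmanASD.HasLocalDecompositions I) :
    ∃ (Λ : Type) (h : Λ → BergmanASD.bergmanSpace n), Countable Λ ∧
      BergmanASD.HasASDWith (BergmanASD.idealClosure I) h ∧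
      ∃ d : ℕ, ∀ i, ∃ q : MvPolynomial (Fin n) ℂ,
        q.totalDegree ≤ d ∧ h i = BergmanASD.polyToBergman n q := by
  obtain ⟨N, M, C, -, -, hC, ε₀, hε₀, hI⟩ := hI
  obtain ⟨C₀, hC₀, hker⟩ := Cover.exists_kernel_bound n N
  obtain ⟨A, hA, hfar⟩ := exists_farKer_bound n
  obtain ⟨G, hG, hγ⟩ := exists_inv_setIntegral_om_pow n (N + (n + 2))
  -- The coefficient of `θ + lam²` in the error estimate. It involves only constants that are fixed
  -- before `ε` and `R`.
  obtain ⟨B, hB, hB0⟩ : ∃ B : ℝ, B = 4 * A * (G * C₀) ^ 2 * (M * (6 ^ (n + 2) * (C * M))) ∧ 0 ≤ B :=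
    ⟨_, rfl, by positivity⟩
  -- The number `s` serves both as `θ` and as `lam`. The far and near parts then contribute at most
  -- `2 / 64`, the local errors `2 / 64`, and `16 * (4 / 64) = 1`.
  obtain ⟨s, hs0, hs1, hsB⟩ : ∃ s : ℝ, 0 < s ∧ s ≤ 1 / 64 ∧ B * s ≤ 1 / 64 :=
    ⟨1 / (64 * (B + 1)), by positivity,
      one_div_le_one_div_of_le (by norm_num) (by linarith), by
        rw [mul_one_div, div_le_div_iff₀ (by positivity) (by norm_num)]
        linarith⟩
  -- This choice gives `1 - τ² ≤ s⁴` and `τ ≥ 1 / 2`.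
  obtain ⟨τ, hτ⟩ : ∃ τ : ℝ, τ = 1 - s ^ 4 / 2 := ⟨_, rfl⟩
  have hs4 : s ^ 4 ≤ 1 := pow_le_one₀ hs0.le (by linarith)
  have hs4' : 0 < s ^ 4 := by positivity
  have hτ1 : τ < 1 := by linarith
  have hτ2 : 1 / 2 ≤ τ := by linarith
  obtain ⟨γ, hγG, hγ1⟩ := hγ τ hτ2 hτ1
  obtain ⟨ε, hε, hεε₀, hεM⟩ : ∃ ε : ℝ, 0 < ε ∧ ε < ε₀ ∧ (M * (ε * M) : ℝ) ≤ 1 / 64 := by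
    refine ⟨min (ε₀ / 2) (1 / (64 * (M ^ 2 + 1))), by positivity,
      (min_le_left _ _).trans_lt (by linarith), ?_⟩
    calc (M * (min (ε₀ / 2) (1 / (64 * (M ^ 2 + 1))) * M) : ℝ)
        ≤ M * (1 / (64 * (M ^ 2 + 1)) * M) := by
          gcongr
          exact min_le_right _ _
      _ = M ^ 2 / (64 * (M ^ 2 + 1)) := by ring
      _ ≤ 1 / 64 := by
          rw [div_le_div_iff₀ (by positivity) (by norm_num)]
          linarith
  obtain ⟨R₀, hR₀, hR₀'⟩ := hI ε hε hεε₀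
  obtain ⟨b, hb⟩ : ∃ b : ℝ, b = 1 / 2 * Real.log ((1 + τ) / (1 - τ)) := ⟨_, rfl⟩
  -- Besides `R > R₀`, the radius must exceed that of the averaging discs and the diameter bound `2
  -- b` of the discs `ρ < τ`, and make the oscillation `(2 M + 1) b / R` of the partition functions
  -- at most `s`.
  obtain ⟨R, hRR₀, hR1, hR2, hR3⟩ : ∃ R : ℝ, R₀ < R ∧
      1 / 2 * Real.log ((1 + 1 / 2) / (1 - 1 / 2)) ≤ R ∧ 2 * b ≤ R ∧ (2 * M + 1) * b / s ≤ R := by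
    refine ⟨max (R₀ + 1) (max (1 / 2 * Real.log ((1 + 1 / 2) / (1 - 1 / 2)))
      (max (2 * b) ((2 * M + 1) * b / s))), ?_, ?_, ?_, ?_⟩ <;> simp
  have hR0 : 0 < R := hR₀.trans hRR₀
  obtain ⟨δ, C', hδ0, hδ1, hC', Λ, Γ, hΛ, hΓ, E, F, p, hloc⟩ := hR₀' R hRR₀
  obtain ⟨D, F, c, hm, hF, hFM, hpI, hc0, hcd, hest⟩ := hloc.exists_cover hΛ hΓ hR0 hR1
  have hV : ∀ κ ≤ 1, ∀ f : idealClosure I, _ := fun κ hκ f =>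
    lintegral_V_sq_le_of_local (hcd f) hF hFM hκ fun i => (hest f i).2 κ hκ
  have hadm : ∀ f, D.Admissible (fun x => c x f) C₀ := fun f =>
    ⟨hcd f, fun x hx => by simp [hc0 x hx], by
      have h1 := hV 0 (by norm_num) f
      simp only [pow_zero, mul_one] at h1
      refine ne_top_of_le_ne_top ?_ h1
      rw [← enorm_sq_eq]
      finiteness, hker M R D _ (hcd f)⟩
  -- Here `K` serves only for boundedness in both norms, so `C'` may enter.
  refine exists_division hpI hadm γ hδ0 hδ1 hm
    (K := M * (ENNReal.ofReal (6 ^ (n + 2)) * (ENNReal.ofReal (max C C') * M))) (by finiteness)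
    (fun κ hκ f => (hV κ hκ f).trans ?_) fun f => ?_
  · gcongr
    split_ifs
    · exact le_max_left _ _
    · exact le_max_right _ _
  · have h1 := (hadm f).lintegral_err_sq_le hA.le (fun θ hθ g hg => by
      simpa only [pow_zero, mul_one] using hfar θ hθ 0 (by norm_num) g hg)
      (by linarith) hτ1 hs0 (by nlinarith) (hb ▸ hR2) hs0.le (by
        rw [← hb, div_mul_eq_mul_div, div_le_iff₀ hR0]
        rwa [div_le_iff₀ hs0, mul_comm R] at hR3) hγ1
      (differentiableOn_fn (f : bergmanSpace n)).continuousOn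
    have h2 := hV 0 (by norm_num) f
    simp only [pow_zero, mul_one, if_true] at h2
    rw [← enorm_sq_eq] at h2
    refine (mul_le_mul_right h1 16).trans (err_const_le (a := 6 ^ (n + 2)) hA.le hG.le hC₀ hC.le
      (by positivity) hε.le hs0.le ?_ ?_ ?_ h2)
    · have h3 : B * s ^ 2 ≤ 1 / 64 := by
        have : B * s ^ 2 ≤ B * s := by
          gcongr
          nlinarith
        linarith
      have h4 : 4 * A * (s + s ^ 2) * (G * C₀) ^ 2 * (M * (6 ^ (n + 2) * (C * M))) =
          B * s + B * s ^ 2 := by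
        rw [hB]
        ring
      rw [h4]
      linarith
    · rw [← ofReal_norm]
      exact ENNReal.ofReal_le_ofReal hγG
    · calc _ ≤ ∑' i, ENNReal.ofReal ε *
            ∫⁻ z in F i, ‖fn (f : bergmanSpace n) z‖ₑ ^ 2 ∂(ballMeasure n) :=
            ENNReal.tsum_le_tsum fun i => (hest f i).1
        _ ≤ _ := by
            rw [ENNReal.tsum_mul_left, enorm_sq_eq]
            gcongr
            exact tsum_setLIntegral_le hF hFM ((memLp_fn _).aestronglyMeasurable.enorm.pow_const 2)
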